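/- All $C^*$-algebras are complex, homomorphisms are $*$-homomorphisms, and $M_n=M_n(\mathbb C)$. **DSH algebras.** Let $X_1,\dots,X_l$ ($l\ge 1$) be compact Hausdorff spaces, $Y_i\subseteq X_i$ closed subsets for $2\le i\le l$, and $n_1,\dots,n_l\ge 1$ integers. Put $A_1=C(X_1,M_{n_1})$. Suppose that, recursively for $i=1,\dots,l-1$, a homomorphism $\phi_i:A_i\to C(Y_{i+1},M_{n_{i+1}})$ is given such that for every $y\in Y_{i+1}$ there is a finite ordered list of points $x_1,\dots,x_t$ with $x_k\in X_{i_k}$, $i_k\le i$, $n_{i_1}+\dots+n_{i_t}=n_{i+1}$, satisfying $$\phi_i(f)(y)=\mathrm{diag}\bigl(f_{i_1}(x_1),\dots,f_{i_t}(x_t)\bigr)\qquad\text{for all } f\in A_i,$$ and that $$A_{i+1}=\{(a,g)\in A_i\oplus C(X_{i+1},M_{n_{i+1}}):\ \phi_i(a)=g|_{Y_{i+1}}\}\subseteq\bigoplus_{j\le i+1}C(X_j,M_{n_j}).$$ Here $f_j$ denotes the component of $f$ in $C(X_j,M_{n_j})$. The $C^*$-algebra $A_l$ is then called a diagonal subhomogeneous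 (DSH) algebra; it is considered together with this composition sequence. **Diagonal maps.** Let $A\subseteq\bigoplus_i C(X_i,M_{n_i})$ and $B\subseteq\bigoplus_i C(X_i',M_{n_i'})$ be DSH algebras. A homomorphism $\phi:A\to B$ is diagonal if for every $i$ and every $x\in X_i'$ there are points $x_1,\dots,x_t$ with $x_k\in X_{i_k}$ and $n_{i_1}+\dots+n_{i_t}=n_i'$ such that $$\phi(f)_i(x)=\mathrm{diag}\bigl(f_{i_1}(x_1),\dots,f_{i_t}(x_t)\bigr)\qquad\text{for all } f\in A.$$ **Theorem.** Let $(A_j)_{j\in\mathbb N}$ be a sequence of DSH algebras with diagonal (not necessarily injective) connecting maps $\phi_j:A_j\to A_{j+1}$, and let $A=\varinjlim(A_j,\phi_j)$ be the $C^*$-algebraic inductive limit. If $A$ is simple (that is, $A\ne 0$ and the only closed two-sided ideals of $A$ are $0$ and $A$), then $A$ has stable rank one, that is, the invertible elements of $A$ are dense in $A$. -/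

import Mathlib

open scoped Matrix.Norms.L2Operator
open Filter Topology

universe u v

namespace DSH

/-- `Mat n` is the C*-algebra `M_n` of complex `n × n` matrices (with the operator norm). -/
abbrev Mat (n : ℕ) : Type := Matrix (Fin n) (Fin n) ℂ

/-- The block diagonal matrix `diag (B 0, …, B (t - 1))`, with the blocks in this order, of total
size `N = m 0 + ⋯ + m (t - 1)`. -/
def diag {t : ℕ} (m : Fin t → ℕ) {N : ℕ} (h : ∑ k, m k = N) (B : ∀ k, Mat (m k)) : Mat N :=
  Matrix.reindex (finSigmaFinEquiv.trans (finCongr h)) (finSigmaFinEquiv.trans (finCongr h))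
    (Matrix.blockDiagonal' B)

/-- The direct sum `⨁ i, C(X i, M_{n i})` over a finite index set, with pointwise operations and
the supremum norm. -/
abbrev Sections {l : ℕ} (X : Fin l → Type u) [∀ i, TopologicalSpace (X i)] (n : Fin l → ℕ) :
    Type u :=
  ∀ i, C(X i, Mat (n i))

/-- A finite ordered list of points `x 0, …, x (t - 1)`, where `x k` lies in `X (i k)` for some
`i k`, whose dimensions `n (i k)` add up to `N`. -/
structure PointList {l : ℕ} (X : Fin l → Type u) (n : Fin l → ℕ) (N : ℕ) where
  t : ℕ
  pt : Fin t → Σ i, X i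
  sum_dim : ∑ k, n (pt k).1 = N

/-- `L.eval f = diag (f_{i 0} (x 0), …, f_{i (t - 1)} (x (t - 1)))`. -/
noncomputable def PointList.eval {l : ℕ} {X : Fin l → Type u} [∀ i, TopologicalSpace (X i)] {n : Fin l → ℕ}
    {N : ℕ} (L : PointList X n N) (f : Sections X n) : Mat N :=
  diag (fun k => n (L.pt k).1) L.sum_dim (fun k => f (L.pt k).1 (L.pt k).2)

/-- The data of a composition sequence of a diagonal subhomogeneous algebra:
compact Hausdorff spaces `X i`, closed subsets `Y i ⊆ X i`, dimensions `n i ≥ 1`, and for each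
`y ∈ Y i` an ordered list of points in spaces of strictly earlier stages.

Writing `A_i ⊆ ⨁_{j < i} C(X j, M_{n j})` for the algebra obtained from the stages before `i`,
the field `continuous_eval` says that `φ_i (f) (y) = (list i y).eval f` defines a map
`φ_i : A_i → C(Y i, M_{n i})`; being given pointwise by block diagonal matrices, it is a unital
`*`-homomorphism. (An `f` in `⨁_j C(X j, M_{n j})` over all stages is used to represent its part
at the stages `j < i`; by `list_lt`, nothing else of `f` enters.)
At the first stage there are no earlier points, so that `Y 0` is empty by `n_pos`. -/
structure CompositionSequence where
  length : ℕ
  length_pos : 0 < length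
  X : Fin length → Type u
  [topologicalSpace : ∀ i, TopologicalSpace (X i)]
  [compactSpace : ∀ i, CompactSpace (X i)]
  [t2Space : ∀ i, T2Space (X i)]
  n : Fin length → ℕ
  n_pos : ∀ i, 0 < n i
  Y : ∀ i, Set (X i)
  isClosed_Y : ∀ i, IsClosed (Y i)
  list : ∀ i, Y i → PointList X n (n i)
  list_lt : ∀ i (y : Y i) k, ((list i y).pt k).1 < i
  continuous_eval : ∀ i (f : Sections X n),
    (∀ j < i, ∀ y : Y j, f j y = (list j y).eval f) →
      Continuous fun y : Y i => (list i y).eval f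

attribute [instance] CompositionSequence.topologicalSpace CompositionSequence.compactSpace
  CompositionSequence.t2Space

section Lemmas

variable {l : ℕ} {X : Fin l → Type u} [∀ i, TopologicalSpace (X i)] {n : Fin l → ℕ}
  {N : ℕ} (L : PointList X n N)

theorem PointList.eval_add (f g : Sections X n) : L.eval (f + g) = L.eval f + L.eval g := by
  have h : (fun k => (f + g) (L.pt k).1 (L.pt k).2) =
      (fun k => f (L.pt k).1 (L.pt k).2) + fun k => g (L.pt k).1 (L.pt k).2 := rfl
  rw [PointList.eval, h, diag, Matrix.blockDiagonal'_add]
  rfl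

theorem PointList.eval_mul (f g : Sections X n) : L.eval (f * g) = L.eval f * L.eval g := by
  simp only [PointList.eval, diag, Matrix.reindex_apply, Matrix.submatrix_mul_equiv,
    ← Matrix.blockDiagonal'_mul]
  rfl

theorem PointList.eval_algebraMap (c : ℂ) :
    L.eval (algebraMap ℂ (Sections X n) c) = algebraMap ℂ (Mat N) c := by
  have h : (fun k => (algebraMap ℂ (Sections X n) c) (L.pt k).1 (L.pt k).2) =
      c • (1 : ∀ k, Mat (n (L.pt k).1)) := by
    funext k
    simp [Algebra.algebraMap_eq_smul_one]
  rw [PointList.eval, h, diag, Matrix.blockDiagonal'_smul, Matrix.blockDiagonal'_one,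
    Matrix.reindex_apply, Algebra.algebraMap_eq_smul_one]
  simp only [Matrix.submatrix_smul, Pi.smul_apply, Matrix.submatrix_one_equiv]

theorem PointList.eval_star (f : Sections X n) : L.eval (star f) = star (L.eval f) := by
  simp only [PointList.eval, diag, Matrix.reindex_apply, Matrix.star_eq_conjTranspose,
    Matrix.conjTranspose_submatrix, Matrix.blockDiagonal'_conjTranspose]
  rfl

theorem PointList.continuous_eval : Continuous (L.eval : Sections X n → Mat N) := by
  have h : Continuous fun f : Sections X n => fun k => f (L.pt k).1 (L.pt k).2 :=
    continuous_pi fun k => (continuous_eval_const _).comp (continuous_apply _)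
  exact (h.matrix_blockDiagonal').matrix_submatrix _ _

end Lemmas

namespace CompositionSequence

/-- The diagonal subhomogeneous (DSH) algebra of a composition sequence: the iterated pullback
`[⋯[C(X 0, M) ⊕_{C(Y 1, M)} C(X 1, M)]⋯] ⊕ C(X (l-1), M)`, i.e. all `f` such that, at every stage,
the restriction of `f_i` to `Y i` is the image under `φ_i` of the earlier components. -/
def algebra (D : CompositionSequence.{u}) : StarSubalgebra ℂ (Sections D.X D.n) where
  carrier := {f | ∀ i, ∀ y : D.Y i, f i y = (D.list i y).eval f}
  mul_mem' {f g} hf hg i y := by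
    rw [PointList.eval_mul, ← hf i y, ← hg i y]
    rfl
  add_mem' {f g} hf hg i y := by
    rw [PointList.eval_add, ← hf i y, ← hg i y]
    rfl
  algebraMap_mem' c i y := by
    rw [PointList.eval_algebraMap]
    rfl
  star_mem' {f} hf i y := by
    rw [PointList.eval_star, ← hf i y]
    rfl

theorem isClosed_algebra (D : CompositionSequence.{u}) :
    IsClosed (D.algebra : Set (Sections D.X D.n)) := by
  have h : (D.algebra : Set (Sections D.X D.n)) =
      ⋂ i, ⋂ y : D.Y i, {f | f i y = (D.list i y).eval f} := by
    ext f
    simp only [Set.mem_iInter]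
    rfl
  rw [h]
  exact isClosed_iInter fun i => isClosed_iInter fun y =>
    isClosed_eq ((continuous_eval_const _).comp (continuous_apply _))
      (PointList.continuous_eval _)

/-- A DSH algebra, as a C*-algebra. -/
abbrev Alg (D : CompositionSequence.{u}) : Type u := D.algebra

noncomputable instance (D : CompositionSequence.{u}) : CStarAlgebra D.Alg :=
  haveI : IsClosed (D.algebra : Set (Sections D.X D.n)) := D.isClosed_algebra
  StarSubalgebra.cstarAlgebra D.algebra

end CompositionSequence

/-- A homomorphism `φ` of DSH algebras is diagonal if for every point `x` at stage `i` of the range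
algebra there are points `x_1, …, x_t` at stages `i_1, …, i_t` of the domain algebra with
`φ(f)_i(x) = diag (f_{i_1}(x_1), …, f_{i_t}(x_t))` for all `f`. -/
def IsDiagonal {D E : CompositionSequence.{u}} (φ : D.Alg →⋆ₐ[ℂ] E.Alg) : Prop :=
  ∀ (i : Fin E.length) (x : E.X i), ∃ L : PointList D.X D.n (E.n i),
    ∀ f : D.Alg, (φ f).1 i x = L.eval f.1

section InductiveLimit

variable {B : ℕ → Type*} [∀ j, CStarAlgebra (B j)]

/-- The composite `φ_{j+k,j} : B j → B (j + k)` of the connecting maps. -/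
def connecting (φ : ∀ j, B j →⋆ₐ[ℂ] B (j + 1)) (j : ℕ) : ∀ k : ℕ, B j →⋆ₐ[ℂ] B (j + k)
  | 0 => StarAlgHom.id ℂ (B j)
  | k + 1 => (φ (j + k)).comp (connecting φ j k)

/-- `A`, with the canonical maps `ι j : B j → A`, is the C*-algebraic inductive limit of the
sequence `(B j, φ j)`, i.e. the completion of the algebraic direct limit in the C*-seminorm
`lim_k ‖φ_{j+k,j}(b)‖`. -/
structure IsInductiveLimit (φ : ∀ j, B j →⋆ₐ[ℂ] B (j + 1)) {A : Type*} [CStarAlgebra A]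
    (ι : ∀ j, B j →⋆ₐ[ℂ] A) : Prop where
  comp_eq : ∀ j, (ι (j + 1)).comp (φ j) = ι j
  dense : Dense (⋃ j, Set.range (ι j))
  norm_eq : ∀ j (b : B j), Tendsto (fun k => ‖connecting φ j k b‖) atTop (𝓝 ‖ι j b‖)

end InductiveLimit

/-- A C*-algebra is simple if it is non-zero and has no closed two-sided ideals other than `0` and
itself. -/
def IsSimple (A : Type*) [CStarAlgebra A] : Prop :=
  Nontrivial A ∧ ∀ I : TwoSidedIdeal A, IsClosed (I : Set A) → I = ⊥ ∨ I = ⊤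

/-- A unital C*-algebra has stable rank one if its invertible elements are dense. -/
def HasStableRankOne (A : Type*) [CStarAlgebra A] : Prop :=
  Dense {a : A | IsUnit a}

end DSH

/-! It suffices to approximate `ι j f` for `f` in an algebra of the system. Simplicity enters
through one principle, `IsInductiveLimit.exists_forall_le_norm`: an element that survives in the
limit is, from some stage on, bounded below in norm at every point. If the matrix sizes do not tend
to infinity, a limit of normalised characteristic polynomials and this principle show that `ι j f`
is annihilated by a non-zero polynomial; its spectrum is finite, so `ι j f - c` is invertible for
arbitrarily small `c`.

Suppose now that the sizes tend to infinity. If `f⋆f` and `ff⋆` are both invertible in the limit, so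
is `f`; passing to `f⋆` if necessary, let `f⋆f` be non-invertible. Then the positive part of `ε ^ 2
- f⋆f` survives, so from some stage on every fibre contains an almost singular block of `f`, and
later every fibre contains many of them. The images of `f` stay banded, with a width `K` that does
not depend on the stage. At a point outside the glued subset `Y`, row and column operations that
keep the matrix banded deform a nearby block diagonal matrix into one with `2 * K` zero rows
(`exists_bandedJoined`). A bump function spreads this over a neighbourhood and over the recurrences
of the fibre at later stages (`exists_banded_exchange`): up to a small error the image of `f` is `U
* f' * W` with `U`, `W` invertible and `f'` banded with gaps of zero rows. The bump survives in the
limit, so by simplicity such gaps recur, far out, in every fibre and at bounded distances.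

A banded `g` with recurring gaps is a limit of invertible elements (`mem_closure_units_of_banded`).
Each row is moved down by `K` (operator `R`) or up by `K` (operator `T`). Then `R * g` is strictly
lower and `T * g` strictly upper triangular, so both are nilpotent. If rows moved down are followed
closely by rows moved up only across a gap, then `(T * g) * (R * g) = 0`, hence `(c + T * g) * (c +
R * g) = c * (c + T * g + R * g)` and `(R + T) * g` is a limit of invertible elements. So is `R +
T`, and `g = (R + T)⋆ * ((R + T) * g)`. The difficulty is a continuous choice of directions that
respects the gluing: the last rows of every block have to move up, the first ones down. It is
governed by walls at the ends of blocks, which may fade away between different points of a fibre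
space. -/

namespace DSH

/-! ### Positions in block diagonal matrices -/

/-- The number of rows of a block diagonal matrix before the block `k`. -/
def offset {t : ℕ} (m : Fin t → ℕ) (k : Fin t) : ℕ := ∑ i ∈ Finset.Iio k, m i

/-- The row of a block diagonal matrix which is the row `a` of the block `k`. -/
def blockPos {t : ℕ} (m : Fin t → ℕ) {N : ℕ} (h : ∑ k, m k = N) (k : Fin t) (a : Fin (m k)) :
    Fin N :=
  finCongr h (finSigmaFinEquiv ⟨k, a⟩)

section Blocks

variable {t : ℕ} {m : Fin t → ℕ} {N : ℕ} (h : ∑ k, m k = N)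

theorem blockPos_val (k : Fin t) (a : Fin (m k)) : (blockPos m h k a : ℕ) = offset m k + a := by
  have e : ∑ i : Fin k, m (Fin.castLE k.2.le i) = offset m k := by
    refine Finset.sum_bij (fun i _ => Fin.castLE k.2.le i) (fun i _ => ?_) (fun i _ j _ hij => ?_)
      (fun i hi => ?_) fun i _ => rfl
    · rw [Finset.mem_Iio, Fin.lt_def]
      exact i.2
    · simpa using hij
    · rw [Finset.mem_Iio, Fin.lt_def] at hi
      exact ⟨⟨i, hi⟩, Finset.mem_univ _, rfl⟩
  simp [blockPos, finSigmaFinEquiv_apply, e]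

theorem exists_blockPos (p : Fin N) : ∃ k a, blockPos m h k a = p := by
  refine ⟨(finSigmaFinEquiv.symm ((finCongr h).symm p)).1,
    (finSigmaFinEquiv.symm ((finCongr h).symm p)).2, ?_⟩
  rw [blockPos, Sigma.eta, Equiv.apply_symm_apply, Equiv.apply_symm_apply]

theorem diag_blockPos_self (B : ∀ k, Mat (m k)) (k : Fin t) (a b : Fin (m k)) :
    diag m h B (blockPos m h k a) (blockPos m h k b) = B k a b := by
  simp [diag, blockPos, Matrix.blockDiagonal'_apply]

theorem diag_blockPos_of_ne (B : ∀ k, Mat (m k)) {k k' : Fin t} (hk : k ≠ k') (a : Fin (m k))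
    (b : Fin (m k')) : diag m h B (blockPos m h k a) (blockPos m h k' b) = 0 := by
  simp [diag, blockPos, Matrix.blockDiagonal'_apply, hk]

theorem eq_diag_iff {M : Mat N} {B : ∀ k, Mat (m k)} :
    M = diag m h B ↔
      (∀ k a b, M (blockPos m h k a) (blockPos m h k b) = B k a b) ∧
      ∀ k k', k ≠ k' → ∀ a b, M (blockPos m h k a) (blockPos m h k' b) = 0 := by
  constructor
  · rintro rfl
    exact ⟨diag_blockPos_self h B, fun k k' hk => diag_blockPos_of_ne h B hk⟩
  · rintro ⟨h1, h2⟩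
    ext p q
    obtain ⟨k, a, rfl⟩ := exists_blockPos h p
    obtain ⟨k', b, rfl⟩ := exists_blockPos h q
    by_cases hk : k = k'
    · subst hk
      rw [h1, diag_blockPos_self]
    · rw [h2 k k' hk, diag_blockPos_of_ne h B hk]

theorem offset_add_le_offset {k k' : Fin t} (hk : k < k') : offset m k + m k ≤ offset m k' := by
  have e : offset m k + m k = ∑ i ∈ Finset.Iic k, m i := by
    rw [offset, ← Finset.Iio_insert, Finset.sum_insert (by simp), add_comm]
  rw [e]
  refine Finset.sum_le_sum_of_subset fun i hi => ?_
  rw [Finset.mem_Iic] at hi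
  exact Finset.mem_Iio.2 (hi.trans_lt hk)

theorem offset_add_le {t : ℕ} {m : Fin t → ℕ} {N : ℕ} (h : ∑ k, m k = N) (k : Fin t) :
    offset m k + m k ≤ N := by
  have e : offset m k + m k = ∑ i ∈ Finset.Iic k, m i := by
    rw [offset, ← Finset.Iio_insert, Finset.sum_insert (by simp), add_comm]
  rw [e, ← h]
  exact Finset.sum_le_sum_of_subset fun i _ => Finset.mem_univ i

theorem exists_eq_offset_add {t : ℕ} {m : Fin t → ℕ} {N : ℕ} (h : ∑ k, m k = N) {p : ℕ}
    (hp : p < N) : ∃ k, ∃ a < m k, p = offset m k + a := by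
  obtain ⟨k, a, e⟩ := exists_blockPos h ⟨p, hp⟩
  refine ⟨k, a, a.2, ?_⟩
  rw [← blockPos_val h, e]

theorem block_unique {k k' : Fin t} {a a' : ℕ} (ha : a < m k) (ha' : a' < m k')
    (e : offset m k + a = offset m k' + a') : k = k' ∧ a = a' := by
  rcases lt_trichotomy k k' with hk | hk | hk
  · have := offset_add_le_offset (m := m) hk
    omega
  · subst hk
    exact ⟨rfl, by omega⟩
  · have := offset_add_le_offset (m := m) hk
    omega

end Blocks

theorem PointList.eval_eq {l : ℕ} {X : Fin l → Type u} [∀ i, TopologicalSpace (X i)]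
    {n : Fin l → ℕ} {N : ℕ} (L : PointList X n N) (f : Sections X n) :
    L.eval f = diag (fun k => n (L.pt k).1) L.sum_dim (fun k => f (L.pt k).1 (L.pt k).2) := rfl

/-- The offset of the block `k` in a point list. -/
abbrev PointList.off {l : ℕ} {X : Fin l → Type u} {n : Fin l → ℕ} {N : ℕ} (L : PointList X n N)
    (k : Fin L.t) : ℕ := offset (fun k => n (L.pt k).1) k

namespace CompositionSequence

variable (D : CompositionSequence.{u})

theorem mem_algebra_iff (f : Sections D.X D.n) :
    f ∈ D.algebra ↔ ∀ i, ∀ y : D.Y i, f i y = (D.list i y).eval f := Iff.rfl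

/-! ### Diagonal elements -/

/-- The real diagonal elements of a DSH algebra, as functions on the diagonal positions. Only the
values at the positions `p < n i` matter. -/
structure PosFun where
  toFun : ∀ i, D.X i → ℕ → ℝ
  continuous_toFun : ∀ i p, Continuous fun x => toFun i x p
  compat : ∀ i (y : D.Y i) k a, a < D.n ((D.list i y).pt k).1 →
    toFun i y ((D.list i y).off k + a) = toFun ((D.list i y).pt k).1 ((D.list i y).pt k).2 a

variable {D}

instance : CoeFun D.PosFun fun _ => ∀ i, D.X i → ℕ → ℝ := ⟨PosFun.toFun⟩

namespace PosFun

/-- Apply a continuous function to a position function. -/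
def comp (δ : D.PosFun) (g : ℝ → ℝ) (hg : Continuous g) : D.PosFun where
  toFun i x p := g (δ i x p)
  continuous_toFun i p := hg.comp (δ.continuous_toFun i p)
  compat i y k a ha := by rw [δ.compat i y k a ha]

instance : Mul D.PosFun where
  mul δ η :=
    { toFun := fun i x p => δ i x p * η i x p
      continuous_toFun := fun i p => (δ.continuous_toFun i p).mul (η.continuous_toFun i p)
      compat := fun i y k a ha => by rw [δ.compat i y k a ha, η.compat i y k a ha] }

instance : Zero D.PosFun where
  zero :=
    { toFun := fun _ _ _ => 0
      continuous_toFun := fun _ _ => continuous_const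
      compat := fun _ _ _ _ _ => rfl }

instance : Add D.PosFun where
  add δ η :=
    { toFun := fun i x p => δ i x p + η i x p
      continuous_toFun := fun i p => (δ.continuous_toFun i p).add (η.continuous_toFun i p)
      compat := fun i y k a ha => by rw [δ.compat i y k a ha, η.compat i y k a ha] }

theorem mul_apply (δ η : D.PosFun) (i) (x : D.X i) (p : ℕ) : (δ * η) i x p = δ i x p * η i x p :=
  rfl

theorem add_apply (δ η : D.PosFun) (i) (x : D.X i) (p : ℕ) : (δ + η) i x p = δ i x p + η i x p :=
  rfl

theorem comp_apply (δ : D.PosFun) (g : ℝ → ℝ) (hg : Continuous g) (i) (x : D.X i) (p : ℕ) :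
    δ.comp g hg i x p = g (δ i x p) := rfl

/-- Move a position function `δ` by one position to the left, cutting at the positions where the
position function `τ` is one; these have to include the ends of all blocks. -/
def shift (τ : D.PosFun) (hτ : ∀ i x, τ i x (D.n i - 1) = 1) (δ : D.PosFun) : D.PosFun where
  toFun i x p := (1 - τ i x p) * δ i x (p + 1)
  continuous_toFun i p :=
    (continuous_const.sub (τ.continuous_toFun i p)).mul (δ.continuous_toFun i (p + 1))
  compat i y k a ha := by
    rw [τ.compat i y k a ha]
    by_cases h : a + 1 < D.n ((D.list i y).pt k).1
    · rw [add_assoc, δ.compat i y k (a + 1) h]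
    -- At the last row of a block the factor `1 - τ` vanishes, so the first entry of the next block
    -- is not read.
    · have h' : a = D.n ((D.list i y).pt k).1 - 1 := by omega
      rw [h', hτ, sub_self, zero_mul, zero_mul]

theorem shift_apply (τ : D.PosFun) (hτ : ∀ i x, τ i x (D.n i - 1) = 1) (δ : D.PosFun) (i)
    (x : D.X i) (p : ℕ) : shift τ hτ δ i x p = (1 - τ i x p) * δ i x (p + 1) := rfl

end PosFun

/-- The subdiagonal matrix with the entries `δ p` in row `p + K` and column `p`. -/
def _root_.DSH.lowerMat (n : ℕ) (δ : ℕ → ℝ) (K : ℕ) : Mat n :=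
  Matrix.of fun a b => if (a : ℕ) = b + K then (δ b : ℂ) else 0

/-- The superdiagonal matrix with the entries `δ p` in row `p - K` and column `p`. -/
def _root_.DSH.upperMat (n : ℕ) (δ : ℕ → ℝ) (K : ℕ) : Mat n :=
  Matrix.of fun a b => if (a : ℕ) + K = b then (δ b : ℂ) else 0

namespace PosFun

/-- The element of a DSH algebra with entries `δ p` in row `p + K` and column `p`. -/
noncomputable def lower (δ : D.PosFun) (K : ℕ)
    (h : ∀ i x p, p < D.n i → D.n i ≤ p + K → δ i x p = 0) : D.Alg :=
  ⟨fun i => ⟨fun x => lowerMat (D.n i) (δ i x) K, by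
    refine continuous_matrix fun a b => ?_
    simp only [lowerMat, Matrix.of_apply]
    split_ifs
    · exact Complex.continuous_ofReal.comp (δ.continuous_toFun i b)
    · exact continuous_const⟩, by
    rw [mem_algebra_iff]
    intro i y
    rw [PointList.eval_eq, eq_diag_iff]
    constructor
    · intro k a b
      simp only [ContinuousMap.coe_mk, lowerMat, Matrix.of_apply, blockPos_val]
      rw [δ.compat i y k b b.2]
      exact if_congr (by omega) rfl rfl
    -- An entry outside the diagonal blocks has its row `b + K` beyond the end of the block of its
    -- column; there `h`, at the earlier stage, makes `δ` vanish.
    · intro k k' hk a b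
      simp only [ContinuousMap.coe_mk, lowerMat, Matrix.of_apply, blockPos_val]
      rw [δ.compat i y k' b b.2]
      split_ifs with e
      · rw [h _ _ _ b.2, Complex.ofReal_zero]
        by_contra hc
        exact hk (block_unique (m := fun k => D.n ((D.list i y).pt k).1) a.2 (not_le.1 hc)
          (by omega)).1
      · rfl⟩

/-- The element of a DSH algebra with entries `δ p` in row `p - K` and column `p`. -/
noncomputable def upper (δ : D.PosFun) (K : ℕ)
    (h : ∀ i x p, p < D.n i → p < K → δ i x p = 0) : D.Alg :=
  ⟨fun i => ⟨fun x => upperMat (D.n i) (δ i x) K, by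
    refine continuous_matrix fun a b => ?_
    simp only [upperMat, Matrix.of_apply]
    split_ifs
    · exact Complex.continuous_ofReal.comp (δ.continuous_toFun i b)
    · exact continuous_const⟩, by
    rw [mem_algebra_iff]
    intro i y
    rw [PointList.eval_eq, eq_diag_iff]
    constructor
    · intro k a b
      simp only [ContinuousMap.coe_mk, upperMat, Matrix.of_apply, blockPos_val]
      rw [δ.compat i y k b b.2]
      exact if_congr (by omega) rfl rfl
    · intro k k' hk a b
      simp only [ContinuousMap.coe_mk, upperMat, Matrix.of_apply, blockPos_val]
      rw [δ.compat i y k' b b.2]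
      split_ifs with e
      · rw [h _ _ _ b.2, Complex.ofReal_zero]
        by_contra hc
        exact hk (block_unique (m := fun k => D.n ((D.list i y).pt k).1) a.2
          ((Nat.sub_le _ K).trans_lt b.2) (by omega)).1
      · rfl⟩

theorem lower_apply (δ : D.PosFun) (K : ℕ) (h) (i) (x : D.X i) :
    (δ.lower K h).1 i x = lowerMat (D.n i) (δ i x) K := rfl

theorem upper_apply (δ : D.PosFun) (K : ℕ) (h) (i) (x : D.X i) :
    (δ.upper K h).1 i x = upperMat (D.n i) (δ i x) K := rfl

/-- The real parts of the diagonal entries of an element of a DSH algebra. -/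
noncomputable def ofAlg (f : D.Alg) : D.PosFun where
  toFun i x p := if h : p < D.n i then (f.1 i x ⟨p, h⟩ ⟨p, h⟩).re else 0
  continuous_toFun i p := by
    split_ifs with h
    · exact Complex.continuous_re.comp ((f.1 i).continuous.matrix_elem _ _)
    · exact continuous_const
  compat i y k a ha := by
    have hN : (D.list i y).off k + a < D.n i := by
      exact (Nat.add_lt_add_left ha _).trans_le (offset_add_le (D.list i y).sum_dim k)
    rw [dif_pos hN, dif_pos ha]
    have e : (⟨(D.list i y).off k + a, hN⟩ : Fin (D.n i)) =
        blockPos (fun k => D.n ((D.list i y).pt k).1) (D.list i y).sum_dim k ⟨a, ha⟩ :=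
      Fin.ext (blockPos_val (D.list i y).sum_dim k ⟨a, ha⟩).symm
    rw [e, f.2 i y, PointList.eval_eq, diag_blockPos_self]

theorem ofAlg_apply (f : D.Alg) (i) (x : D.X i) (p : Fin (D.n i)) :
    ofAlg f i x p = (f.1 i x p p).re := dif_pos p.2

end PosFun

end CompositionSequence

/-! ### Extending separated families of bump functions -/

/-- Tietze extends each `d p`, and clamping gives `r p` between `lo` and `cap`. The positive part of
`r p` minus the sum of the nearby `r q` is separated, since of two neighbouring values the smaller
one becomes zero. Nothing changes on `Y`, where the family is already separated, nor where `lo p` is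
positive, because the nearby caps vanish there. -/
theorem exists_separated_extension {X : Type*} [TopologicalSpace X] [NormalSpace X] {Y : Set X}
    (hY : IsClosed Y) (n S : ℕ) {lo cap : X → ℕ → ℝ} (hloc : ∀ p, Continuous fun x => lo x p)
    (hcapc : ∀ p, Continuous fun x => cap x p) (hlo : ∀ x p, 0 ≤ lo x p)
    (hle : ∀ x p, lo x p ≤ cap x p)
    (hsep : ∀ x p q, p < n → q < n → p ≠ q → p < q + S → q < p + S → 0 < lo x p → cap x q = 0)
    {d : Y → ℕ → ℝ} (hd : ∀ p < n, Continuous fun y => d y p)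
    (hdlo : ∀ (y : Y), ∀ p < n, lo y p ≤ d y p) (hdcap : ∀ (y : Y), ∀ p < n, d y p ≤ cap y p)
    (hdsep : ∀ (y : Y) p q, p < n → q < n → p ≠ q → p < q + S → q < p + S → d y p = 0 ∨ d y q = 0) :
    ∃ e : X → ℕ → ℝ, (∀ p, Continuous fun x => e x p) ∧ (∀ (y : Y), ∀ p < n, e y p = d y p) ∧
      (∀ x, ∀ p < n, lo x p ≤ e x p) ∧ (∀ x, ∀ p < n, e x p ≤ cap x p) ∧
      ∀ x p q, p < n → q < n → p ≠ q → p < q + S → q < p + S → e x p = 0 ∨ e x q = 0 := by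
  have ht : ∀ p, ∃ t : C(X, ℝ), p < n → ∀ y : Y, t y = d y p := by
    intro p
    by_cases hp : p < n
    · obtain ⟨t, ht⟩ := ContinuousMap.exists_restrict_eq hY ⟨_, hd p hp⟩
      exact ⟨t, fun _ y => DFunLike.congr_fun ht y⟩
    · exact ⟨0, fun h => absurd h hp⟩
  choose t ht using ht
  set r : X → ℕ → ℝ := fun x p => max (lo x p) (min (t p x) (cap x p)) with hr
  have hrc : ∀ p, Continuous fun x => r x p := fun p =>
    (hloc p).max ((t p).continuous.min (hcapc p))
  have hr0 : ∀ x p, 0 ≤ r x p := fun x p => (hlo x p).trans (le_max_left _ _)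
  have hrcap : ∀ x p, r x p ≤ cap x p := fun x p => max_le (hle x p) (min_le_right _ _)
  have hrY : ∀ (y : Y), ∀ p < n, r y p = d y p := by
    intro y p hp
    simp only [hr]
    rw [ht p hp, min_eq_left (hdcap y p hp), max_eq_right (hdlo y p hp)]
  set near : ℕ → Finset ℕ := fun p =>
    (Finset.range n).filter fun q => p ≠ q ∧ p < q + S ∧ q < p + S with hnear
  have mem_near : ∀ p q, q ∈ near p ↔ q < n ∧ p ≠ q ∧ p < q + S ∧ q < p + S := by
    intro p q
    simp [hnear]
  refine ⟨fun x p => max 0 (r x p - ∑ q ∈ near p, r x q), fun p => ?_, fun y p hp => ?_,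
    fun x p hp => ?_, fun x p hp => ?_, fun x p q hp hq hpq h1 h2 => ?_⟩
  · exact continuous_const.max ((hrc p).sub (continuous_finsetSum _ fun q _ => hrc q))
  · by_cases h0 : d y p = 0
    · beta_reduce
      rw [hrY y p hp, h0, zero_sub]
      exact max_eq_left (neg_nonpos.2 (Finset.sum_nonneg fun q _ => hr0 _ _))
    · have : ∑ q ∈ near p, r y q = 0 := by
        refine Finset.sum_eq_zero fun q hq => ?_
        obtain ⟨hq, hpq, h1, h2⟩ := (mem_near p q).1 hq
        rw [hrY y q hq]
        exact (hdsep y p q hp hq hpq h1 h2).resolve_left h0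
      simp only [this, sub_zero]
      rw [max_eq_right (hr0 _ _), hrY y p hp]
  · rcases (hlo x p).eq_or_lt with h0 | h0
    · rw [← h0]
      exact le_max_left _ _
    · have : ∑ q ∈ near p, r x q = 0 := by
        refine Finset.sum_eq_zero fun q hq => ?_
        obtain ⟨hq, hpq, h1, h2⟩ := (mem_near p q).1 hq
        exact le_antisymm ((hrcap x q).trans (hsep x p q hp hq hpq h1 h2 h0).le) (hr0 x q)
      simp only [this, sub_zero]
      exact (le_max_left _ _).trans (le_max_right _ _)
  · refine max_le ((hlo x p).trans (hle x p)) (le_trans ?_ (hrcap x p))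
    exact sub_le_self _ (Finset.sum_nonneg fun q _ => hr0 _ _)
  · rcases le_total (r x p) (r x q) with h | h
    · left
      refine max_eq_left (sub_nonpos.2 (h.trans ?_))
      exact Finset.single_le_sum (f := fun q => r x q) (fun q _ => hr0 x q)
        ((mem_near p q).2 ⟨hq, hpq, h1, h2⟩)
    · right
      refine max_eq_left (sub_nonpos.2 (h.trans ?_))
      exact Finset.single_le_sum (f := fun q => r x q) (fun q _ => hr0 x q)
        ((mem_near q p).2 ⟨hp, hpq.symm, h2, h1⟩)

/-! ### Separated diagonal elements of a DSH algebra -/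

namespace CompositionSequence

/-- Between a lower and an upper bound which are compatible with the lists of points there is a
real diagonal element which is nowhere non-zero at two different positions at a distance less
than `S`. -/
theorem exists_separated_posFun (D : CompositionSequence.{u}) (S : ℕ)
    {lo cap : ∀ i, D.X i → ℕ → ℝ}
    (hloc : ∀ i p, Continuous fun x => lo i x p) (hcapc : ∀ i p, Continuous fun x => cap i x p)
    (hlo : ∀ i x p, 0 ≤ lo i x p) (hle : ∀ i x p, lo i x p ≤ cap i x p)
    (hlolist : ∀ i (y : D.Y i) k a, a < D.n ((D.list i y).pt k).1 →
      lo i y ((D.list i y).off k + a) ≤ lo ((D.list i y).pt k).1 ((D.list i y).pt k).2 a)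
    (hcaplist : ∀ i (y : D.Y i) k a, a < D.n ((D.list i y).pt k).1 →
      cap ((D.list i y).pt k).1 ((D.list i y).pt k).2 a ≤ cap i y ((D.list i y).off k + a))
    (hsep : ∀ i x p q, p < D.n i → q < D.n i → p ≠ q → p < q + S → q < p + S → 0 < lo i x p →
      cap i x q = 0)
    (hcross : ∀ i (y : D.Y i) k k' a a', k < k' → a < D.n ((D.list i y).pt k).1 →
      a' < D.n ((D.list i y).pt k').1 →
      (D.list i y).off k' + a' < (D.list i y).off k + a + S →
      cap ((D.list i y).pt k).1 ((D.list i y).pt k).2 a ≤ 0 ∨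
      cap ((D.list i y).pt k').1 ((D.list i y).pt k').2 a' ≤ 0) :
    ∃ δ : D.PosFun, (∀ i x, ∀ p < D.n i, lo i x p ≤ δ i x p) ∧
      (∀ i x, ∀ p < D.n i, δ i x p ≤ cap i x p) ∧
      ∀ i x p q, p < D.n i → q < D.n i → p ≠ q → p < q + S → q < p + S →
        δ i x p = 0 ∨ δ i x q = 0 := by
  -- Induction over the stages: the conditions are imposed below stage `m` only, and `δ` is
  -- arbitrary from there on.
  have key : ∀ m : ℕ, m ≤ D.length → ∃ δ : ∀ i, D.X i → ℕ → ℝ,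
      (∀ i p, Continuous fun x => δ i x p) ∧ ∀ i : Fin D.length, (i : ℕ) < m →
      (∀ (y : D.Y i) k a, a < D.n ((D.list i y).pt k).1 →
        δ i y ((D.list i y).off k + a) = δ ((D.list i y).pt k).1 ((D.list i y).pt k).2 a) ∧
      (∀ x, ∀ p < D.n i, lo i x p ≤ δ i x p) ∧ (∀ x, ∀ p < D.n i, δ i x p ≤ cap i x p) ∧
      ∀ x p q, p < D.n i → q < D.n i → p ≠ q → p < q + S → q < p + S →
        δ i x p = 0 ∨ δ i x q = 0 := by
    intro m
    induction m with
    | zero =>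
      exact fun _ => ⟨fun _ _ _ => 0, fun _ _ => continuous_const, fun i hi => absurd hi (by omega)⟩
    | succ m ih =>
      intro hm
      obtain ⟨δ, hδc, hδ⟩ := ih (by omega)
      set i₀ : Fin D.length := ⟨m, hm⟩ with hi₀
      -- The diagonal section with entries `δ`: `continuous_eval` applied to it gives the continuity
      -- of the values that the earlier stages prescribe on `Y i₀`.
      set f : Sections D.X D.n := fun i => ⟨fun x => lowerMat (D.n i) (δ i x) 0, by
        refine continuous_matrix fun a b => ?_
        simp only [lowerMat, Matrix.of_apply]
        split_ifs
        · exact Complex.continuous_ofReal.comp (hδc i b)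
        · exact continuous_const⟩ with hf
      have hdiag : ∀ j : Fin D.length, (j : ℕ) < m → ∀ y : D.Y j, f j y = (D.list j y).eval f := by
        intro j hj y
        rw [PointList.eval_eq, eq_diag_iff]
        constructor
        · intro k a b
          simp only [hf, ContinuousMap.coe_mk, lowerMat, Matrix.of_apply, blockPos_val]
          rw [(hδ j hj).1 y k b b.2]
          exact if_congr (by omega) rfl rfl
        · intro k k' hk a b
          simp only [hf, ContinuousMap.coe_mk, lowerMat, Matrix.of_apply, blockPos_val]
          refine if_neg fun e => hk ?_
          exact (block_unique (m := fun k => D.n ((D.list j y).pt k).1) a.2 b.2 (by omega)).1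
      have hcont := D.continuous_eval i₀ f fun j hj y => hdiag j hj y
      set d : D.Y i₀ → ℕ → ℝ := fun y p =>
        if h : p < D.n i₀ then ((D.list i₀ y).eval f ⟨p, h⟩ ⟨p, h⟩).re else 0 with hd
      have hdval : ∀ (y : D.Y i₀) k a, a < D.n ((D.list i₀ y).pt k).1 →
          d y ((D.list i₀ y).off k + a) =
            δ ((D.list i₀ y).pt k).1 ((D.list i₀ y).pt k).2 a := by
        intro y k a ha
        have hN : (D.list i₀ y).off k + a < D.n i₀ :=
          (Nat.add_lt_add_left ha _).trans_le (offset_add_le (D.list i₀ y).sum_dim k)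
        have e : (⟨(D.list i₀ y).off k + a, hN⟩ : Fin (D.n i₀)) =
            blockPos (fun k => D.n ((D.list i₀ y).pt k).1) (D.list i₀ y).sum_dim k ⟨a, ha⟩ :=
          Fin.ext (blockPos_val (D.list i₀ y).sum_dim k ⟨a, ha⟩).symm
        simp only [hd]
        rw [dif_pos hN, e, PointList.eval_eq, diag_blockPos_self]
        simp [hf, lowerMat]
      have hlt : ∀ (y : D.Y i₀) k, (((D.list i₀ y).pt k).1 : ℕ) < m := fun y k => D.list_lt i₀ y k
      have hex : ∀ (y : D.Y i₀) p, p < D.n i₀ → ∃ k, ∃ a < D.n ((D.list i₀ y).pt k).1,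
          p = (D.list i₀ y).off k + a :=
        fun y p hp => exists_eq_offset_add (D.list i₀ y).sum_dim hp
      obtain ⟨e, hec, heY, helo, hecap, hesep⟩ := exists_separated_extension (D.isClosed_Y i₀)
        (D.n i₀) S (hloc i₀) (hcapc i₀) (hlo i₀) (hle i₀) (hsep i₀) (d := d)
        (fun p hp => by
          simp only [hd, dif_pos hp]
          exact Complex.continuous_re.comp (hcont.matrix_elem _ _))
        (fun y p hp => by
          obtain ⟨k, a, ha, rfl⟩ := hex y p hp
          rw [hdval y k a ha]
          exact (hlolist i₀ y k a ha).trans ((hδ _ (hlt y k)).2.1 _ a ha))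
        (fun y p hp => by
          obtain ⟨k, a, ha, rfl⟩ := hex y p hp
          rw [hdval y k a ha]
          exact ((hδ _ (hlt y k)).2.2.1 _ a ha).trans (hcaplist i₀ y k a ha))
        (fun y p q hp hq hpq h1 h2 => by
          have hzero : ∀ k a, a < D.n ((D.list i₀ y).pt k).1 →
              cap ((D.list i₀ y).pt k).1 ((D.list i₀ y).pt k).2 a ≤ 0 →
              δ ((D.list i₀ y).pt k).1 ((D.list i₀ y).pt k).2 a = 0 := fun k a ha h0 =>
            le_antisymm (((hδ _ (hlt y k)).2.2.1 _ a ha).trans h0)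
              ((hlo _ _ _).trans ((hδ _ (hlt y k)).2.1 _ a ha))
          obtain ⟨k, a, ha, rfl⟩ := hex y p hp
          obtain ⟨k', a', ha', rfl⟩ := hex y q hq
          rw [hdval y k a ha, hdval y k' a' ha']
          rcases lt_trichotomy k k' with hk | hk | hk
          · exact (hcross i₀ y k k' a a' hk ha ha' h2).imp (hzero k a ha) (hzero k' a' ha')
          · subst hk
            exact (hδ _ (hlt y k)).2.2.2 _ a a' ha ha' (by omega) (by omega) (by omega)
          · exact ((hcross i₀ y k' k a' a hk ha' ha h1).imp (hzero k' a' ha')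
              (hzero k a ha)).symm)
      refine ⟨Function.update δ i₀ e, fun i p => ?_, fun i hi => ?_⟩
      · by_cases h : i = i₀
        · subst h
          simpa using hec p
        · simpa [h] using hδc i p
      · by_cases h : i = i₀
        · subst h
          simp only [Function.update_self]
          refine ⟨fun y k a ha => ?_, helo, hecap, hesep⟩
          have hne : ((D.list i₀ y).pt k).1 ≠ i₀ := (D.list_lt i₀ y k).ne
          rw [Function.update_of_ne hne, heY y _ ((Nat.add_lt_add_left ha _).trans_le
            (offset_add_le (D.list i₀ y).sum_dim k)), hdval y k a ha]
        · have hi' : (i : ℕ) < m := by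
            have : (i : ℕ) ≠ m := fun h' => h (Fin.ext h')
            omega
          rw [Function.update_of_ne h]
          obtain ⟨h1, h2⟩ := hδ i hi'
          refine ⟨fun y k a ha => ?_, h2⟩
          have hne : ((D.list i y).pt k).1 ≠ i₀ := by
            intro h'
            have h3 : ((D.list i y).pt k).1 < i := D.list_lt i y k
            rw [h', Fin.lt_def] at h3
            simp only [hi₀] at h3
            omega
          rw [Function.update_of_ne hne, h1 y k a ha]
  obtain ⟨δ, hδc, hδ⟩ := key D.length le_rfl
  exact ⟨⟨δ, hδc, fun i => (hδ i i.2).1⟩, fun i => (hδ i i.2).2.1, fun i => (hδ i i.2).2.2.1,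
    fun i => (hδ i i.2).2.2.2⟩

end CompositionSequence

/-! ### The closure of the invertible elements -/

section ClosureUnits

variable {A : Type*} [NormedRing A]

theorem mul_mem_closure_units {a b : A} (ha : a ∈ closure {a : A | IsUnit a})
    (hb : b ∈ closure {a : A | IsUnit a}) : a * b ∈ closure {a : A | IsUnit a} :=
  map_mem_closure₂ continuous_mul ha hb fun _ h₁ _ h₂ => IsUnit.mul h₁ h₂

theorem star_mem_closure_units [StarRing A] [ContinuousStar A] {a : A}
    (ha : a ∈ closure {a : A | IsUnit a}) : star a ∈ closure {a : A | IsUnit a} :=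
  map_mem_closure continuous_star ha fun _ h => IsUnit.star h

variable [NormedAlgebra ℂ A]

theorem mem_closure_units_of_forall {a : A} (h : ∀ c : ℂ, c ≠ 0 → IsUnit (algebraMap ℂ A c + a)) :
    a ∈ closure {a : A | IsUnit a} := by
  have h1 : Tendsto (fun c : ℂ => algebraMap ℂ A c + a) (𝓝[≠] 0) (𝓝 (algebraMap ℂ A 0 + a)) :=
    ((algebraMapCLM ℂ A).continuous.add continuous_const).continuousAt.tendsto.mono_left
      nhdsWithin_le_nhds
  rw [map_zero, zero_add] at h1
  exact mem_closure_of_tendsto h1 (eventually_mem_nhdsWithin.mono fun c hc => h c hc)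

theorem isUnit_algebraMap_add_of_isNilpotent {a : A} (ha : IsNilpotent a) {c : ℂ} (hc : c ≠ 0) :
    IsUnit (algebraMap ℂ A c + a) :=
  ha.isUnit_add_left_of_commute ((IsUnit.mk0 c hc).map (algebraMap ℂ A))
    (Algebra.commutes c a).symm

/-- For `c ≠ 0` the factors of `(c + a) * (c + b) = c * (c + (a + b))` are invertible by nilpotency,
and the mixed term is `a * b = 0`. -/
theorem add_mem_closure_units {a b : A} (ha : IsNilpotent a) (hb : IsNilpotent b)
    (hab : a * b = 0) : a + b ∈ closure {a : A | IsUnit a} := by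
  refine mem_closure_units_of_forall fun c hc => ?_
  have h1 := (isUnit_algebraMap_add_of_isNilpotent ha hc).mul
    (isUnit_algebraMap_add_of_isNilpotent hb hc)
  have h2 : (algebraMap ℂ A c + a) * (algebraMap ℂ A c + b) =
      algebraMap ℂ A c * (algebraMap ℂ A c + (a + b)) := by
    rw [add_mul, mul_add, mul_add, hab, mul_add, mul_add, ← Algebra.commutes c a]
    abel
  rw [h2] at h1
  obtain ⟨u, hu⟩ := (IsUnit.mk0 c hc).map (algebraMap ℂ A)
  rw [← hu] at h1
  rw [← hu]
  exact (Units.isUnit_units_mul u _).1 h1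

end ClosureUnits

/-! ### Banded matrices -/

section Banded

variable {n : ℕ}

/-- All non-zero entries are at a distance less than `K` from the diagonal. -/
def Banded (K : ℕ) (M : Mat n) : Prop :=
  ∀ a b : Fin n, M a b ≠ 0 → (a : ℕ) < b + K ∧ (b : ℕ) < a + K

/-- All non-zero entries are strictly below the diagonal. -/
def StrictLower (M : Mat n) : Prop := ∀ a b : Fin n, M a b ≠ 0 → b < a

/-- All non-zero entries are strictly above the diagonal. -/
def StrictUpper (M : Mat n) : Prop := ∀ a b : Fin n, M a b ≠ 0 → a < b

theorem exists_of_mul_apply_ne_zero {l m n : Type*} [Fintype m] {A : Matrix l m ℂ}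
    {B : Matrix m n ℂ} {a : l} {b : n} (h : (A * B) a b ≠ 0) : ∃ c, A a c ≠ 0 ∧ B c b ≠ 0 := by
  rw [Matrix.mul_apply] at h
  obtain ⟨c, -, hc⟩ := Finset.exists_ne_zero_of_sum_ne_zero h
  exact ⟨c, left_ne_zero_of_mul hc, right_ne_zero_of_mul hc⟩

theorem StrictLower.pow_eq_zero {M : Mat n} (hM : StrictLower M) {m : ℕ} (hm : n ≤ m) :
    M ^ m = 0 := by
  have key : ∀ (k : ℕ) (a b : Fin n), (M ^ k) a b ≠ 0 → (b : ℕ) + k ≤ a := by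
    intro k
    induction k with
    | zero =>
      intro a b h
      rw [pow_zero] at h
      have : a = b := by
        by_contra hab
        exact h (Matrix.one_apply_ne hab)
      rw [this]
      rfl
    | succ k ih =>
      intro a b h
      rw [pow_succ] at h
      obtain ⟨c, h1, h2⟩ := exists_of_mul_apply_ne_zero h
      have h3 := ih a c h1
      have h4 : (b : ℕ) < c := hM c b h2
      omega
  ext a b
  by_contra h
  have := key m a b h
  omega

theorem StrictUpper.pow_eq_zero {M : Mat n} (hM : StrictUpper M) {m : ℕ} (hm : n ≤ m) :
    M ^ m = 0 := by
  have h : StrictLower M.transpose := fun a b h => hM b a h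
  have h1 := h.pow_eq_zero hm
  rw [← Matrix.transpose_pow] at h1
  exact Matrix.transpose_eq_zero.1 h1

theorem banded_one {K : ℕ} (hK : 0 < K) : Banded K (1 : Mat n) := by
  intro a b h
  have : a = b := by
    by_contra hab
    exact h (Matrix.one_apply_ne hab)
  subst this
  omega

theorem lowerMat_ne_zero {δ : ℕ → ℝ} {K : ℕ} {a b : Fin n} (h : lowerMat n δ K a b ≠ 0) :
    (a : ℕ) = b + K ∧ δ b ≠ 0 := by
  simpa [lowerMat] using h

theorem upperMat_ne_zero {δ : ℕ → ℝ} {K : ℕ} {a b : Fin n} (h : upperMat n δ K a b ≠ 0) :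
    (a : ℕ) + K = b ∧ δ b ≠ 0 := by
  simpa [upperMat] using h

theorem strictLower_lowerMat_mul {δ : ℕ → ℝ} {K : ℕ} {M : Mat n} (hM : Banded K M) :
    StrictLower (lowerMat n δ K * M) := by
  intro a b h
  obtain ⟨c, h1, h2⟩ := exists_of_mul_apply_ne_zero h
  have h3 := (lowerMat_ne_zero h1).1
  have h4 := hM c b h2
  rw [Fin.lt_def]
  omega

theorem strictUpper_upperMat_mul {δ : ℕ → ℝ} {K : ℕ} {M : Mat n} (hM : Banded K M) :
    StrictUpper (upperMat n δ K * M) := by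
  intro a b h
  obtain ⟨c, h1, h2⟩ := exists_of_mul_apply_ne_zero h
  have h3 := (upperMat_ne_zero h1).1
  have h4 := hM c b h2
  rw [Fin.lt_def]
  omega

/-- A non-zero entry would give `r b ≠ 0` and `l c ≠ 0` with `c` at a distance less than `K` from `b
+ K`, so `b < c < b + 2 * K`: a row moved down shortly before a row moved up. -/
theorem upperMat_mul_mul_lowerMat {r l : ℕ → ℝ} {K : ℕ} {M : Mat n} (hM : Banded K M)
    (hrl : ∀ p q, p < n → q < n → p < q → q ≤ p + 2 * K → r p = 0 ∨ l q = 0) :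
    upperMat n l K * (M * lowerMat n r K) = 0 := by
  ext a b
  by_contra h
  obtain ⟨c, h1, h2⟩ := exists_of_mul_apply_ne_zero h
  obtain ⟨d, h3, h4⟩ := exists_of_mul_apply_ne_zero h2
  obtain ⟨h5, h6⟩ := upperMat_ne_zero h1
  obtain ⟨h7, h8⟩ := lowerMat_ne_zero h4
  have h9 := hM c d h3
  exact (hrl b c b.2 c.2 (by omega) (by omega)).elim h8 h6

/-- Two rows land at the same place only if `p + K = q - K`; this is the case `q = p + 2 * K` of
`hrl`. -/
theorem conjTranspose_lowerMat_mul_upperMat {r l : ℕ → ℝ} {K : ℕ} (hK : 0 < K)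
    (hrl : ∀ p q, p < n → q < n → p < q → q ≤ p + 2 * K → r p = 0 ∨ l q = 0) :
    star (lowerMat n r K) * upperMat n l K = 0 := by
  ext a b
  by_contra h
  obtain ⟨c, h1, h2⟩ := exists_of_mul_apply_ne_zero h
  rw [Matrix.star_apply, star_ne_zero] at h1
  obtain ⟨h5, h6⟩ := lowerMat_ne_zero h1
  obtain ⟨h7, h8⟩ := upperMat_ne_zero h2
  exact (hrl a b a.2 b.2 (by omega) (by omega)).elim h6 h8

theorem star_lowerMat_mul_self {r : ℕ → ℝ} {K : ℕ} (hr : ∀ p, p < n → n ≤ p + K → r p = 0) :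
    star (lowerMat n r K) * lowerMat n r K = lowerMat n (fun p => r p ^ 2) 0 := by
  ext a b
  by_cases hab : a = b
  · subst hab
    rw [Matrix.mul_apply]
    simp only [Matrix.star_apply, lowerMat, Matrix.of_apply, add_zero, if_true]
    by_cases ha : (a : ℕ) + K < n
    · rw [Finset.sum_eq_single ⟨a + K, ha⟩]
      · simp [pow_two]
      · intro c _ hc
        rw [if_neg, mul_zero]
        exact fun h => hc (Fin.ext h)
      · simp
    · rw [hr a a.2 (not_lt.1 ha)]
      simp
  · have h1 : lowerMat n (fun p => r p ^ 2) 0 a b = 0 := by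
      by_contra h
      exact hab (Fin.ext (lowerMat_ne_zero h).1)
    rw [h1]
    by_contra h
    obtain ⟨c, h1, h2⟩ := exists_of_mul_apply_ne_zero h
    rw [Matrix.star_apply, star_ne_zero] at h1
    have h5 := lowerMat_ne_zero h1
    have h6 := lowerMat_ne_zero h2
    exact hab (Fin.ext (by omega))

theorem star_upperMat_mul_self {r : ℕ → ℝ} {K : ℕ} (hr : ∀ p, p < n → p < K → r p = 0) :
    star (upperMat n r K) * upperMat n r K = lowerMat n (fun p => r p ^ 2) 0 := by
  ext a b
  by_cases hab : a = b
  · subst hab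
    rw [Matrix.mul_apply]
    simp only [Matrix.star_apply, lowerMat, upperMat, Matrix.of_apply, add_zero, if_true]
    by_cases ha : K ≤ (a : ℕ)
    · rw [Finset.sum_eq_single ⟨a - K, (Nat.sub_le _ _).trans_lt a.2⟩]
      · simp [pow_two, Nat.sub_add_cancel ha]
      · intro c _ hc
        rw [if_neg, mul_zero]
        exact fun h => hc (Fin.ext (by simp only; omega))
      · simp
    · rw [hr a a.2 (not_le.1 ha)]
      simp
  · have h1 : lowerMat n (fun p => r p ^ 2) 0 a b = 0 := by
      by_contra h
      exact hab (Fin.ext (lowerMat_ne_zero h).1)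
    rw [h1]
    by_contra h
    obtain ⟨c, h1, h2⟩ := exists_of_mul_apply_ne_zero h
    rw [Matrix.star_apply, star_ne_zero] at h1
    have h5 := upperMat_ne_zero h1
    have h6 := upperMat_ne_zero h2
    exact hab (Fin.ext (by omega))

theorem lowerMat_zero_mul_apply (δ : ℕ → ℝ) (M : Mat n) (a b : Fin n) :
    (lowerMat n δ 0 * M) a b = δ a * M a b := by
  rw [Matrix.mul_apply, Finset.sum_eq_single a]
  · simp [lowerMat]
  · intro c _ hc
    have : lowerMat n δ 0 a c = 0 := by
      by_contra h
      exact hc (Fin.ext (lowerMat_ne_zero h).1.symm)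
    rw [this, zero_mul]
  · simp

/-- A matrix whose rows are moved, without loss, up by `K` and down by `K`. -/
theorem star_add_mul_add_mul {r l h : ℕ → ℝ} {K : ℕ} (hK : 0 < K) {M : Mat n}
    (hr : ∀ p, p < n → n ≤ p + K → r p = 0) (hl : ∀ p, p < n → p < K → l p = 0)
    (hrl : ∀ p q, p < n → q < n → p < q → q ≤ p + 2 * K → r p = 0 ∨ l q = 0)
    (hrlh : ∀ p < n, r p ^ 2 + l p ^ 2 = h p ^ 2) (hM : ∀ a b : Fin n, M a b ≠ 0 → h a = 1) :
    star (lowerMat n r K + upperMat n l K) * ((lowerMat n r K + upperMat n l K) * M) = M := by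
  have h1 := conjTranspose_lowerMat_mul_upperMat hK hrl
  have h2 : star (upperMat n l K) * lowerMat n r K = 0 := by
    rw [← star_star (lowerMat n r K), ← star_mul, h1, star_zero]
  rw [← mul_assoc, star_add, add_mul, mul_add, mul_add, h1, h2, add_zero, zero_add,
    star_lowerMat_mul_self hr, star_upperMat_mul_self hl, add_mul]
  ext a b
  rw [Matrix.add_apply, lowerMat_zero_mul_apply, lowerMat_zero_mul_apply, ← add_mul,
    ← Complex.ofReal_add, hrlh a a.2]
  by_cases h0 : M a b = 0
  · rw [h0, mul_zero]
  · rw [hM a b h0]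
    simp

end Banded

/-! ### Directions -/

/-- Truncation of a real number to the unit interval. -/
noncomputable def clamp (t : ℝ) : ℝ := max 0 (min t 1)

theorem continuous_clamp : Continuous clamp := continuous_const.max (continuous_id.min continuous_const)

theorem clamp_of_nonpos {t : ℝ} (h : t ≤ 0) : clamp t = 0 :=
  max_eq_left ((min_le_left _ _).trans h)

theorem clamp_of_one_le {t : ℝ} (h : 1 ≤ t) : clamp t = 1 := by
  rw [clamp, min_eq_right h, max_eq_right zero_le_one]

theorem pos_of_clamp_ne_zero {t : ℝ} (h : clamp t ≠ 0) : 0 < t := by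
  by_contra h'
  exact h (clamp_of_nonpos (not_lt.1 h'))

theorem clamp_nonneg (t : ℝ) : 0 ≤ clamp t := le_max_left _ _

theorem clamp_le_one (t : ℝ) : clamp t ≤ 1 := max_le zero_le_one (min_le_right _ _)

/-- `charge τ ζ o p` is `τ (p + o)`, reduced by the values of `τ` and `ζ` in between. -/
def charge (τ ζ : ℕ → ℝ) : ℕ → ℕ → ℝ
  | 0, p => τ p
  | o + 1, p => (1 - τ p) * ((1 - ζ (p + 1)) * charge τ ζ o (p + 1))

/-- The direction, right (`0`) or left (`1`), in which the row `p` is to be moved. -/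
noncomputable def direction (τ ζ : ℕ → ℝ) (M m p : ℕ) : ℝ :=
  ∑ o ∈ Finset.range m, clamp (M * charge τ ζ o p - (M - 1 - o))

section Direction

variable {τ ζ : ℕ → ℝ}

theorem charge_eq_zero_of_right {o p : ℕ} (h : τ (p + o) = 0) : charge τ ζ o p = 0 := by
  induction o generalizing p with
  | zero => exact h
  | succ o ih => rw [charge, ih (by rw [← h]; ring_nf), mul_zero, mul_zero]

theorem charge_eq_zero_of_wall {o p i : ℕ} (h1 : p ≤ i) (h2 : i < p + o) (h : τ i = 1) :
    charge τ ζ o p = 0 := by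
  induction o generalizing p with
  | zero => omega
  | succ o ih =>
    rw [charge]
    rcases h1.eq_or_lt with rfl | h1
    · rw [h, sub_self, zero_mul]
    · rw [ih (by omega) (by omega), mul_zero, mul_zero]

theorem charge_eq_zero_of_gap {o p i : ℕ} (h1 : p < i) (h2 : i ≤ p + o) (h : ζ i = 1) :
    charge τ ζ o p = 0 := by
  induction o generalizing p with
  | zero => omega
  | succ o ih =>
    rw [charge]
    rcases (Nat.succ_le_of_lt h1).eq_or_lt with rfl | h1
    · rw [h, sub_self, zero_mul, mul_zero]
    · rw [ih (by omega) (by omega), mul_zero, mul_zero]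

theorem charge_add {d o p : ℕ} (h1 : ∀ i, p ≤ i → i < p + d → τ i = 0)
    (h2 : ∀ i, p < i → i ≤ p + d → ζ i = 0) : charge τ ζ (d + o) p = charge τ ζ o (p + d) := by
  induction d generalizing p with
  | zero => rw [zero_add, add_zero]
  | succ d ih =>
    rw [add_right_comm, charge, h1 p le_rfl (by omega), h2 (p + 1) (by omega) (by omega),
      ih (fun i h3 h4 => h1 i (by omega) (by omega)) (fun i h3 h4 => h2 i (by omega) (by omega)),
      sub_zero, one_mul, one_mul, add_assoc, add_comm 1]

variable {n N M : ℕ}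

theorem clamp_eq_zero_of_charge {o p : ℕ} (ho : o < M) (h : charge τ ζ o p = 0) :
    clamp (M * charge τ ζ o p - (M - 1 - o)) = 0 := by
  refine clamp_of_nonpos ?_
  rw [h, mul_zero, zero_sub, neg_nonpos, sub_sub, sub_nonneg]
  exact_mod_cast (by omega : 1 + o ≤ M)

theorem exists_of_direction_ne_zero (hend : τ (n - 1) = 1) {p : ℕ} (hp : p < n)
    (h : direction τ ζ M M p ≠ 0) :
    ∃ o < M, p + o < n ∧ τ (p + o) ≠ 0 ∧ charge τ ζ o p ≠ 0 ∧
      0 < M * charge τ ζ o p - (M - 1 - o) := by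
  obtain ⟨o, ho, h1⟩ := Finset.exists_ne_zero_of_sum_ne_zero h
  rw [Finset.mem_range] at ho
  have h2 : charge τ ζ o p ≠ 0 := fun h2 => h1 (clamp_eq_zero_of_charge ho h2)
  refine ⟨o, ho, ?_, fun h3 => h2 (charge_eq_zero_of_right h3), h2, pos_of_clamp_ne_zero h1⟩
  by_contra h3
  exact h2 (charge_eq_zero_of_wall (i := n - 1) (by omega) (by omega) hend)

/-- At most one wall is met in the `M ≤ N` positions from `p` on, so a single summand survives.
Summands that reach past the end of the matrix are killed by the wall at `n - 1`. -/
theorem direction_eq (hend : τ (n - 1) = 1)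
    (hsep : ∀ p q, p < n → q < n → p ≠ q → p < q + N → q < p + N → τ p = 0 ∨ τ q = 0)
    (hMN : M ≤ N) {o p : ℕ} (ho : o < M) (hp : p + o < n) (hτ : τ (p + o) ≠ 0) :
    direction τ ζ M M p = clamp (M * charge τ ζ o p - (M - 1 - o)) := by
  rw [direction, Finset.sum_eq_single o]
  · intro o' ho' hne
    rw [Finset.mem_range] at ho'
    refine clamp_eq_zero_of_charge ho' ?_
    by_cases h : p + o' < n
    · exact charge_eq_zero_of_right
        ((hsep _ _ hp h (by omega) (by omega) (by omega)).resolve_left hτ)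
    · exact charge_eq_zero_of_wall (i := n - 1) (by omega) (by omega) hend
  · intro h
    exact absurd (Finset.mem_range.2 ho) h

/-- The last `K` rows feel the wall at `n - 1` with full charge, as neither another wall nor a gap
is that close to the end. Their direction is therefore one, and no row is pushed out at the bottom.
-/
theorem cos_direction_mul_eq_zero {K : ℕ} {h : ℕ → ℝ} (hend : τ (n - 1) = 1)
    (hsep : ∀ p q, p < n → q < n → p ≠ q → p < q + N → q < p + N → τ p = 0 ∨ τ q = 0)
    (hMN : M ≤ N) (hKM : K ≤ M) (hζ : ∀ p < n, ζ p ≠ 0 → p + 2 * K ≤ n) {p : ℕ} (hp : p < n)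
    (hpK : n ≤ p + K) : Real.cos (Real.pi / 2 * direction τ ζ M M p) * h p = 0 := by
  have h1 : τ (p + (n - 1 - p)) = 1 := by
    rw [show p + (n - 1 - p) = n - 1 by omega, hend]
  have h2 : charge τ ζ (n - 1 - p + 0) p = 1 := by
    rw [charge_add, charge, h1]
    · intro i h3 h4
      refine (hsep i (n - 1) (by omega) (by omega) (by omega) (by omega) (by omega)).resolve_right ?_
      rw [hend]
      exact one_ne_zero
    · intro i h3 h4
      by_contra h5
      have := hζ i (by omega) h5
      omega
  rw [add_zero] at h2
  rw [direction_eq hend hsep hMN (o := n - 1 - p) (by omega) (by omega) (by rw [h1]; exact one_ne_zero),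
    h2, clamp_of_one_le, mul_one, Real.cos_pi_div_two, zero_mul]
  have : (0 : ℝ) ≤ ((n - 1 - p : ℕ) : ℝ) := Nat.cast_nonneg _
  linarith

/-- The first wall stands at `N - 1` or later, out of reach of the first `K` rows because `M + K <
N`. Their direction is zero, and no row is pushed out at the top. -/
theorem sin_direction_mul_eq_zero {K : ℕ} {h : ℕ → ℝ} (hend : τ (n - 1) = 1)
    (hfirst : ∀ p < n, p + 1 < N → τ p = 0) (hMN : M + K < N) {p : ℕ} (hp : p < n)
    (hpK : p < K) : Real.sin (Real.pi / 2 * direction τ ζ M M p) * h p = 0 := by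
  have : direction τ ζ M M p = 0 := by
    by_contra h1
    obtain ⟨o, h2, h3, h4, -, -⟩ := exists_of_direction_ne_zero hend hp h1
    exact h4 (hfirst _ h3 (by omega))
  rw [this, mul_zero, Real.sin_zero, zero_mul]

/-- With the charge fixed, the argument of `clamp` grows by one per step away from the wall. So if
row `q` has positive direction, every row before it that feels the same charge within reach has
direction exactly one and moves up entirely. The charge gets lost only across a gap, where the rows
are zero. While a wall fades in, the zone of rows moving up grows from the far end towards the wall.
-/
theorem cos_direction_mul_eq_zero_or {K M₁ : ℕ} {h : ℕ → ℝ} (hend : τ (n - 1) = 1)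
    (hsep : ∀ p q, p < n → q < n → p ≠ q → p < q + N → q < p + N → τ p = 0 ∨ τ q = 0)
    (hMN : M + 2 * K < N) (hM : M₁ + 2 * K ≤ M)
    (hwindow : ∀ p, p + M₁ ≤ n → ∃ i, p ≤ i ∧ i < p + M₁ ∧ ζ i = 1)
    (hζ : ∀ p < n, ζ p ≠ 0 → ∀ i, p ≤ i → i < p + 2 * K → h i = 0)
    {p q : ℕ} (hq : q < n) (hpq : p < q) (hqp : q ≤ p + 2 * K) :
    Real.cos (Real.pi / 2 * direction τ ζ M M p) * h p = 0 ∨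
      Real.sin (Real.pi / 2 * direction τ ζ M M q) * h q = 0 := by
  by_cases hhq : h q = 0
  · right
    rw [hhq, mul_zero]
  by_cases hdq : direction τ ζ M M q = 0
  · right
    rw [hdq, mul_zero, Real.sin_zero, zero_mul]
  left
  obtain ⟨o, ho, hqo, hτ, hc, hpos⟩ := exists_of_direction_ne_zero hend hq hdq
  -- Row `p` feels the same charge as `q`: no other wall is near, and a gap beginning in `(p, q]`
  -- would contain the row `q`, where `h q ≠ 0`.
  have h1 : charge τ ζ (q - p + o) p = charge τ ζ o q := by
    rw [charge_add, show p + (q - p) = q by omega]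
    · intro i h2 h3
      exact (hsep i (q + o) (by omega) hqo (by omega) (by omega) (by omega)).resolve_right hτ
    · intro i h2 h3
      by_contra h4
      exact hhq (hζ i (by omega) h4 q (by omega) (by omega))
  by_cases hoM : q - p + o < M
  · have h2 : p + (q - p + o) = q + o := by omega
    rw [direction_eq hend hsep (by omega) hoM (by omega) (by rw [h2]; exact hτ), h1,
      clamp_of_one_le, mul_one, Real.cos_pi_div_two, zero_mul]
    have h3 : (o : ℝ) + 1 ≤ ((q - p + o : ℕ) : ℝ) := by exact_mod_cast (by omega)
    have h4 : (M : ℝ) * charge τ ζ o q - (M - 1 - o) > 0 := hpos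
    have h5 : charge τ ζ o q ≤ 1 ∨ 1 ≤ charge τ ζ o q := le_total _ _
    linarith
  -- Here `o ≥ M₁`, so a full gap begins after `q` and not beyond the wall, and the charge at `q`
  -- would be zero.
  · obtain ⟨i, h2, h3, h4⟩ := hwindow (q + 1) (by omega)
    exact absurd (charge_eq_zero_of_gap (by omega) (by omega) h4) hc

end Direction

/-! ### Banded elements of DSH algebras with recurring zero rows -/

namespace CompositionSequence

variable {D : CompositionSequence.{u}}

theorem Alg.ext {f g : D.Alg} (h : ∀ i x, f.1 i x = g.1 i x) : f = g :=
  Subtype.ext (funext fun i => ContinuousMap.ext (h i))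

theorem Alg.mul_apply (f g : D.Alg) (i) (x : D.X i) : (f * g).1 i x = f.1 i x * g.1 i x := rfl

theorem Alg.add_apply (f g : D.Alg) (i) (x : D.X i) : (f + g).1 i x = f.1 i x + g.1 i x := rfl

theorem Alg.sub_apply (f g : D.Alg) (i) (x : D.X i) : (f - g).1 i x = f.1 i x - g.1 i x := rfl

theorem Alg.star_apply (f : D.Alg) (i) (x : D.X i) : (star f).1 i x = star (f.1 i x) := rfl

theorem Alg.one_apply (i) (x : D.X i) : (1 : D.Alg).1 i x = 1 := rfl

theorem Alg.zero_apply (i) (x : D.X i) : (0 : D.Alg).1 i x = 0 := rfl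

theorem Alg.pow_apply (f : D.Alg) (m : ℕ) (i) (x : D.X i) : (f ^ m).1 i x = f.1 i x ^ m := by
  induction m with
  | zero => rw [pow_zero, pow_zero]; rfl
  | succ m ih => rw [pow_succ, pow_succ, Alg.mul_apply, ih]

/-- The largest matrix size in a composition sequence. -/
def maxDim (D : CompositionSequence.{u}) : ℕ := Finset.univ.sup D.n

theorem n_le_maxDim (i : Fin D.length) : D.n i ≤ D.maxDim := Finset.le_sup (Finset.mem_univ i)

theorem Alg.isNilpotent_of_strictLower {f : D.Alg} (h : ∀ i x, StrictLower (f.1 i x)) :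
    IsNilpotent f :=
  ⟨D.maxDim, Alg.ext fun i x => by
    rw [Alg.pow_apply, (h i x).pow_eq_zero (n_le_maxDim i), Alg.zero_apply]⟩

theorem Alg.isNilpotent_of_strictUpper {f : D.Alg} (h : ∀ i x, StrictUpper (f.1 i x)) :
    IsNilpotent f :=
  ⟨D.maxDim, Alg.ext fun i x => by
    rw [Alg.pow_apply, (h i x).pow_eq_zero (n_le_maxDim i), Alg.zero_apply]⟩

/-- A real diagonal element which is one at the ends of all blocks, and nowhere non-zero at two
positions at a distance less than `N`. -/
theorem exists_wall (D : CompositionSequence.{u}) {N : ℕ} (hN : ∀ i, ∀ _ : D.X i, N ≤ D.n i) :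
    ∃ τ : D.PosFun, (∀ i x, τ i x (D.n i - 1) = 1) ∧
      (∀ i x, ∀ p < D.n i, p + 1 < N → τ i x p = 0) ∧
      ∀ i x p q, p < D.n i → q < D.n i → p ≠ q → p < q + N → q < p + N →
        τ i x p = 0 ∨ τ i x q = 0 := by
  -- `lo` forces a wall at the end of the fibre. `cap` forbids walls among the first `N - 1`
  -- positions and, except for the end itself, among the last `N`.
  set lo : ∀ i, D.X i → ℕ → ℝ := fun i _ p => if p = D.n i - 1 then 1 else 0 with hlo
  set cap : ∀ i, D.X i → ℕ → ℝ := fun i _ p =>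
    if p = D.n i - 1 then 1 else if p + 1 < N ∨ D.n i ≤ p + N then 0 else 1 with hcap
  have hcap1 : ∀ i x p, p ≠ D.n i - 1 → (p + 1 < N ∨ D.n i ≤ p + N) → cap i x p = 0 := by
    intro i x p h1 h2
    simp only [hcap]
    rw [if_neg h1, if_pos h2]
  obtain ⟨τ, h1, h2, h3⟩ := D.exists_separated_posFun N (lo := lo) (cap := cap)
    (fun i p => continuous_const) (fun i p => continuous_const)
    (fun i x p => by simp only [hlo]; split_ifs <;> norm_num)
    (fun i x p => by simp only [hlo, hcap]; split_ifs <;> norm_num)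
    (fun i y k a ha => by
      have := offset_add_le (D.list i y).sum_dim k
      simp only [hlo]
      split_ifs with e1 e2
      · exact le_rfl
      · simp only [PointList.off] at e1
        omega
      · exact zero_le_one
      · exact le_rfl)
    (fun i y k a ha => by
      have hoff := offset_add_le (D.list i y).sum_dim k
      have hk := hN _ ((D.list i y).pt k).2
      have hle : cap ((D.list i y).pt k).1 ((D.list i y).pt k).2 a ≤ 1 := by
        simp only [hcap]
        split_ifs <;> norm_num
      have hle0 : a ≠ D.n ((D.list i y).pt k).1 - 1 ∧
          (a + 1 < N ∨ D.n ((D.list i y).pt k).1 ≤ a + N) →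
          cap ((D.list i y).pt k).1 ((D.list i y).pt k).2 a ≤ 0 := fun h =>
        (hcap1 _ ((D.list i y).pt k).2 a h.1 h.2).le
      rw [show cap i y ((D.list i y).off k + a) = if (D.list i y).off k + a = D.n i - 1 then 1
        else if (D.list i y).off k + a + 1 < N ∨ D.n i ≤ (D.list i y).off k + a + N then 0 else 1
        from rfl]
      split_ifs with e1 e2
      · exact hle
      · refine hle0 ?_
        simp only [PointList.off] at e1 e2
        rcases e2 with e2 | e2
        · omega
        -- A position among the last `N` lies in the last block, since this block has size at least
        -- `N`; there the cap of the earlier stage applies.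
        · obtain ⟨k', a', ha', e3⟩ := exists_eq_offset_add (D.list i y).sum_dim
            (p := D.n i - 1) (by have := D.n_pos i; omega)
          have hoff' := offset_add_le (D.list i y).sum_dim k'
          have hk' := hN _ ((D.list i y).pt k').2
          rcases lt_trichotomy k k' with h | h | h
          · have := offset_add_le_offset (m := fun k => D.n ((D.list i y).pt k).1) h
            omega
          · subst h
            omega
          · have := offset_add_le_offset (m := fun k => D.n ((D.list i y).pt k).1) h
            omega
      · exact hle)
    (fun i x p q hp hq hpq h4 h5 h6 => by
      simp only [hlo] at h6
      split_ifs at h6 with e1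
      · exact hcap1 i x q (by omega) (by omega)
      · exact absurd h6 (lt_irrefl _))
    (fun i y k k' a a' hk ha ha' h4 => by
      right
      have hk' := hN _ ((D.list i y).pt k').2
      have := offset_add_le_offset (m := fun k => D.n ((D.list i y).pt k).1) hk
      simp only [PointList.off] at *
      refine (hcap1 _ ((D.list i y).pt k').2 a' ?_ (Or.inl ?_)).le <;> omega)
  refine ⟨τ, fun i x => le_antisymm ?_ ?_, fun i x p hp hpN => le_antisymm ?_ ?_, h3⟩
  · refine (h2 i x _ (by have := D.n_pos i; omega)).trans ?_
    simp [hcap]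
  · refine le_trans ?_ (h1 i x _ (by have := D.n_pos i; omega))
    simp [hlo]
  · refine (h2 i x p hp).trans (hcap1 i x p ?_ (Or.inl hpN)).le
    have := hN i x
    omega
  · refine le_trans ?_ (h1 i x p hp)
    simp only [hlo]
    split_ifs <;> norm_num

/-- The position function of the values of `charge`. -/
def PosFun.charge (τ : D.PosFun) (hτ : ∀ i x, τ i x (D.n i - 1) = 1) (ζ : D.PosFun) : ℕ → D.PosFun
  | 0 => τ
  | o + 1 => PosFun.shift τ hτ (ζ.comp (fun t => 1 - t) (by fun_prop) * PosFun.charge τ hτ ζ o)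

theorem PosFun.charge_apply (τ : D.PosFun) (hτ : ∀ i x, τ i x (D.n i - 1) = 1) (ζ : D.PosFun)
    (o : ℕ) (i) (x : D.X i) (p : ℕ) :
    PosFun.charge τ hτ ζ o i x p = DSH.charge (τ i x) (ζ i x) o p := by
  induction o generalizing p with
  | zero => rfl
  | succ o ih =>
    rw [PosFun.charge, PosFun.shift_apply, PosFun.mul_apply, ih, PosFun.comp_apply, DSH.charge]

/-- The position function of the values of `direction`. -/
noncomputable def PosFun.direction (τ : D.PosFun) (hτ : ∀ i x, τ i x (D.n i - 1) = 1)
    (ζ : D.PosFun) (M : ℕ) : ℕ → D.PosFun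
  | 0 => 0
  | m + 1 => PosFun.direction τ hτ ζ M m + (PosFun.charge τ hτ ζ m).comp
      (fun t => clamp (M * t - (M - 1 - m))) (continuous_clamp.comp (by fun_prop))

theorem PosFun.direction_apply (τ : D.PosFun) (hτ : ∀ i x, τ i x (D.n i - 1) = 1) (ζ : D.PosFun)
    (M m : ℕ) (i) (x : D.X i) (p : ℕ) :
    PosFun.direction τ hτ ζ M m i x p = DSH.direction (τ i x) (ζ i x) M m p := by
  induction m with
  | zero => rfl
  | succ m ih =>
    rw [PosFun.direction, PosFun.add_apply, ih, PosFun.comp_apply, PosFun.charge_apply,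
      DSH.direction, DSH.direction, Finset.sum_range_succ]

/-- A banded element of a DSH algebra which has, everywhere and in every interval of positions of
a fixed length, sufficiently many consecutive zero rows, lies in the closure of the invertible
elements as soon as all matrix sizes are large enough. -/
theorem mem_closure_units_of_banded {K M₁ : ℕ} (hK : 0 < K) {f : D.Alg}
    (hf : ∀ i x, Banded K (f.1 i x)) (h ζ : D.PosFun)
    (hfh : ∀ i x (a b : Fin (D.n i)), f.1 i x a b ≠ 0 → h i x a = 1)
    (hζ : ∀ i x, ∀ p < D.n i, ζ i x p ≠ 0 → p + 2 * K ≤ D.n i ∧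
      ∀ q, p ≤ q → q < p + 2 * K → h i x q = 0)
    (hwindow : ∀ i x p, p + M₁ ≤ D.n i → ∃ q, p ≤ q ∧ q < p + M₁ ∧ ζ i x q = 1)
    (hN : ∀ i, ∀ _ : D.X i, M₁ + 4 * K + 1 ≤ D.n i) :
    f ∈ closure {a : D.Alg | IsUnit a} := by
  obtain ⟨τ, hend, hfirst, hsep⟩ := D.exists_wall hN
  -- Looking `M₁` positions ahead ensures that a gap is met; the additional `2 * K` is the largest
  -- distance of two interacting rows. The walls are `M₁ + 4 * K + 1 > M + 2 * K` apart.
  set M := M₁ + 2 * K with hM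
  set α := PosFun.direction τ hend ζ M M with hα
  -- Cosine and sine split the weight `h` of a row between moving down and moving up, so that `r ^ 2
  -- + l ^ 2 = h ^ 2` and the row can be recovered.
  set r : D.PosFun := α.comp (fun t => Real.cos (Real.pi / 2 * t)) (by fun_prop) * h with hr
  set l : D.PosFun := α.comp (fun t => Real.sin (Real.pi / 2 * t)) (by fun_prop) * h with hl
  have hrv : ∀ i x p, r i x p =
      Real.cos (Real.pi / 2 * DSH.direction (τ i x) (ζ i x) M M p) * h i x p := by
    intro i x p
    rw [hr, PosFun.mul_apply, PosFun.comp_apply, hα, PosFun.direction_apply]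
  have hlv : ∀ i x p, l i x p =
      Real.sin (Real.pi / 2 * DSH.direction (τ i x) (ζ i x) M M p) * h i x p := by
    intro i x p
    rw [hl, PosFun.mul_apply, PosFun.comp_apply, hα, PosFun.direction_apply]
  have hr0 : ∀ i x p, p < D.n i → D.n i ≤ p + K → r i x p = 0 := by
    intro i x p hp hpK
    rw [hrv]
    exact cos_direction_mul_eq_zero (hend i x) (hsep i x) (by omega) (by omega)
      (fun q hq h1 => (hζ i x q hq h1).1) hp hpK
  have hl0 : ∀ i x p, p < D.n i → p < K → l i x p = 0 := by
    intro i x p hp hpK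
    rw [hlv]
    exact sin_direction_mul_eq_zero (hend i x) (hfirst i x) (by omega) hp hpK
  have hrl : ∀ i x p q, p < D.n i → q < D.n i → p < q → q ≤ p + 2 * K →
      r i x p = 0 ∨ l i x q = 0 := by
    intro i x p q _ hq hpq hqp
    rw [hrv, hlv]
    exact cos_direction_mul_eq_zero_or (hend i x) (hsep i x) (by omega) le_rfl (hwindow i x)
      (fun q hq h1 => (hζ i x q hq h1).2) hq hpq hqp
  have hrlh : ∀ i x p, r i x p ^ 2 + l i x p ^ 2 = h i x p ^ 2 := by
    intro i x p
    rw [hrv, hlv, mul_pow, mul_pow, ← add_mul, Real.cos_sq_add_sin_sq, one_mul]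
  set R := r.lower K hr0 with hR
  set T := l.upper K hl0 with hT
  have hmul : star (R + T) * ((R + T) * f) = f := by
    refine Alg.ext fun i x => ?_
    rw [Alg.mul_apply, Alg.mul_apply, Alg.star_apply, Alg.add_apply, hR, hT, PosFun.lower_apply,
      PosFun.upper_apply]
    exact star_add_mul_add_mul hK (hr0 i x) (hl0 i x) (hrl i x) (fun p _ => hrlh i x p) (hfh i x)
  have key : ∀ g : D.Alg, (∀ i x, Banded K (g.1 i x)) → IsNilpotent (R * g) ∧
      IsNilpotent (T * g) ∧ T * (g * R) = 0 := by
    intro g hg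
    refine ⟨Alg.isNilpotent_of_strictLower fun i x => ?_,
      Alg.isNilpotent_of_strictUpper fun i x => ?_, Alg.ext fun i x => ?_⟩
    · rw [Alg.mul_apply, hR, PosFun.lower_apply]
      exact strictLower_lowerMat_mul (hg i x)
    · rw [Alg.mul_apply, hT, PosFun.upper_apply]
      exact strictUpper_upperMat_mul (hg i x)
    · rw [Alg.mul_apply, Alg.mul_apply, hR, hT, PosFun.lower_apply, PosFun.upper_apply]
      exact upperMat_mul_mul_lowerMat (hg i x) (hrl i x)
  -- The identity is banded too, so one argument covers both `R + T` and `(R + T) * f`.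
  obtain ⟨h1, h2, h3⟩ := key 1 fun i x => banded_one hK
  obtain ⟨h4, h5, h6⟩ := key f hf
  rw [mul_one] at h1 h2
  rw [one_mul] at h3
  have h7 : R + T ∈ closure {a : D.Alg | IsUnit a} := by
    rw [add_comm]
    exact add_mem_closure_units h2 h1 h3
  have h8 : (R + T) * f ∈ closure {a : D.Alg | IsUnit a} := by
    rw [add_mul, add_comm]
    refine add_mem_closure_units h5 h4 ?_
    rw [mul_assoc, ← mul_assoc f, ← mul_assoc, h6, zero_mul]
  rw [← hmul]
  exact mul_mem_closure_units (star_mem_closure_units h7) h8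

end CompositionSequence

/-! ### Connecting banded matrices -/

section Paths

/-- Scaling all coefficients by `t` joins the product to the identity. The submonoid `P` records a
shape that all matrices on the path share. -/
theorem exists_path_transvections {n : ℕ} (P : Submonoid (Mat n))
    (L : List (Matrix.TransvectionStruct (Fin n) ℂ))
    (hL : ∀ T ∈ L, ∀ c : ℂ, Matrix.transvection T.i T.j c ∈ P) :
    ∃ v : ℝ → Mat n, Continuous v ∧ v 0 = 1 ∧
      v 1 = (L.map Matrix.TransvectionStruct.toMatrix).prod ∧ ∀ t, IsUnit (v t) ∧ v t ∈ P := by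
  induction L with
  | nil => exact ⟨fun _ => 1, continuous_const, rfl, rfl, fun _ => ⟨isUnit_one, P.one_mem⟩⟩
  | cons T L ih =>
    obtain ⟨v, hv, hv0, hv1, hvt⟩ := ih fun T' hT' => hL T' (List.mem_cons_of_mem _ hT')
    refine ⟨fun t => Matrix.transvection T.i T.j (t * T.c) * v t, ?_, ?_, ?_, fun t => ⟨?_, ?_⟩⟩
    · refine Continuous.mul ?_ hv
      simp only [Matrix.transvection]
      refine continuous_const.add (continuous_matrix fun a b => ?_)
      simp only [Matrix.single_apply]
      split_ifs
      · fun_prop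
      · fun_prop
    · simp [hv0]
    · simp [hv1, Matrix.TransvectionStruct.toMatrix]
    · refine IsUnit.mul ?_ (hvt t).1
      rw [Matrix.isUnit_iff_isUnit_det, Matrix.det_transvection_of_ne _ _ T.hij]
      exact isUnit_one
    · exact P.mul_mem (hL T List.mem_cons_self _) (hvt t).2

/-- The pairs of invertible matrices `V`, `W` for which `V * F * W` is banded. -/
def bandedPairs {n : ℕ} (K : ℕ) (F : Mat n) : Set (Mat n × Mat n) :=
  {p | IsUnit p.1 ∧ IsUnit p.2 ∧ Banded K (p.1 * F * p.2)}

/-- `F` can be deformed into `F'` through banded matrices of the form `V * F * W` with invertible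
`V` and `W`. -/
def BandedJoined {n : ℕ} (K : ℕ) (F F' : Mat n) : Prop :=
  ∃ V W, V * F * W = F' ∧ JoinedIn (bandedPairs K F) (1, 1) (V, W)

theorem BandedJoined.refl {n K : ℕ} {F : Mat n} (hF : Banded K F) : BandedJoined K F F :=
  ⟨1, 1, by simp, JoinedIn.refl ⟨isUnit_one, isUnit_one, by simpa using hF⟩⟩

/-- The second path, multiplied by the end point `(V, W)` of the first one, continues it inside the
pairs belonging to `F`. -/
theorem BandedJoined.trans {n K : ℕ} {F F' F'' : Mat n} (h : BandedJoined K F F')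
    (h' : BandedJoined K F' F'') : BandedJoined K F F'' := by
  obtain ⟨V, W, rfl, h⟩ := h
  obtain ⟨V', W', rfl, h'⟩ := h'
  refine ⟨V' * V, W * W', by simp only [mul_assoc], h.trans ?_⟩
  have h1 := h'.map (f := fun p : Mat n × Mat n => (p.1 * V, W * p.2)) (by fun_prop)
  simp only [one_mul, mul_one] at h1
  refine h1.mono ?_
  rintro _ ⟨⟨V'', W''⟩, ⟨h2, h3, h4⟩, rfl⟩
  refine ⟨h2.mul h.target_mem.1, h.target_mem.2.1.mul h3, ?_⟩
  simpa only [mul_assoc] using h4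

theorem BandedJoined.of_path {n K : ℕ} {F : Mat n} {v w : ℝ → Mat n} (hv : Continuous v)
    (hw : Continuous w) (hv0 : v 0 = 1) (hw0 : w 0 = 1) (hvu : ∀ t, IsUnit (v t))
    (hwu : ∀ t, IsUnit (w t)) (h : ∀ t, Banded K (v t * F * w t)) :
    BandedJoined K F (v 1 * F * w 1) := by
  refine ⟨v 1, w 1, rfl, JoinedIn.ofLine (f := fun t => (v t, w t))
    (hv.prodMk hw).continuousOn (by simp [hv0, hw0]) rfl ?_⟩
  rintro _ ⟨t, -, rfl⟩
  exact ⟨hvu t, hwu t, h t⟩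

theorem diag_mul {t : ℕ} {m : Fin t → ℕ} {N : ℕ} (h : ∑ k, m k = N) (B C : ∀ k, Mat (m k)) :
    diag m h (fun k => B k * C k) = diag m h B * diag m h C := by
  simp only [diag, Matrix.reindex_apply, Matrix.submatrix_mul_equiv, ← Matrix.blockDiagonal'_mul]

theorem diag_diagonal {t : ℕ} {m : Fin t → ℕ} {N : ℕ} (h : ∑ k, m k = N)
    (B : ∀ k, Fin (m k) → ℂ) : ∃ d : Fin N → ℂ,
      diag m h (fun k => Matrix.diagonal (B k)) = Matrix.diagonal d ∧
      ∀ k a, d (blockPos m h k a) = B k a := by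
  refine ⟨fun p => diag m h (fun k => Matrix.diagonal (B k)) p p, ?_, fun k a => ?_⟩
  · symm
    rw [eq_diag_iff]
    refine ⟨fun k a b => ?_, fun k k' hk a b => Matrix.diagonal_apply_ne _ fun h' => ?_⟩
    · rw [Matrix.diagonal_apply, Matrix.diagonal_apply, diag_blockPos_self,
        Matrix.diagonal_apply_eq]
      refine if_congr ⟨fun e => ?_, fun e => by rw [e]⟩ rfl rfl
      have e1 := congrArg Fin.val e
      rw [blockPos_val, blockPos_val] at e1
      exact Fin.ext (by omega)
    · have e1 := congrArg Fin.val h'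
      rw [blockPos_val, blockPos_val] at e1
      exact hk (block_unique a.2 b.2 e1).1
  · beta_reduce
    rw [diag_blockPos_self, Matrix.diagonal_apply_eq]

theorem diag_one {t : ℕ} {m : Fin t → ℕ} {N : ℕ} (h : ∑ k, m k = N) :
    diag m h (fun k => (1 : Mat (m k))) = 1 := by
  rw [diag, show (fun k => (1 : Mat (m k))) = 1 from rfl, Matrix.blockDiagonal'_one,
    Matrix.reindex_apply, Matrix.submatrix_one_equiv]

theorem isUnit_diag {t : ℕ} {m : Fin t → ℕ} {N : ℕ} (h : ∑ k, m k = N) {B : ∀ k, Mat (m k)}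
    (hB : ∀ k, IsUnit (B k)) : IsUnit (diag m h B) := by
  choose u hu using hB
  refine IsUnit.of_mul_eq_one (diag m h fun k => ↑(u k)⁻¹) ?_
  rw [← diag_mul, ← diag_one h]
  congr 1
  funext k
  rw [← hu, Units.mul_inv]

theorem continuous_diag {t : ℕ} {m : Fin t → ℕ} {N : ℕ} (h : ∑ k, m k = N)
    {X : Type*} [TopologicalSpace X] {B : X → ∀ k, Mat (m k)} (hB : Continuous B) :
    Continuous fun x => diag m h (B x) :=
  (hB.matrix_blockDiagonal').matrix_submatrix _ _

theorem banded_diag {t : ℕ} {m : Fin t → ℕ} {N K : ℕ} (h : ∑ k, m k = N) {B : ∀ k, Mat (m k)}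
    (hB : ∀ k, Banded K (B k)) : Banded K (diag m h B) := by
  intro p q hpq
  obtain ⟨k, a, rfl⟩ := exists_blockPos h p
  obtain ⟨k', b, rfl⟩ := exists_blockPos h q
  by_cases hk : k = k'
  · subst hk
    rw [diag_blockPos_self] at hpq
    have := hB k a b hpq
    rw [blockPos_val, blockPos_val]
    omega
  · exact absurd (diag_blockPos_of_ne h B hk a b) hpq

theorem banded_of_le {n K : ℕ} (h : n ≤ K) (M : Mat n) : Banded K M := by
  intro a b _
  omega

theorem Banded.mono {n K K' : ℕ} (h : K ≤ K') {M : Mat n} (hM : Banded K M) : Banded K' M := by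
  intro a b hab
  have := hM a b hab
  omega

/-- The matrices which differ from diagonal matrices only in the plane of two coordinates. -/
def planeSubmonoid {n : ℕ} (p q : Fin n) : Submonoid (Mat n) where
  carrier := {M | ∀ a b, M a b ≠ 0 → a = b ∨ (a = p ∧ b = q) ∨ (a = q ∧ b = p)}
  one_mem' a b h := by
    left
    by_contra hab
    exact h (Matrix.one_apply_ne hab)
  mul_mem' {M N} hM hN a b h := by
    obtain ⟨c, h1, h2⟩ := exists_of_mul_apply_ne_zero h
    have h3 := hM a c h1
    have h4 := hN c b h2
    grind

/-- Up to signs the product of the three transvections is the permutation matrix of the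
transposition, so its non-zero entries sit at `(a, swap p q a)`. -/
theorem swap_transvections_mul_diagonal {n : ℕ} {p q : Fin n} (hpq : p ≠ q) (d : Fin n → ℂ) :
    (Matrix.transvection p q 1 * (Matrix.transvection q p (-1) * Matrix.transvection p q 1)) *
      Matrix.diagonal d = Matrix.diagonal (d ∘ Equiv.swap p q) *
    (Matrix.transvection p q 1 * (Matrix.transvection q p (-1) * Matrix.transvection p q 1)) := by
  have key : ∀ a b : Fin n, (Matrix.transvection p q (1 : ℂ) * (Matrix.transvection q p (-1) *
      Matrix.transvection p q 1) : Mat n) a b ≠ 0 → b = Equiv.swap p q a := by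
    intro a b h
    by_cases hap : a = p
    · subst hap
      rw [Equiv.swap_apply_left]
      by_contra hb
      apply h
      rw [Matrix.transvection_mul_apply_same, Matrix.transvection_mul_apply_of_ne _ _ _ _ hpq,
        Matrix.transvection_mul_apply_same]
      by_cases hab : a = b <;> simp [Matrix.transvection, Ne.symm hb, hab]
    · by_cases haq : a = q
      · subst haq
        rw [Equiv.swap_apply_right]
        by_contra hb
        apply h
        rw [Matrix.transvection_mul_apply_of_ne _ _ _ _ hap, Matrix.transvection_mul_apply_same]
        simp only [Matrix.transvection, Matrix.add_apply, Matrix.one_apply, Matrix.single_apply,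
          Ne.symm hb, hpq, false_and, if_false]
        by_cases hab : a = b <;> simp [hab]
      · rw [Equiv.swap_apply_of_ne_of_ne hap haq]
        by_contra hb
        apply h
        rw [Matrix.transvection_mul_apply_of_ne _ _ _ _ hap,
          Matrix.transvection_mul_apply_of_ne _ _ _ _ haq]
        simp [Matrix.transvection, Ne.symm hb, Ne.symm hap]
  ext a b
  rw [Matrix.mul_diagonal, Matrix.diagonal_mul]
  by_cases h : (Matrix.transvection p q (1 : ℂ) * (Matrix.transvection q p (-1) *
      Matrix.transvection p q 1) : Mat n) a b = 0
  · rw [h, zero_mul, mul_zero]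
  · rw [key a b h, mul_comm]
    rfl

/-- All matrices on the path are diagonal outside the plane of two neighbouring coordinates, which
leaves band width two. -/
theorem bandedJoined_diagonal_swap {n : ℕ} {p q : Fin n} (hpq : (p : ℕ) + 1 = q) (d : Fin n → ℂ) :
    BandedJoined 2 (Matrix.diagonal d) (Matrix.diagonal (d ∘ Equiv.swap p q)) := by
  have hne : p ≠ q := by
    rintro rfl
    omega
  have hP : ∀ c : ℂ, Matrix.transvection p q c ∈ planeSubmonoid p q ∧
      Matrix.transvection q p c ∈ planeSubmonoid p q := by
    intro c
    constructor <;>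
    · intro a b h
      by_contra h'
      apply h
      simp only [not_or, not_and] at h'
      simp only [Matrix.transvection, Matrix.add_apply, Matrix.one_apply, Matrix.single_apply]
      grind
  obtain ⟨v, hv, hv0, hv1, hvt⟩ := exists_path_transvections (planeSubmonoid p q)
    [⟨p, q, hne, 1⟩, ⟨q, p, hne.symm, -1⟩, ⟨p, q, hne, 1⟩] (by
      intro T hT c
      simp only [List.mem_cons, List.not_mem_nil, or_false] at hT
      rcases hT with rfl | rfl | rfl
      exacts [(hP c).1, (hP c).2, (hP c).1])
  -- `w` ends at the inverse of the end point of `v`, so the final matrix is a conjugate of the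
  -- diagonal one.
  obtain ⟨w, hw, hw0, hw1, hwt⟩ := exists_path_transvections (planeSubmonoid p q)
    [⟨p, q, hne, -1⟩, ⟨q, p, hne.symm, 1⟩, ⟨p, q, hne, -1⟩] (by
      intro T hT c
      simp only [List.mem_cons, List.not_mem_nil, or_false] at hT
      rcases hT with rfl | rfl | rfl
      exacts [(hP c).1, (hP c).2, (hP c).1])
  have hd : Matrix.diagonal d ∈ planeSubmonoid p q := by
    intro a b h
    left
    by_contra hab
    exact h (Matrix.diagonal_apply_ne _ hab)
  have h := BandedJoined.of_path (K := 2) (F := Matrix.diagonal d) hv hw hv0 hw0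
    (fun t => (hvt t).1) (fun t => (hwt t).1) (fun t a b h => by
      have h1 := mul_mem (mul_mem (hvt t).2 hd) (hwt t).2 a b h
      rcases h1 with rfl | ⟨rfl, rfl⟩ | ⟨rfl, rfl⟩ <;> omega)
  convert h using 1
  rw [hv1, hw1]
  simp only [List.map_cons, List.map_nil, List.prod_cons, List.prod_nil, mul_one,
    Matrix.TransvectionStruct.toMatrix_mk]
  rw [swap_transvections_mul_diagonal hne, mul_assoc]
  have e1 : Matrix.transvection p q (1 : ℂ) * Matrix.transvection p q (-1) = 1 := by
    rw [Matrix.transvection_mul_transvection_same _ _ hne, add_neg_cancel,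
      Matrix.transvection_zero]
  have e2 : Matrix.transvection q p (-1 : ℂ) * Matrix.transvection q p 1 = 1 := by
    rw [Matrix.transvection_mul_transvection_same _ _ hne.symm, neg_add_cancel,
      Matrix.transvection_zero]
  rw [mul_assoc, mul_assoc, ← mul_assoc (Matrix.transvection p q (1 : ℂ)) (Matrix.transvection p q _),
    e1, one_mul, ← mul_assoc (Matrix.transvection q p (-1 : ℂ)), e2, one_mul, e1, mul_one]

/-- Adjacent transpositions generate the symmetric group, and deformations can be composed. -/
theorem bandedJoined_diagonal_perm {n : ℕ} (σ : Equiv.Perm (Fin n)) (d : Fin n → ℂ) :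
    BandedJoined 2 (Matrix.diagonal d) (Matrix.diagonal (d ∘ σ)) := by
  cases n with
  | zero =>
    rw [Subsingleton.elim σ 1]
    exact BandedJoined.refl (banded_of_le (by omega) _)
  | succ n =>
    have hσ : σ ∈ Submonoid.closure (Set.range fun i : Fin n => Equiv.swap i.castSucc i.succ) := by
      rw [Equiv.Perm.mclosure_swap_castSucc_succ]
      trivial
    induction hσ using Submonoid.closure_induction generalizing d with
    | mem σ hσ =>
      obtain ⟨i, rfl⟩ := hσ
      exact bandedJoined_diagonal_swap (by simp) d
    | one =>
      refine BandedJoined.refl fun a b h => ?_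
      have : a = b := by
        by_contra hab
        exact h (Matrix.diagonal_apply_ne _ hab)
      omega
    | mul σ τ _ _ h1 h2 => exact (h1 d).trans (h2 (d ∘ σ))

theorem BandedJoined.mono {n K K' : ℕ} (h : K ≤ K') {F F' : Mat n} (hF : BandedJoined K F F') :
    BandedJoined K' F F' := by
  obtain ⟨V, W, h1, h2⟩ := hF
  exact ⟨V, W, h1, h2.mono fun p hp => ⟨hp.1, hp.2.1, hp.2.2.mono h⟩⟩

/-- A block diagonal matrix with `r` singular blocks can be deformed, through banded matrices, into
a matrix whose first `r` rows are zero. -/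
theorem exists_bandedJoined {t : ℕ} {m : Fin t → ℕ} {N K r : ℕ} (h : ∑ k, m k = N)
    (B : ∀ k, Mat (m k)) (hK : 0 < K) (hm : ∀ k, m k ≤ K)
    (hr : r ≤ (Finset.univ.filter fun k => (B k).det = 0).card) :
    ∃ F, BandedJoined (K + 1) (diag m h B) F ∧ ∀ a b : Fin N, (a : ℕ) < r → F a b = 0 := by
  -- Transvections diagonalise each block without changing its determinant, so a singular block
  -- acquires a zero on the diagonal. As blocks have size at most `K`, everything done inside them
  -- stays banded.
  choose L L' d hd using fun k =>
    Matrix.Pivot.exists_list_transvec_mul_mul_list_transvec_eq_diagonal (B k)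
  choose v hv hv0 hv1 hvt using fun k => exists_path_transvections ⊤ (L k) (by simp)
  choose w hw hw0 hw1 hwt using fun k => exists_path_transvections ⊤ (L' k) (by simp)
  obtain ⟨e, he, hed⟩ := diag_diagonal h d
  have h1 : BandedJoined K (diag m h B) (Matrix.diagonal e) := by
    have h2 := BandedJoined.of_path (K := K) (F := diag m h B)
      (v := fun t => diag m h fun k => v k t) (w := fun t => diag m h fun k => w k t)
      (continuous_diag h (continuous_pi hv)) (continuous_diag h (continuous_pi hw))
      (by simp only [hv0, diag_one]) (by simp only [hw0, diag_one])
      (fun t => isUnit_diag h fun k => (hvt k t).1) (fun t => isUnit_diag h fun k => (hwt k t).1)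
      (fun t => by
        rw [← diag_mul, ← diag_mul]
        exact banded_diag h fun k => banded_of_le (hm k) _)
    rw [← diag_mul, ← diag_mul] at h2
    simp only [hv1, hw1, hd, he] at h2
    exact h2
  have hzero : ∀ k, (B k).det = 0 → ∃ a, d k a = 0 := by
    intro k hk
    have h2 := congrArg Matrix.det (hd k)
    rw [Matrix.det_mul, Matrix.det_mul, hk, mul_zero, zero_mul, Matrix.det_diagonal] at h2
    obtain ⟨a, -, ha⟩ := Finset.prod_eq_zero_iff.1 h2.symm
    exact ⟨a, ha⟩
  set Z := Finset.univ.filter fun p => e p = 0 with hZ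
  have hcard : r ≤ Z.card := by
    refine hr.trans (Finset.card_le_card_of_surjOn (fun p => (exists_blockPos h p).choose) ?_)
    intro k hk
    obtain ⟨a, ha⟩ := hzero k (by simpa using hk)
    refine ⟨blockPos m h k a, by simp [hZ, hed, ha], ?_⟩
    obtain ⟨a', ha'⟩ := (exists_blockPos h (blockPos m h k a)).choose_spec
    have e1 := congrArg Fin.val ha'
    rw [blockPos_val, blockPos_val] at e1
    exact (block_unique a'.2 a.2 e1).1
  set s : Finset (Fin N) := Finset.univ.filter fun a => (a : ℕ) < r with hs
  have hscard : s.card ≤ r := by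
    refine (Finset.card_le_card_of_injOn (s := s) (fun a => (a : ℕ)) (t := Finset.range r) ?_ ?_).trans
      (Finset.card_range r).le
    · intro a ha
      simpa [hs] using ha
    · exact fun a _ b _ hab => Fin.ext hab
  obtain ⟨Z', hZ', hZcard⟩ := Finset.exists_subset_card_eq (hscard.trans hcard)
  -- A permutation that carries the first `r` positions to zeros of the diagonal.
  set σ : Equiv.Perm (Fin N) := (Finset.equivOfCardEq hZcard.symm).extendSubtype with hσ
  refine ⟨_, (h1.mono (by omega)).trans ((bandedJoined_diagonal_perm σ e).mono ?_),
    fun a b ha => ?_⟩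
  · omega
  · have has : a ∈ s := by simpa [hs] using ha
    have h2 : σ a ∈ Z := by
      rw [hσ, Equiv.extendSubtype_apply_of_mem _ a has]
      exact hZ' (Subtype.property _)
    by_cases hab : a = b
    · subst hab
      rw [Matrix.diagonal_apply_eq]
      simpa [hZ] using h2
    · exact Matrix.diagonal_apply_ne _ hab

end Paths

/-! ### Matrices with blocks placed at prescribed positions -/

section Cone

variable {n S : ℕ}

/-- The inclusion of `S` coordinates at the positions `p, …, p + S - 1`. -/
def inclMat (n S p : ℕ) : Matrix (Fin n) (Fin S) ℂ :=
  Matrix.of fun a s => if (a : ℕ) = p + s then 1 else 0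

/-- The matrix which has a block `F` at the positions `p, …, p + S - 1` and is zero elsewhere. -/
def cornerMat (n : ℕ) {S : ℕ} (p : ℕ) (F : Mat S) : Mat n :=
  inclMat n S p * F * (inclMat n S p).transpose

theorem inclMat_apply (p : ℕ) (a : Fin n) (s : Fin S) :
    inclMat n S p a s = if (a : ℕ) = p + s then 1 else 0 := rfl

theorem cornerMat_apply_add {p : ℕ} (F : Mat S) {a b : Fin n} {s t : Fin S} (ha : (a : ℕ) = p + s)
    (hb : (b : ℕ) = p + t) : cornerMat n p F a b = F s t := by
  rw [cornerMat, Matrix.mul_apply, Finset.sum_eq_single t]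
  · rw [Matrix.mul_apply, Finset.sum_eq_single s]
    · simp [inclMat_apply, ha, hb]
    · intro s' _ hs'
      rw [inclMat_apply, if_neg, zero_mul]
      exact fun h => hs' (Fin.ext (by omega))
    · simp
  · intro t' _ ht'
    rw [Matrix.transpose_apply, inclMat_apply, if_neg, mul_zero]
    exact fun h => ht' (Fin.ext (by omega))
  · simp

theorem cornerMat_ne_zero {p : ℕ} {F : Mat S} {a b : Fin n} (h : cornerMat n p F a b ≠ 0) :
    ∃ s t : Fin S, (a : ℕ) = p + s ∧ (b : ℕ) = p + t ∧ F s t ≠ 0 := by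
  rw [cornerMat] at h
  obtain ⟨t, h1, h2⟩ := exists_of_mul_apply_ne_zero h
  obtain ⟨s, h3, h4⟩ := exists_of_mul_apply_ne_zero h1
  rw [inclMat_apply] at h3
  rw [Matrix.transpose_apply, inclMat_apply] at h2
  exact ⟨s, t, by by_contra hc; exact h3 (if_neg hc), by by_contra hc; exact h2 (if_neg hc), h4⟩

theorem cornerMat_apply_of_left {p : ℕ} (F : Mat S) {a b : Fin n}
    (ha : ¬ (p ≤ (a : ℕ) ∧ (a : ℕ) < p + S)) : cornerMat n p F a b = 0 := by
  by_contra h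
  obtain ⟨s, t, h1, h2, -⟩ := cornerMat_ne_zero h
  omega

theorem cornerMat_apply_of_right {p : ℕ} (F : Mat S) {a b : Fin n}
    (hb : ¬ (p ≤ (b : ℕ) ∧ (b : ℕ) < p + S)) : cornerMat n p F a b = 0 := by
  by_contra h
  obtain ⟨s, t, h1, h2, -⟩ := cornerMat_ne_zero h
  omega

theorem cornerMat_zero (p : ℕ) : cornerMat n p (0 : Mat S) = 0 := by
  rw [cornerMat, Matrix.mul_zero, Matrix.zero_mul]

theorem cornerMat_add (p : ℕ) (F G : Mat S) :
    cornerMat n p (F + G) = cornerMat n p F + cornerMat n p G := by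
  rw [cornerMat, Matrix.mul_add, Matrix.add_mul]
  rfl

theorem cornerMat_mul {p : ℕ} (hp : p + S ≤ n) (F G : Mat S) :
    cornerMat n p F * cornerMat n p G = cornerMat n p (F * G) := by
  have h : (inclMat n S p).transpose * inclMat n S p = 1 := by
    ext s t
    rw [Matrix.mul_apply, Finset.sum_eq_single ⟨p + s, by omega⟩]
    · simp only [Matrix.transpose_apply, inclMat_apply, if_true, one_mul, Matrix.one_apply]
      exact if_congr ⟨fun h => Fin.ext (by omega), fun h => by rw [h]⟩ rfl rfl
    · intro c _ hc
      rw [Matrix.transpose_apply, inclMat_apply, if_neg, zero_mul]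
      exact fun h => hc (Fin.ext h)
    · simp
  simp only [cornerMat]
  rw [Matrix.mul_assoc, Matrix.mul_assoc, Matrix.mul_assoc, Matrix.mul_assoc,
    ← Matrix.mul_assoc (inclMat n S p).transpose, h, Matrix.one_mul]
  simp only [Matrix.mul_assoc]

theorem continuous_cornerMat (p : ℕ) : Continuous (cornerMat n p : Mat S → Mat n) :=
  (continuous_const.matrix_mul continuous_id).matrix_mul continuous_const

/-- The blocks `F (β p)` at the positions `p, …, p + S - 1`, for all `p`. -/
def coneMat (n : ℕ) {S : ℕ} (β : ℕ → ℝ) (F : ℝ → Mat S) : Mat n :=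
  ∑ p ∈ Finset.range n, cornerMat n p (F (β p))

/-- The positions where `β` is non-zero are the beginnings of disjoint intervals of length `S`. -/
structure Separated (n S : ℕ) (β : ℕ → ℝ) : Prop where
  add_le : ∀ p < n, β p ≠ 0 → p + S ≤ n
  sep : ∀ p q, p < n → q < n → p ≠ q → p < q + S → q < p + S → β p = 0 ∨ β q = 0

variable {β : ℕ → ℝ}

theorem coneMat_apply_of_mem (hβ : Separated n S β) {F : ℝ → Mat S} (hF : F 0 = 0) {p : ℕ}
    (hp : p < n) (hβp : β p ≠ 0) {a : Fin n} (h1 : p ≤ (a : ℕ)) (h2 : (a : ℕ) < p + S)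
    (b : Fin n) : coneMat n β F a b = cornerMat n p (F (β p)) a b := by
  rw [coneMat, Matrix.sum_apply, Finset.sum_eq_single p]
  · intro q hq hqp
    by_cases h0 : β q = 0
    · rw [h0, hF, cornerMat_zero]
      rfl
    · refine cornerMat_apply_of_left _ fun h3 => ?_
      exact (hβ.sep p q hp (Finset.mem_range.1 hq) hqp.symm (by omega) (by omega)).elim hβp h0
  · intro h
    exact absurd (Finset.mem_range.2 hp) h

theorem coneMat_apply_of_forall_not {F : ℝ → Mat S} (hF : F 0 = 0) {a : Fin n}
    (ha : ∀ p < n, β p ≠ 0 → ¬ (p ≤ (a : ℕ) ∧ (a : ℕ) < p + S)) (b : Fin n) :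
    coneMat n β F a b = 0 := by
  rw [coneMat, Matrix.sum_apply]
  refine Finset.sum_eq_zero fun q hq => ?_
  by_cases h0 : β q = 0
  · rw [h0, hF, cornerMat_zero]
    rfl
  · exact cornerMat_apply_of_left _ (ha q (Finset.mem_range.1 hq) h0)

theorem coneMat_ne_zero {F : ℝ → Mat S} (hF : F 0 = 0) {a b : Fin n}
    (h : coneMat n β F a b ≠ 0) : ∃ p < n, β p ≠ 0 ∧ ∃ s t : Fin S, (a : ℕ) = p + s ∧
      (b : ℕ) = p + t ∧ F (β p) s t ≠ 0 := by
  rw [coneMat, Matrix.sum_apply] at h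
  obtain ⟨p, hp, h1⟩ := Finset.exists_ne_zero_of_sum_ne_zero h
  refine ⟨p, Finset.mem_range.1 hp, fun h0 => h1 ?_, cornerMat_ne_zero h1⟩
  rw [h0, hF, cornerMat_zero]
  rfl

theorem coneMat_add (F G : ℝ → Mat S) :
    coneMat n β (fun t => F t + G t) = coneMat n β F + coneMat n β G := by
  simp only [coneMat, cornerMat_add, Finset.sum_add_distrib]

/-- The blocks occupy disjoint intervals inside the matrix and multiply separately; `F 0 = 0`
removes the positions where no block begins. -/
theorem coneMat_mul (hβ : Separated n S β) {F G : ℝ → Mat S} (hF : F 0 = 0) (hG : G 0 = 0) :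
    coneMat n β F * coneMat n β G = coneMat n β fun t => F t * G t := by
  have hFG : (fun t => F t * G t) 0 = 0 := by simp [hF]
  ext a b
  by_cases h : ∃ p < n, β p ≠ 0 ∧ p ≤ (a : ℕ) ∧ (a : ℕ) < p + S
  · obtain ⟨p, hp, hβp, h1, h2⟩ := h
    rw [coneMat_apply_of_mem hβ hFG hp hβp h1 h2, ← cornerMat_mul (hβ.add_le p hp hβp),
      Matrix.mul_apply, Matrix.mul_apply]
    refine Finset.sum_congr rfl fun c _ => ?_
    rw [coneMat_apply_of_mem hβ hF hp hβp h1 h2]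
    by_cases hc : p ≤ (c : ℕ) ∧ (c : ℕ) < p + S
    · rw [coneMat_apply_of_mem hβ hG hp hβp hc.1 hc.2]
    · rw [cornerMat_apply_of_right _ hc, zero_mul, zero_mul]
  · rw [coneMat_apply_of_forall_not hFG (fun p hp hβp h' => h ⟨p, hp, hβp, h'⟩), Matrix.mul_apply]
    refine Finset.sum_eq_zero fun c _ => ?_
    rw [coneMat_apply_of_forall_not hF (fun p hp hβp h' => h ⟨p, hp, hβp, h'⟩), zero_mul]

theorem banded_coneMat {K : ℕ} {F : ℝ → Mat S} (hF : F 0 = 0) (hK : ∀ t, Banded K (F t)) :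
    Banded K (coneMat n β F) := by
  intro a b h
  obtain ⟨p, -, -, s, t, h1, h2, h3⟩ := coneMat_ne_zero hF h
  have := hK _ s t h3
  omega

end Cone

/-! ### Elements of DSH algebras made of inserted blocks -/

namespace CompositionSequence

variable {D : CompositionSequence.{u}}

/-- The element of a DSH algebra with the blocks `F (β p)` at the positions `p, …, p + S - 1`. -/
noncomputable def PosFun.cone {S : ℕ} (β : D.PosFun)
    (hβ : ∀ i x, Separated (D.n i) S (β i x))
    (F : ℝ → Mat S) (hF : Continuous F) (hF0 : F 0 = 0) : D.Alg :=
  ⟨fun i => ⟨fun x => coneMat (D.n i) (β i x) F, by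
    unfold coneMat
    exact continuous_finsetSum _ fun p _ =>
      (continuous_cornerMat p).comp (hF.comp (β.continuous_toFun i p))⟩, by
    rw [mem_algebra_iff]
    intro i y
    have hlt : ∀ k a, a < D.n ((D.list i y).pt k).1 → (D.list i y).off k + a < D.n i :=
      fun k a ha => (Nat.add_lt_add_left ha _).trans_le (offset_add_le (D.list i y).sum_dim k)
    -- An inserted block that meets a summand of the fibre at `y` lies inside it: it begins in some
    -- summand by compatibility, and `Separated` at the earlier stage keeps it from leaving that
    -- summand.
    have hblock : ∀ k a q, a < D.n ((D.list i y).pt k).1 → q < D.n i → β i y q ≠ 0 →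
        q ≤ (D.list i y).off k + a → (D.list i y).off k + a < q + S →
        ∃ q' < D.n ((D.list i y).pt k).1, q = (D.list i y).off k + q' ∧
          β ((D.list i y).pt k).1 ((D.list i y).pt k).2 q' ≠ 0 ∧
          q' + S ≤ D.n ((D.list i y).pt k).1 := by
      intro k a q ha hq h0 h1 h2
      obtain ⟨k', q', hq', rfl⟩ := exists_eq_offset_add (D.list i y).sum_dim hq
      have h3 := h0
      rw [β.compat i y k' q' hq'] at h3
      have h4 := (hβ _ _).add_le q' hq' h3
      simp only [PointList.off] at h1 h2
      have h5 := block_unique (m := fun k => D.n ((D.list i y).pt k).1) (k := k) (k' := k')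
        (a := a) (a' := offset (fun k => D.n ((D.list i y).pt k).1) k + a -
          offset (fun k => D.n ((D.list i y).pt k).1) k') ha (by omega) (by omega)
      obtain ⟨rfl, -⟩ := h5
      exact ⟨q', hq', rfl, h3, h4⟩
    rw [PointList.eval_eq, eq_diag_iff]
    constructor
    · intro k a b
      simp only [ContinuousMap.coe_mk]
      by_cases h : ∃ p < D.n ((D.list i y).pt k).1,
          β ((D.list i y).pt k).1 ((D.list i y).pt k).2 p ≠ 0 ∧ p ≤ (a : ℕ) ∧ (a : ℕ) < p + S
      · obtain ⟨p, hp, h0, h1, h2⟩ := h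
        rw [coneMat_apply_of_mem (hβ _ _) hF0 hp h0 h1 h2,
          coneMat_apply_of_mem (hβ _ _) hF0 (hlt k p hp) (by rwa [β.compat i y k p hp])
            (by rw [blockPos_val]; simp only [PointList.off]; omega)
            (by rw [blockPos_val]; simp only [PointList.off]; omega), β.compat i y k p hp]
        by_cases hb : p ≤ (b : ℕ) ∧ (b : ℕ) < p + S
        · rw [cornerMat_apply_add _ (s := ⟨a - p, by omega⟩) (t := ⟨b - p, by omega⟩)
              (by rw [blockPos_val]; simp only [PointList.off]; omega)
              (by rw [blockPos_val]; simp only [PointList.off]; omega),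
            cornerMat_apply_add _ (s := ⟨a - p, by omega⟩) (t := ⟨b - p, by omega⟩)
              (Nat.add_sub_cancel' h1).symm (Nat.add_sub_cancel' hb.1).symm]
        · rw [cornerMat_apply_of_right _ hb, cornerMat_apply_of_right]
          rw [blockPos_val]
          simp only [PointList.off]
          omega
      · rw [coneMat_apply_of_forall_not hF0 (fun p hp h0 h' => h ⟨p, hp, h0, h'⟩),
          coneMat_apply_of_forall_not hF0]
        rintro q hq h0 ⟨h1, h2⟩
        rw [blockPos_val] at h1 h2
        obtain ⟨q', hq', rfl, h3, h4⟩ := hblock k a q a.2 hq h0 h1 h2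
        simp only [PointList.off] at h1 h2
        exact h ⟨q', hq', h3, by omega, by omega⟩
    · intro k k' hk a b
      simp only [ContinuousMap.coe_mk]
      by_contra hne
      obtain ⟨q, hq, h0, s, t, h1, h2, -⟩ := coneMat_ne_zero hF0 hne
      rw [blockPos_val] at h1 h2
      obtain ⟨q', hq', rfl, h3, h4⟩ := hblock k a q a.2 hq h0
        (by simp only [PointList.off]; omega) (by simp only [PointList.off]; omega)
      simp only [PointList.off] at h1 h2
      exact hk (block_unique (m := fun k => D.n ((D.list i y).pt k).1) (a := q' + t) (a' := b)
        (by omega) b.2 (by omega)).1⟩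

theorem PosFun.cone_apply {S : ℕ} (β : D.PosFun)
    (hβ : ∀ i x, Separated (D.n i) S (β i x)) (F : ℝ → Mat S) (hF : Continuous F) (hF0 : F 0 = 0)
    (i) (x : D.X i) : (PosFun.cone β hβ F hF hF0).1 i x = coneMat (D.n i) (β i x) F := rfl

end CompositionSequence

/-- The largest deviation of `M` from the block `F` at the positions `p, …, p + S - 1`, in the rows
and columns of these positions. -/
noncomputable def deviation {n S : ℕ} (F : Mat S) (p : ℕ) (M : Mat n) : NNReal :=
  Finset.univ.sup fun c : Fin n × Fin n =>
    if (p ≤ (c.1 : ℕ) ∧ (c.1 : ℕ) < p + S) ∨ (p ≤ (c.2 : ℕ) ∧ (c.2 : ℕ) < p + S) then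
      ‖M c.1 c.2 - cornerMat n p F c.1 c.2‖₊ else 0

section Deviation

variable {n S : ℕ} {F : Mat S} {p : ℕ} {M : Mat n}

theorem norm_sub_le_deviation {a b : Fin n}
    (h : (p ≤ (a : ℕ) ∧ (a : ℕ) < p + S) ∨ (p ≤ (b : ℕ) ∧ (b : ℕ) < p + S)) :
    ‖M a b - cornerMat n p F a b‖ ≤ deviation F p M := by
  have h1 := Finset.le_sup (f := fun c : Fin n × Fin n =>
    if (p ≤ (c.1 : ℕ) ∧ (c.1 : ℕ) < p + S) ∨ (p ≤ (c.2 : ℕ) ∧ (c.2 : ℕ) < p + S) then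
      ‖M c.1 c.2 - cornerMat n p F c.1 c.2‖₊ else 0) (Finset.mem_univ (a, b))
  simp only [if_pos h] at h1
  exact_mod_cast h1

theorem continuous_deviation {X : Type*} [TopologicalSpace X] {M : X → Mat n}
    (hM : Continuous M) : Continuous fun x => deviation F p (M x) := by
  unfold deviation
  refine Continuous.finset_sup_apply fun c _ => ?_
  split_ifs
  · exact ((hM.matrix_elem _ _).sub continuous_const).nnnorm
  · exact continuous_const

theorem deviation_self (M : Mat n) : deviation M 0 M = 0 := by
  refine le_antisymm (Finset.sup_le fun c _ => ?_) bot_le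
  split_ifs
  · rw [cornerMat_apply_add (p := 0) M (s := c.1) (t := c.2) (by omega) (by omega), sub_self,
      nnnorm_zero]
  · exact le_rfl

/-- Entries that link different summands vanish in both matrices, so only those within the summand
`k` count. This makes the upper bound for the bump function compatible with the gluing. -/
theorem deviation_diag_le {t : ℕ} {m : Fin t → ℕ} {N : ℕ} (h : ∑ k, m k = N) {S : ℕ} {F : Mat S}
    (B : ∀ k, Mat (m k)) (k : Fin t) {p : ℕ} (hp : p + S ≤ m k) :
    deviation F (offset m k + p) (diag m h B) ≤ deviation F p (B k) := by
  refine Finset.sup_le fun c _ => ?_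
  split_ifs with hc
  · obtain ⟨a, b⟩ := c
    simp only at *
    obtain ⟨k₁, a, rfl⟩ := exists_blockPos h a
    obtain ⟨k₂, b, rfl⟩ := exists_blockPos h b
    have key : ∀ (k' : Fin t) (a : Fin (m k')), offset m k + p ≤ (blockPos m h k' a : ℕ) →
        (blockPos m h k' a : ℕ) < offset m k + p + S → k' = k := by
      intro k' a h1 h2
      rw [blockPos_val] at h1 h2
      exact (block_unique (a' := offset m k' + a - offset m k) a.2 (by omega) (by omega)).1
    by_cases h12 : k₁ = k₂
    · subst h12
      have hk : k₁ = k := hc.elim (fun hc => key _ _ hc.1 hc.2) fun hc => key _ _ hc.1 hc.2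
      subst hk
      rw [diag_blockPos_self]
      simp only [blockPos_val] at hc
      have h3 := norm_sub_le_deviation (F := F) (p := p) (M := B k₁) (a := a) (b := b) (by omega)
      by_cases hab : (p ≤ (a : ℕ) ∧ (a : ℕ) < p + S) ∧ (p ≤ (b : ℕ) ∧ (b : ℕ) < p + S)
      · rw [cornerMat_apply_add F (s := ⟨a - p, by omega⟩) (t := ⟨b - p, by omega⟩)
          (by rw [blockPos_val, add_assoc, Nat.add_sub_cancel' hab.1.1])
          (by rw [blockPos_val, add_assoc, Nat.add_sub_cancel' hab.2.1])]
        rw [cornerMat_apply_add F (s := ⟨a - p, by omega⟩) (t := ⟨b - p, by omega⟩)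
          (Nat.add_sub_cancel' hab.1.1).symm (Nat.add_sub_cancel' hab.2.1).symm] at h3
        exact_mod_cast h3
      · have h4 : cornerMat (m k₁) p F a b = 0 := by
          by_contra hne
          obtain ⟨s, t, h5, h6, -⟩ := cornerMat_ne_zero hne
          omega
        have h5 : cornerMat N (offset m k₁ + p) F (blockPos m h k₁ a) (blockPos m h k₁ b) = 0 := by
          by_contra hne
          obtain ⟨s, t, h5, h6, -⟩ := cornerMat_ne_zero hne
          rw [blockPos_val] at h5 h6
          omega
        rw [h5]
        rw [h4] at h3
        exact_mod_cast h3
    · have h5 : cornerMat N (offset m k + p) F (blockPos m h k₁ a) (blockPos m h k₂ b) = 0 := by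
        by_contra hne
        obtain ⟨s, t, h5, h6, -⟩ := cornerMat_ne_zero hne
        exact h12 ((key k₁ a (by omega) (by omega)).trans (key k₂ b (by omega) (by omega)).symm)
      rw [diag_blockPos_of_ne h B h12, h5, sub_self, nnnorm_zero]
      exact bot_le
  · exact bot_le

end Deviation

/-! ### Bump functions at the recurrences of a fibre -/

namespace CompositionSequence

variable {D : CompositionSequence.{u}}

/-- Near a point `x₀` outside `Y i₀`, and near the corresponding blocks at later stages, an element
`f` of a DSH algebra looks like its value at `x₀`: there is a bump function which indicates where
these blocks begin. -/
theorem exists_bump {i₀ : Fin D.length} {x₀ : D.X i₀} (hx₀ : x₀ ∉ D.Y i₀) (f : D.Alg) {ε : ℝ}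
    (hε : 0 < ε) : ∃ β : D.PosFun, (∀ i x, Separated (D.n i) (D.n i₀) (β i x)) ∧
      β i₀ x₀ 0 = 1 ∧ (∀ i x, ∀ p < D.n i, 0 ≤ β i x p) ∧
      ∀ i x, ∀ p < D.n i, β i x p ≠ 0 → deviation (f.1 i₀ x₀) p (f.1 i x) ≤ ε := by
  set S := D.n i₀ with hS
  have hS0 : 0 < S := D.n_pos i₀
  -- A bump may stand only where a block of size `S` fits in and deviates from the value at `x₀` by
  -- less than `ε`.
  set cap : ∀ i, D.X i → ℕ → ℝ := fun i x p =>
    if p + S ≤ D.n i then max 0 (1 - deviation (f.1 i₀ x₀) p (f.1 i x) / ε) else 0 with hcap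
  have hcapc : ∀ i p, Continuous fun x => cap i x p := by
    intro i p
    simp only [hcap]
    split_ifs
    · refine continuous_const.max (continuous_const.sub (Continuous.div_const ?_ ε))
      exact NNReal.continuous_coe.comp (continuous_deviation (f.1 i).continuous)
    · exact continuous_const
  have hcap0 : ∀ i x p, 0 ≤ cap i x p := by
    intro i x p
    simp only [hcap]
    split_ifs
    · exact le_max_left _ _
    · exact le_rfl
  have hcap1 : ∀ i x p, ¬ p + S ≤ D.n i → cap i x p = 0 := fun i x p h => if_neg h
  obtain ⟨u, hu0, hu1, hu⟩ := exists_continuous_zero_one_of_isClosed (D.isClosed_Y i₀)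
    (isClosed_singleton (x := x₀)) (Set.disjoint_singleton_right.2 hx₀)
  -- The lower bound is imposed at stage `i₀` only and fades out towards `Y i₀`, where the earlier
  -- stages decide; this is where `x₀ ∉ Y i₀` is needed.
  set U : ∀ i, C(D.X i, ℝ) := Function.update (fun i => (0 : C(D.X i, ℝ))) i₀ u with hU
  have hU0 : ∀ i x, 0 ≤ U i x ∧ U i x ≤ 1 := by
    intro i x
    by_cases h : i = i₀
    · subst h
      rw [hU, Function.update_self]
      exact hu x
    · rw [hU, Function.update_of_ne h]
      exact ⟨le_rfl, zero_le_one⟩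
  have hUY : ∀ i (y : D.Y i), U i y = 0 := by
    intro i y
    by_cases h : i = i₀
    · subst h
      rw [hU, Function.update_self]
      exact hu0 y.2
    · rw [hU, Function.update_of_ne h]
      rfl
  obtain ⟨β, h1, h2, h3⟩ := D.exists_separated_posFun S (cap := cap)
    (lo := fun i x p => if p = 0 then U i x * cap i x p else 0)
    (fun i p => by
      split_ifs
      · exact (U i).continuous.mul (hcapc i p)
      · exact continuous_const)
    hcapc
    (fun i x p => by
      split_ifs
      · exact mul_nonneg (hU0 i x).1 (hcap0 i x p)
      · exact le_rfl)
    (fun i x p => by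
      split_ifs
      · exact mul_le_of_le_one_left (hcap0 i x p) (hU0 i x).2
      · exact hcap0 i x p)
    (fun i y k a ha => by
      rw [hUY, zero_mul, ite_self]
      split_ifs
      · exact mul_nonneg (hU0 _ _).1 (hcap0 _ _ a)
      · exact le_rfl)
    (fun i y k a ha => by
      have hoff := offset_add_le (D.list i y).sum_dim k
      by_cases haS : a + S ≤ D.n ((D.list i y).pt k).1
      · have h4 := deviation_diag_le (F := f.1 i₀ x₀) (D.list i y).sum_dim
          (fun k => f.1 ((D.list i y).pt k).1 ((D.list i y).pt k).2) k haS
        rw [← PointList.eval_eq, ← f.2 i y] at h4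
        simp only [hcap]
        rw [if_pos haS, if_pos (by simp only [PointList.off]; omega)]
        exact max_le_max le_rfl (sub_le_sub_left
          (div_le_div_of_nonneg_right (by exact_mod_cast h4) hε.le) 1)
      · rw [hcap1 _ _ a haS]
        exact hcap0 _ _ _)
    (fun i x p q hp hq hpq h4 h5 h6 => by
      split_ifs at h6 with e1
      · subst e1
        -- At stage `i₀` the matrix size is `S` itself, so a block cannot begin at any position
        -- other than zero.
        by_cases h : i = i₀
        · subst h
          exact hcap1 i x q (by omega)
        · rw [hU, Function.update_of_ne h] at h6
          simp at h6
      · exact absurd h6 (lt_irrefl _))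
    (fun i y k k' a a' hk ha ha' h4 => by
      -- A block that fits into the summand `k` ends before the summand `k'` begins.
      left
      have := offset_add_le_offset (m := fun k => D.n ((D.list i y).pt k).1) hk
      simp only [PointList.off] at h4
      exact (hcap1 _ ((D.list i y).pt k).2 a (by omega)).le)
  have h0 : ∀ i x, ∀ p < D.n i, 0 ≤ β i x p := by
    intro i x p hp
    refine le_trans ?_ (h1 i x p hp)
    split_ifs
    · exact mul_nonneg (hU0 i x).1 (hcap0 i x p)
    · exact le_rfl
  have hne : ∀ i x, ∀ p < D.n i, β i x p ≠ 0 → cap i x p ≠ 0 := fun i x p hp h4 h5 =>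
    h4 (le_antisymm ((h2 i x p hp).trans h5.le) (h0 i x p hp))
  refine ⟨β, fun i x => ⟨fun p hp h4 => ?_, h3 i x⟩, le_antisymm ?_ ?_, h0,
    fun i x p hp h4 => ?_⟩
  · by_contra h5
    exact hne i x p hp h4 (hcap1 i x p h5)
  · refine (h2 i₀ x₀ 0 hS0).trans ?_
    simp [hcap, deviation_self, hS]
  · refine le_trans ?_ (h1 i₀ x₀ 0 hS0)
    have hux : u x₀ = 1 := hu1 rfl
    simp [hcap, deviation_self, hU, hux, hS]
  · have h5 := hne i x p hp h4
    by_contra h6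
    refine h5 ?_
    simp only [hcap]
    split_ifs
    · refine max_eq_left (sub_nonpos.2 ?_)
      rw [one_le_div hε]
      exact (not_le.1 h6).le
    · rfl

end CompositionSequence

/-! ### Invertible elements from paths of invertible matrices -/

namespace CompositionSequence

variable {D : CompositionSequence.{u}}

theorem PosFun.cone_mul {S : ℕ} (β : D.PosFun) (hβ : ∀ i x, Separated (D.n i) S (β i x))
    {F G H : ℝ → Mat S} (hF : Continuous F) (hF0 : F 0 = 0) (hG : Continuous G) (hG0 : G 0 = 0)
    (hH : Continuous H) (hH0 : H 0 = 0) (h : ∀ t, F t * G t = H t) :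
    β.cone hβ F hF hF0 * β.cone hβ G hG hG0 = β.cone hβ H hH hH0 := by
  refine Alg.ext fun i x => ?_
  rw [Alg.mul_apply, PosFun.cone_apply, PosFun.cone_apply, PosFun.cone_apply,
    coneMat_mul (hβ i x) hF0 hG0, funext h]

theorem PosFun.cone_add {S : ℕ} (β : D.PosFun) (hβ : ∀ i x, Separated (D.n i) S (β i x))
    {F G H : ℝ → Mat S} (hF : Continuous F) (hF0 : F 0 = 0) (hG : Continuous G) (hG0 : G 0 = 0)
    (hH : Continuous H) (hH0 : H 0 = 0) (h : ∀ t, F t + G t = H t) :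
    β.cone hβ F hF hF0 + β.cone hβ G hG hG0 = β.cone hβ H hH hH0 := by
  refine Alg.ext fun i x => ?_
  rw [Alg.add_apply, PosFun.cone_apply, PosFun.cone_apply, PosFun.cone_apply, ← coneMat_add,
    funext h]

theorem PosFun.cone_zero {S : ℕ} (β : D.PosFun) (hβ : ∀ i x, Separated (D.n i) S (β i x)) :
    β.cone hβ (fun _ => (0 : Mat S)) continuous_const rfl = 0 := by
  refine Alg.ext fun i x => ?_
  rw [PosFun.cone_apply, Alg.zero_apply]
  simp [coneMat, cornerMat_zero]

/-- Since `cone` respects sums and products, `v ↦ 1 + cone (v - 1)` is multiplicative on paths that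
start at the identity. -/
theorem PosFun.one_add_cone_mul {S : ℕ} (β : D.PosFun) (hβ : ∀ i x, Separated (D.n i) S (β i x))
    {v v' : ℝ → Mat S} (hv : Continuous v) (hv0 : v 0 - 1 = 0) (hv' : Continuous v')
    (hv0' : v' 0 - 1 = 0) (h : ∀ t, v t * v' t = 1) :
    (1 + β.cone hβ (fun t => v t - 1) (hv.sub continuous_const) hv0) *
      (1 + β.cone hβ (fun t => v' t - 1) (hv'.sub continuous_const) hv0') = 1 := by
  rw [add_mul, mul_add, mul_one, one_mul, add_assoc]
  conv_rhs => rw [← add_zero (1 : D.Alg)]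
  congr 1
  have h0 : (fun t => (v t - 1) * (v' t - 1)) 0 = 0 := by simp [hv0]
  rw [mul_add, mul_one, PosFun.cone_mul β hβ (H := fun t => (v t - 1) * (v' t - 1)) _ _ _ _
    (by fun_prop) h0 fun t => rfl, ← add_assoc,
    PosFun.cone_add β hβ (H := fun t => (v' t - 1) + (v t - 1)) _ _ _ _ (by fun_prop)
      (by simp [hv0, hv0']) (fun t => rfl),
    PosFun.cone_add β hβ (H := fun _ => 0) _ _ _ _ continuous_const rfl, PosFun.cone_zero]
  intro t
  have := h t
  simp only [sub_mul, mul_sub, mul_one, one_mul, this]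
  abel

theorem PosFun.isUnit_one_add_cone {S : ℕ} (β : D.PosFun)
    (hβ : ∀ i x, Separated (D.n i) S (β i x)) {v : ℝ → Mat S} (hv : Continuous v)
    (hv0 : v 0 - 1 = 0) (h : ∀ t, IsUnit (v t)) :
    IsUnit (1 + β.cone hβ (fun t => v t - 1) (hv.sub continuous_const) hv0) := by
  have hc : Continuous fun t => Ring.inverse (v t) := by
    refine continuous_iff_continuousAt.2 fun t => ?_
    obtain ⟨w, hw⟩ := h t
    refine ContinuousAt.comp (f := v) (g := Ring.inverse) ?_ hv.continuousAt
    rw [← hw]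
    exact NormedRing.inverse_continuousAt w
  have h0 : Ring.inverse (v 0) - 1 = 0 := by
    rw [sub_eq_zero.1 hv0, Ring.inverse_one, sub_self]
  exact isUnit_iff_exists.2 ⟨_,
    β.one_add_cone_mul hβ hv hv0 hc h0 fun t => Ring.mul_inverse_cancel _ (h t),
    β.one_add_cone_mul hβ hc h0 hv hv0 fun t => Ring.inverse_mul_cancel _ (h t)⟩

end CompositionSequence

/-! ### Exchanging blocks by cutoff functions -/

section Cutoff

variable {n S : ℕ} {β : ℕ → ℝ} {g : ℝ → ℝ}

theorem coneMat_smul_diagonal (hg : g 0 = 0) (d : Fin S → ℂ) :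
    coneMat n β (fun t => g t • Matrix.diagonal d) = Matrix.diagonal fun a =>
      coneMat n β (fun t => g t • Matrix.diagonal d) a a := by
  have hF : (fun t => g t • Matrix.diagonal d) 0 = 0 := by simp [hg]
  ext a b
  by_cases hab : a = b
  · rw [hab, Matrix.diagonal_apply_eq]
  · rw [Matrix.diagonal_apply_ne _ hab]
    by_contra hne
    obtain ⟨p, -, -, s, t, h1, h2, h3⟩ := coneMat_ne_zero hF hne
    have hst : s ≠ t := fun h => hab (Fin.ext (by omega))
    rw [Matrix.smul_apply, Matrix.diagonal_apply_ne _ hst, smul_zero] at h3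
    exact h3 rfl

theorem coneMat_smul_diagonal_apply (hβ : Separated n S β) (hg : g 0 = 0) (d : Fin S → ℂ) {p : ℕ}
    (hp : p < n) (hβp : β p ≠ 0) {a : Fin n} {s : Fin S} (ha : (a : ℕ) = p + s) :
    coneMat n β (fun t => g t • Matrix.diagonal d) a a = g (β p) * d s := by
  have hF : (fun t => g t • Matrix.diagonal d) 0 = 0 := by simp [hg]
  rw [coneMat_apply_of_mem hβ hF hp hβp (by omega) (by omega), cornerMat_apply_add _ ha ha]
  simp

theorem one_sub_coneMat_mul_mul (hg : g 0 = 0) (M : Mat n) (a b : Fin n) :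
    ((1 - coneMat n β fun t => g t • (1 : Mat S)) * M *
      (1 - coneMat n β fun t => g t • (1 : Mat S))) a b =
    (1 - coneMat n β (fun t => g t • (1 : Mat S)) a a) * M a b *
      (1 - coneMat n β (fun t => g t • (1 : Mat S)) b b) := by
  have h := coneMat_smul_diagonal (n := n) (S := S) (β := β) hg (fun _ => 1)
  rw [Matrix.diagonal_one] at h
  have h' : (1 : Mat n) - coneMat n β (fun t => g t • (1 : Mat S)) = Matrix.diagonal fun a =>
      1 - coneMat n β (fun t => g t • (1 : Mat S)) a a := by
    conv_lhs => rw [h, ← Matrix.diagonal_one, Matrix.diagonal_sub]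
  rw [h', Matrix.mul_diagonal, Matrix.diagonal_mul]

theorem coneMat_smul_one_apply (hβ : Separated n S β) (hg : g 0 = 0) (a : Fin n) :
    (∃ p < n, β p ≠ 0 ∧ ∃ s : Fin S, (a : ℕ) = p + s ∧
      coneMat n β (fun t => g t • (1 : Mat S)) a a = g (β p)) ∨
    (∀ p < n, β p ≠ 0 → ¬ (p ≤ (a : ℕ) ∧ (a : ℕ) < p + S)) ∧
      coneMat n β (fun t => g t • (1 : Mat S)) a a = 0 := by
  by_cases h : ∃ p < n, β p ≠ 0 ∧ p ≤ (a : ℕ) ∧ (a : ℕ) < p + S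
  · obtain ⟨p, hp, h0, h1, h2⟩ := h
    refine Or.inl ⟨p, hp, h0, ⟨a - p, by omega⟩, (Nat.add_sub_cancel' h1).symm, ?_⟩
    have := coneMat_smul_diagonal_apply hβ hg (fun _ => 1) hp h0 (s := ⟨a - p, by omega⟩)
      (Nat.add_sub_cancel' h1).symm
    rwa [Matrix.diagonal_one, mul_one] at this
  · refine Or.inr ⟨fun p hp h0 h' => h ⟨p, hp, h0, h'⟩, ?_⟩
    exact coneMat_apply_of_forall_not (by simp [hg]) (fun p hp h0 h' => h ⟨p, hp, h0, h'⟩) a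

/-- Exchanging the blocks of `M` which are close to `F` by `F'`. -/
theorem norm_exchange_sub_le (hβ : Separated n S β) (hg : g 0 = 0)
    (hg01 : ∀ t, 0 ≤ g t ∧ g t ≤ 1) {M : Mat n} {F F' : Mat S} {ε : ℝ} (hε : 0 ≤ ε)
    (hM : ∀ p < n, β p ≠ 0 → deviation F p M ≤ ε) (hF : ∀ s t, ‖F' s t - F s t‖ ≤ ε)
    (a b : Fin n) :
    ‖((1 - coneMat n β fun t => g t • (1 : Mat S)) * M *
      (1 - coneMat n β fun t => g t • (1 : Mat S)) +
      coneMat n β fun t => (1 - (1 - g t) ^ 2) • F') a b - M a b‖ ≤ 2 * ε := by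
  have hk : (fun t => (1 - (1 - g t) ^ 2) • F') 0 = 0 := by simp [hg]
  have hq : ∀ c : Fin n, ∃ q : ℝ, 0 ≤ q ∧ q ≤ 1 ∧
      1 - coneMat n β (fun t => g t • (1 : Mat S)) c c = q := by
    intro c
    rcases coneMat_smul_one_apply hβ hg c with ⟨p, -, -, -, -, h⟩ | ⟨-, h⟩
    · exact ⟨1 - g (β p), by linarith [(hg01 (β p)).2], by linarith [(hg01 (β p)).1], by
        rw [h]; push_cast; rfl⟩
    · exact ⟨1, zero_le_one, le_rfl, by rw [h]; simp⟩
  -- For entries with only the row or only the column in a block: they are at most `ε` in size,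
  -- because the inserted matrix is zero there, so shrinking them changes little.
  have hoff : ∀ q : ℝ, 0 ≤ q → q ≤ 1 → ∀ q' : ℝ, 0 ≤ q' → q' ≤ 1 → ∀ z : ℂ, ‖z‖ ≤ ε →
      ‖(q : ℂ) * z * q' - z‖ ≤ 2 * ε := by
    intro q h1 h2 q' h3 h4 z hz
    have e : (q : ℂ) * z * q' - z = ((q * q' - 1 : ℝ) : ℂ) * z := by push_cast; ring
    rw [e, norm_mul, Complex.norm_real, Real.norm_eq_abs]
    have h5 : |q * q' - 1| ≤ 1 := by
      rw [abs_le]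
      constructor <;> nlinarith
    nlinarith [norm_nonneg z, abs_nonneg (q * q' - 1)]
  rw [Matrix.add_apply, one_sub_coneMat_mul_mul hg]
  rcases coneMat_smul_one_apply hβ hg a with ⟨p, hp, h0, s, ha, h⟩ | ⟨ha, h⟩
  · have h1 := norm_sub_le_deviation (F := F) (p := p) (M := M) (a := a) (b := b)
      (Or.inl (by omega))
    have h2 := h1.trans (hM p hp h0)
    rw [coneMat_apply_of_mem (F := fun t => (1 - (1 - g t) ^ 2) • F') hβ hk hp h0 (by omega) (by omega)]
    by_cases hb : p ≤ (b : ℕ) ∧ (b : ℕ) < p + S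
    · have hb' : (b : ℕ) = p + (⟨b - p, by omega⟩ : Fin S) := (Nat.add_sub_cancel' hb.1).symm
      have h3 : coneMat n β (fun t => g t • (1 : Mat S)) b b = g (β p) := by
        have := coneMat_smul_diagonal_apply hβ hg (fun _ => 1) hp h0 hb'
        rwa [Matrix.diagonal_one, mul_one] at this
      rw [cornerMat_apply_add _ ha hb', h, h3]
      rw [cornerMat_apply_add _ ha hb'] at h2
      set t : Fin S := ⟨b - p, by omega⟩
      have h4 := hF s t
      obtain ⟨h5, h6⟩ := hg01 (β p)
      -- Within a block the new entry is a convex combination of those of `M` and `F'`, both of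
      -- which are within `ε` of `F`.
      have e : (1 - (g (β p) : ℂ)) * M a b * (1 - g (β p)) +
          ((1 - (1 - g (β p)) ^ 2) • F') s t - M a b =
          ((1 - (1 - g (β p)) ^ 2 : ℝ) : ℂ) * ((F' s t - F s t) - (M a b - F s t)) := by
        simp only [Matrix.smul_apply, Complex.real_smul]
        push_cast
        ring
      rw [e, norm_mul, Complex.norm_real, Real.norm_eq_abs]
      have h7 : |1 - (1 - g (β p)) ^ 2| ≤ 1 := by
        rw [abs_le]
        constructor <;> nlinarith
      have h8 := norm_sub_le (F' s t - F s t) (M a b - F s t)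
      nlinarith [norm_nonneg ((F' s t - F s t) - (M a b - F s t)),
        abs_nonneg (1 - (1 - g (β p)) ^ 2)]
    · rw [cornerMat_apply_of_right _ hb, sub_zero] at h2
      rw [cornerMat_apply_of_right _ hb, add_zero]
      obtain ⟨q, h3, h4, h5⟩ := hq a
      obtain ⟨q', h6, h7, h8⟩ := hq b
      rw [h5, h8]
      exact hoff q h3 h4 q' h6 h7 _ h2
  · rw [coneMat_apply_of_forall_not (F := fun t => (1 - (1 - g t) ^ 2) • F') hk ha, add_zero, h, sub_zero, one_mul]
    rcases coneMat_smul_one_apply hβ hg b with ⟨p, hp, h0, s, hb, h'⟩ | ⟨hb, h'⟩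
    · have h1 := norm_sub_le_deviation (F := F) (p := p) (M := M) (a := a) (b := b)
        (Or.inr (by omega))
      have h2 := h1.trans (hM p hp h0)
      rw [cornerMat_apply_of_left _ (ha p hp h0), sub_zero] at h2
      obtain ⟨q', h6, h7, h8⟩ := hq b
      rw [h8]
      simpa using hoff 1 zero_le_one le_rfl q' h6 h7 _ h2
    · rw [h', sub_zero, mul_one, sub_self, norm_zero]
      linarith

end Cutoff

/-! ### Zero rows near a point -/

namespace CompositionSequence

variable {D : CompositionSequence.{u}}

/-- If the blocks of `f` near the value at a point `x₀` outside `Y i₀` are close to `F'`, which can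
be deformed to a matrix whose first `r` rows are zero, then a small perturbation of `f` is, up to
invertible factors, a banded element with zero rows. -/
theorem exists_banded_exchange {i₀ : Fin D.length} {x₀ : D.X i₀} (hx₀ : x₀ ∉ D.Y i₀) {K r : ℕ}
    {f : D.Alg} (hf : ∀ i x, Banded K (f.1 i x)) {ε : ℝ} (hε : 0 < ε) {F' F'' : Mat (D.n i₀)}
    (hF' : ∀ s t, ‖F' s t - f.1 i₀ x₀ s t‖ ≤ ε) (hjoin : BandedJoined K F' F'')
    (hF'' : ∀ s t : Fin (D.n i₀), (s : ℕ) < r → F'' s t = 0) (hr : r ≤ D.n i₀) :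
    ∃ (U f' W : D.Alg) (h ζ : D.PosFun), IsUnit U ∧ IsUnit W ∧
      (∀ i x a b, ‖(U * f' * W).1 i x a b - f.1 i x a b‖ ≤ 2 * ε) ∧
      (∀ i x, Banded K ((U * f' * W).1 i x)) ∧
      (∀ i x, Banded K (f'.1 i x)) ∧
      (∀ i x (a b : Fin (D.n i)), f'.1 i x a b ≠ 0 → h i x a = 1) ∧
      (∀ i x, ∀ p < D.n i, ζ i x p ≠ 0 → p + r ≤ D.n i ∧
        ∀ q, p ≤ q → q < p + r → h i x q = 0) ∧
      (∀ i x p, 0 ≤ ζ i x p) ∧ ζ i₀ x₀ 0 = 1 := by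
  obtain ⟨β, hβ, hβ1, hβ0, hdev⟩ := exists_bump hx₀ f hε
  obtain ⟨V, W, hVW, hpath⟩ := hjoin
  set γ := hpath.somePath
  have hγ : ∀ t, γ.extend t ∈ bandedPairs K F' := by
    intro t
    obtain ⟨s, hs⟩ : γ.extend t ∈ Set.range γ := by
      rw [← Path.extend_range γ]
      exact ⟨t, rfl⟩
    rw [← hs]
    exact hpath.somePath_mem s
  have hγ0 : γ.extend 0 = (1, 1) := γ.extend_zero
  have hγ1 : γ.extend 1 = (V, W) := γ.extend_one
  have hγc : Continuous γ.extend := γ.continuous_extend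
  -- Four successive ramps on the quarters of `[0, 1]`: `g` cuts the block out of `f`, `b` runs
  -- along the deformation, `m` removes the first `r` rows from `h`, and `clamp (4 * t - 3)` gives
  -- `ζ`. Each has reached one before the next leaves zero.
  set b : ℝ → ℝ := fun t => clamp (4 * t - 1) with hb
  set g : ℝ → ℝ := fun t => clamp (4 * t) with hg
  set m : ℝ → ℝ := fun t => clamp (4 * t - 2) with hm
  have hgc : Continuous g := continuous_clamp.comp (by fun_prop)
  have hmc : Continuous m := continuous_clamp.comp (by fun_prop)
  have hbc : Continuous b := continuous_clamp.comp (by fun_prop)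
  have hb0 : b 0 = 0 := clamp_of_nonpos (by norm_num)
  have hg0 : g 0 = 0 := clamp_of_nonpos (by norm_num)
  have hm0 : m 0 = 0 := clamp_of_nonpos (by norm_num)
  have hbg : ∀ t, b t = 0 ∨ g t = 1 := by
    intro t
    rcases le_or_gt (4 * t) 1 with h | h
    · exact Or.inl (clamp_of_nonpos (by linarith))
    · exact Or.inr (clamp_of_one_le h.le)
  have hmb : ∀ t, m t ≠ 0 → b t = 1 ∧ g t = 1 := by
    intro t h
    have := pos_of_clamp_ne_zero h
    exact ⟨clamp_of_one_le (by linarith), clamp_of_one_le (by linarith)⟩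
  set v : ℝ → Mat (D.n i₀) := fun t => (γ.extend (b t)).1 with hv
  set w : ℝ → Mat (D.n i₀) := fun t => (γ.extend (b t)).2 with hw
  have hvc : Continuous v := continuous_fst.comp (hγc.comp hbc)
  have hwc : Continuous w := continuous_snd.comp (hγc.comp hbc)
  have hvu : ∀ t, IsUnit (v t) := fun t => (hγ _).1
  have hwu : ∀ t, IsUnit (w t) := fun t => (hγ _).2.1
  have hv1 : ∀ t, b t = 0 → v t = 1 := fun t ht => by simp only [hv, ht, hγ0]
  have hw1 : ∀ t, b t = 0 → w t = 1 := fun t ht => by simp only [hw, ht, hγ0]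
  have hvic : Continuous fun t => Ring.inverse (v t) := by
    refine continuous_iff_continuousAt.2 fun t => ?_
    obtain ⟨u, hu⟩ := hvu t
    refine ContinuousAt.comp (f := v) (g := Ring.inverse) ?_ hvc.continuousAt
    rw [← hu]
    exact NormedRing.inverse_continuousAt u
  have hwic : Continuous fun t => Ring.inverse (w t) := by
    refine continuous_iff_continuousAt.2 fun t => ?_
    obtain ⟨u, hu⟩ := hwu t
    refine ContinuousAt.comp (f := w) (g := Ring.inverse) ?_ hwc.continuousAt
    rw [← hu]
    exact NormedRing.inverse_continuousAt u
  have hvi0 : ∀ t, b t = 0 → Ring.inverse (v t) - 1 = 0 := fun t ht => by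
    rw [hv1 t ht, Ring.inverse_one, sub_self]
  have hwi0 : ∀ t, b t = 0 → Ring.inverse (w t) - 1 = 0 := fun t ht => by
    rw [hw1 t ht, Ring.inverse_one, sub_self]
  set k : ℝ → ℝ := fun t => 1 - (1 - g t) ^ 2 with hk
  have hkc : Continuous k := by fun_prop
  have hk0 : k 0 = 0 := by simp [hk, hg0]
  set P := β.cone hβ (fun t => g t • (1 : Mat (D.n i₀))) (by fun_prop) (by simp [hg0]) with hP
  set U := 1 + β.cone hβ (fun t => Ring.inverse (v t) - 1) (hvic.sub continuous_const)
    (hvi0 0 hb0) with hU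
  set Z := 1 + β.cone hβ (fun t => Ring.inverse (w t) - 1) (hwic.sub continuous_const)
    (hwi0 0 hb0) with hZ
  set R := β.cone hβ (fun t => k t • (v t * F' * w t)) (by fun_prop) (by simp [hk0]) with hR
  set E : Fin (D.n i₀) → ℂ := fun s => if (s : ℕ) < r then 1 else 0 with hE
  set C := β.cone hβ (fun t => m t • Matrix.diagonal E) (by fun_prop) (by simp [hm0]) with hC
  -- The correction in `U` lives where `b ≠ 0`, hence where `g = 1`, and there `1 - P` vanishes on
  -- the block. Thus `U` and `Z` undo the deformation of the block without touching the remainder of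
  -- `f`.
  have hUP : U * (1 - P) = 1 - P := by
    rw [hU, add_mul, one_mul, mul_sub, mul_one, hP, PosFun.cone_mul β hβ
      (H := fun t => Ring.inverse (v t) - 1) _ _ _ _ (hvic.sub continuous_const) (hvi0 0 hb0),
      sub_self, add_zero]
    intro t
    rcases hbg t with h | h
    · rw [hvi0 t h, zero_mul]
    · rw [h, one_smul, mul_one]
  have hPZ : (1 - P) * Z = 1 - P := by
    rw [hZ, mul_add, mul_one, sub_mul, one_mul, hP, PosFun.cone_mul β hβ
      (H := fun t => Ring.inverse (w t) - 1) _ _ _ _ (hwic.sub continuous_const) (hwi0 0 hb0),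
      sub_self, add_zero]
    intro t
    rcases hbg t with h | h
    · rw [hwi0 t h, mul_zero]
    · rw [h, one_smul, one_mul]
  have hURZ : U * R * Z = β.cone hβ (fun t => k t • F') (by fun_prop) (by simp [hk0]) := by
    have e1 : U * R = β.cone hβ (fun t => k t • (F' * w t)) (by fun_prop) (by simp [hk0]) := by
      rw [hU, add_mul, one_mul, hR, PosFun.cone_mul β hβ
        (H := fun t => (Ring.inverse (v t) - 1) * (k t • (v t * F' * w t))) _ _ _ _
        ((hvic.sub continuous_const).mul (by fun_prop)) (by simp [hk0]) fun _ => rfl]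
      refine PosFun.cone_add β hβ _ _ _ _ _ _ fun t => ?_
      rw [sub_mul, one_mul, add_sub_cancel, mul_smul_comm, mul_assoc (v t),
        Ring.inverse_mul_cancel_left _ _ (hvu t)]
    rw [e1, hZ, mul_add, mul_one, PosFun.cone_mul β hβ
      (H := fun t => (k t • (F' * w t)) * (Ring.inverse (w t) - 1)) _ _ _ _
      (Continuous.mul (by fun_prop) (hwic.sub continuous_const)) (by simp [hk0]) fun _ => rfl]
    refine PosFun.cone_add β hβ _ _ _ _ _ _ fun t => ?_
    rw [mul_sub, mul_one, add_sub_cancel, smul_mul_assoc,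
      Ring.mul_inverse_cancel_right _ _ (hwu t)]
  have hprod : U * ((1 - P) * f * (1 - P) + R) * Z =
      (1 - P) * f * (1 - P) + β.cone hβ (fun t => k t • F') (by fun_prop) (by simp [hk0]) := by
    rw [mul_add U, add_mul (U * _), hURZ]
    congr 1
    calc U * ((1 - P) * f * (1 - P)) * Z = (U * (1 - P)) * f * ((1 - P) * Z) := by
          simp only [mul_assoc]
      _ = _ := by rw [hUP, hPZ]
  have hQ : ∀ i x a b, ((1 - P) * f * (1 - P)).1 i x a b =
      (1 - coneMat (D.n i) (β i x) (fun t => g t • (1 : Mat (D.n i₀))) a a) * f.1 i x a b *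
        (1 - coneMat (D.n i) (β i x) (fun t => g t • (1 : Mat (D.n i₀))) b b) := fun i x a b =>
    one_sub_coneMat_mul_mul hg0 (f.1 i x) a b
  have hCin : ∀ i x, ∀ p < D.n i, β i x p ≠ 0 → ∀ (a : Fin (D.n i)) (s : Fin (D.n i₀)),
      (a : ℕ) = p + s → PosFun.ofAlg (1 - C) i x a = 1 - m (β i x p) * if (s : ℕ) < r then 1 else 0 := by
    intro i x p hp h0 a s ha
    rw [PosFun.ofAlg_apply, Alg.sub_apply, Alg.one_apply, Matrix.sub_apply, Matrix.one_apply_eq,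
      hC, PosFun.cone_apply, coneMat_smul_diagonal_apply (hβ i x) hm0 E hp h0 ha, hE]
    by_cases hs : (s : ℕ) < r <;> simp [hs]
  have hCout : ∀ i x (a : Fin (D.n i)),
      (∀ p < D.n i, β i x p ≠ 0 → ¬ (p ≤ (a : ℕ) ∧ (a : ℕ) < p + D.n i₀)) →
      PosFun.ofAlg (1 - C) i x a = 1 := by
    intro i x a ha
    rw [PosFun.ofAlg_apply, Alg.sub_apply, Alg.one_apply, Matrix.sub_apply, Matrix.one_apply_eq,
      hC, PosFun.cone_apply, coneMat_apply_of_forall_not (by simp [hm0]) ha]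
    simp
  have hcase : ∀ i x (a : Fin (D.n i)), (∃ p < D.n i, β i x p ≠ 0 ∧ ∃ s : Fin (D.n i₀),
      (a : ℕ) = p + s) ∨ (∀ p < D.n i, β i x p ≠ 0 → ¬ (p ≤ (a : ℕ) ∧ (a : ℕ) < p + D.n i₀)) := by
    intro i x a
    rcases coneMat_smul_one_apply (hβ i x) hg0 a with ⟨p, hp, h0, s, ha, -⟩ | ⟨h, -⟩
    · exact Or.inl ⟨p, hp, h0, s, ha⟩
    · exact Or.inr h
  refine ⟨U, (1 - P) * f * (1 - P) + R, Z, PosFun.ofAlg (1 - C),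
    β.comp (fun t => clamp (4 * t - 3)) (continuous_clamp.comp (by fun_prop)), ?_, ?_, ?_, ?_, ?_, ?_,
    ?_, fun i x p => clamp_nonneg _, ?_⟩
  · refine β.isUnit_one_add_cone hβ hvic (hvi0 0 hb0) fun t => ?_
    exact (hvu t).ringInverse
  · refine β.isUnit_one_add_cone hβ hwic (hwi0 0 hb0) fun t => ?_
    exact (hwu t).ringInverse
  · intro i x a b
    rw [hprod]
    exact norm_exchange_sub_le (hβ i x) hg0 (fun t => ⟨clamp_nonneg _, clamp_le_one _⟩) hε.le
      (hdev i x) hF' a b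
  · intro i x a a' hab
    rw [hprod, Alg.add_apply, Matrix.add_apply] at hab
    by_cases h1 : f.1 i x a a' = 0
    · rw [hQ, h1, mul_zero, zero_mul, zero_add] at hab
      refine banded_coneMat (F := fun t => k t • F') (by simp [hk0])
        (fun t s s' hs => ?_) a a' hab
      have h2 := (hγ 0).2.2
      rw [hγ0, one_mul, mul_one] at h2
      exact h2 s s' fun h => hs (by rw [Matrix.smul_apply, h, smul_zero])
    · exact hf i x a a' h1
  · intro i x a a' hab
    rw [Alg.add_apply, Matrix.add_apply] at hab
    by_cases h1 : f.1 i x a a' = 0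
    · rw [hQ, h1, mul_zero, zero_mul, zero_add] at hab
      refine banded_coneMat (F := fun t => k t • (v t * F' * w t)) (by simp [hk0])
        (fun t s s' hs => ?_) a a' hab
      exact (hγ (b t)).2.2 s s' fun h => hs (by
        rw [Matrix.smul_apply]
        exact (congrArg _ h).trans (smul_zero _))
    · exact hf i x a a' h1
  · intro i x a b' hab
    rcases hcase i x a with ⟨p, hp, h0, s, ha⟩ | ha
    · rw [hCin i x p hp h0 a s ha]
      by_contra hne
      have hs : (s : ℕ) < r := by
        by_contra hs
        simp [hs] at hne
      have hmp : m (β i x p) ≠ 0 := by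
        intro h
        simp [h] at hne
      -- Where `m` starts, the block of `f` is fully cut out and the path has arrived at `F''`; so
      -- the row is zero even where `h` is still strictly between zero and one.
      obtain ⟨hb1, hg1⟩ := hmb _ hmp
      refine hab ?_
      have e1 := coneMat_smul_diagonal_apply (hβ i x) hg0 (fun _ => 1) hp h0 ha
      rw [Matrix.diagonal_one, hg1] at e1
      rw [Alg.add_apply, Matrix.add_apply, hQ, e1]
      simp only [Complex.ofReal_one, mul_one, sub_self, zero_mul, zero_add]
      rw [hR, PosFun.cone_apply, coneMat_apply_of_mem (F := fun t => k t • (v t * F' * w t))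
        (hβ i x) (by simp [hk0]) hp h0 (by omega) (by omega)]
      by_contra hne'
      obtain ⟨s', t', h1, -, h3⟩ := cornerMat_ne_zero hne'
      have hss : s' = s := Fin.ext (by omega)
      subst hss
      refine h3 ?_
      simp only [Matrix.smul_apply, hv, hw, hb1, hγ1, hVW]
      rw [hF'' _ _ hs, smul_zero]
    · exact hCout i x a ha
  · intro i x p hp hne
    rw [PosFun.comp_apply] at hne
    have hpos := pos_of_clamp_ne_zero hne
    have h0 : β i x p ≠ 0 := by
      intro h
      rw [h] at hpos
      norm_num at hpos
    have hadd := (hβ i x).add_le p hp h0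
    refine ⟨by omega, fun q hq1 hq2 => ?_⟩
    have h1 := hCin i x p hp h0 ⟨q, by omega⟩ ⟨q - p, by omega⟩ (Nat.add_sub_cancel' hq1).symm
    rw [if_pos (show q - p < r by omega)] at h1
    refine h1.trans ?_
    simp only [hm]
    rw [clamp_of_one_le (by linarith)]
    norm_num
  · rw [PosFun.comp_apply, hβ1]
    exact clamp_of_one_le (by norm_num)

end CompositionSequence

/-! ### Block diagonal matrices of block diagonal matrices -/

section Nested

variable {t : ℕ} {n : Fin t → ℕ} {N : ℕ} {s : Fin t → ℕ} {m : ∀ k, Fin (s k) → ℕ}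

/-- The dimensions of the blocks in a concatenation of lists of blocks. -/
abbrev joinDim (m : ∀ k, Fin (s k) → ℕ) (q : Fin (∑ k, s k)) : ℕ :=
  m (finSigmaFinEquiv.symm q).1 (finSigmaFinEquiv.symm q).2

theorem sum_joinDim (h : ∑ k, n k = N) (hm : ∀ k, ∑ k', m k k' = n k) :
    ∑ q, joinDim m q = N := by
  have e := Equiv.sum_comp finSigmaFinEquiv.symm fun x : Σ k, Fin (s k) => m x.1 x.2
  rw [e, Fintype.sum_sigma, ← h]
  exact Finset.sum_congr rfl fun k _ => hm k

theorem offset_eq_sum {t : ℕ} (m : Fin t → ℕ) (k : Fin t) :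
    offset m k = ∑ i, if i < k then m i else 0 := by
  rw [offset, ← Finset.sum_filter]
  congr 1
  ext i
  simp

theorem offset_joinDim (hm : ∀ k, ∑ k', m k k' = n k) (q : Fin (∑ k, s k)) :
    offset (joinDim m) q = offset n (finSigmaFinEquiv.symm q).1 +
      offset (m (finSigmaFinEquiv.symm q).1) (finSigmaFinEquiv.symm q).2 := by
  obtain ⟨⟨k, k'⟩, rfl⟩ := finSigmaFinEquiv.surjective q
  rw [Equiv.symm_apply_apply]
  have hlt : ∀ l l', finSigmaFinEquiv ⟨l, l'⟩ < finSigmaFinEquiv (⟨k, k'⟩ : Σ k, Fin (s k)) ↔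
      offset s l + l' < offset s k + k' := by
    intro l l'
    rw [Fin.lt_def]
    have h1 := blockPos_val (m := s) rfl l l'
    have h2 := blockPos_val (m := s) rfl k k'
    simp only [blockPos, finCongr_refl, Equiv.refl_apply] at h1 h2
    rw [h1, h2]
  have e := Equiv.sum_comp finSigmaFinEquiv.symm fun x : Σ k, Fin (s k) =>
    if finSigmaFinEquiv x < finSigmaFinEquiv ⟨k, k'⟩ then m x.1 x.2 else 0
  simp only [Equiv.apply_symm_apply] at e
  rw [offset_eq_sum]
  refine e.trans ?_
  rw [Fintype.sum_sigma]
  have h1 : ∀ l, (∑ l', if finSigmaFinEquiv ⟨l, l'⟩ < finSigmaFinEquiv (⟨k, k'⟩ : Σ k, Fin (s k))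
      then m l l' else 0) = (if l < k then n l else 0) +
        if l = k then offset (m k) k' else 0 := by
    intro l
    simp only [hlt]
    rcases lt_trichotomy l k with h | h | h
    · rw [if_pos h, if_neg h.ne, add_zero, ← hm]
      refine Finset.sum_congr rfl fun l' _ => if_pos ?_
      have := offset_add_le_offset (m := s) h
      omega
    · subst h
      rw [if_neg (lt_irrefl _), if_pos rfl, zero_add, offset_eq_sum (m l)]
      refine Finset.sum_congr rfl fun l' _ => ?_
      exact if_congr (by rw [Fin.lt_def]; omega) rfl rfl
    · rw [if_neg h.not_gt, if_neg h.ne', add_zero]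
      refine Finset.sum_eq_zero fun l' _ => if_neg ?_
      have := offset_add_le_offset (m := s) h
      omega
  simp only [h1]
  rw [Finset.sum_add_distrib, Finset.sum_ite_eq' Finset.univ k, if_pos (Finset.mem_univ _),
    offset_eq_sum n]

theorem diag_diag (h : ∑ k, n k = N) (hm : ∀ k, ∑ k', m k k' = n k)
    (B : ∀ k k', Mat (m k k')) :
    diag n h (fun k => diag (m k) (hm k) (B k)) =
      diag (joinDim m) (sum_joinDim h hm) fun q =>
        B (finSigmaFinEquiv.symm q).1 (finSigmaFinEquiv.symm q).2 := by
  rw [eq_diag_iff]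
  have hpos : ∀ q a, blockPos (joinDim m) (sum_joinDim h hm) q a =
      blockPos n h (finSigmaFinEquiv.symm q).1 (blockPos (m (finSigmaFinEquiv.symm q).1)
        (hm (finSigmaFinEquiv.symm q).1) (finSigmaFinEquiv.symm q).2 a) := by
    intro q a
    refine Fin.ext ?_
    rw [blockPos_val, blockPos_val, blockPos_val, offset_joinDim hm, add_assoc]
  constructor
  · intro q a b
    rw [hpos, hpos, diag_blockPos_self, diag_blockPos_self]
  · have key : ∀ x x' : Σ k, Fin (s k), x ≠ x' → ∀ a b,
        diag n h (fun k => diag (m k) (hm k) (B k))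
          (blockPos n h x.1 (blockPos (m x.1) (hm x.1) x.2 a))
          (blockPos n h x'.1 (blockPos (m x'.1) (hm x'.1) x'.2 b)) = 0 := by
      rintro ⟨k, k'⟩ ⟨l, l'⟩ hne a b
      by_cases hkl : k = l
      · subst hkl
        rw [diag_blockPos_self, diag_blockPos_of_ne]
        exact fun h => hne (congrArg (Sigma.mk k) h)
      · rw [diag_blockPos_of_ne _ _ hkl]
    intro q q' hq a b
    rw [hpos, hpos]
    exact key _ _ (fun h => hq (finSigmaFinEquiv.symm.injective h)) a b

end Nested

/-! ### Norm estimates -/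

section Norm

variable {n : ℕ}

/-- The block is the compression of the whole matrix by the coordinate isometry `J`. -/
theorem norm_diag_block_le {t : ℕ} {m : Fin t → ℕ} {N : ℕ} (h : ∑ k, m k = N)
    (B : ∀ k, Mat (m k)) (k : Fin t) : ‖B k‖ ≤ ‖diag m h B‖ := by
  set J : Matrix (Fin N) (Fin (m k)) ℂ := (1 : Mat N).submatrix id (blockPos m h k) with hJ
  have hJJ : J.conjTranspose * J = 1 := by
    rw [hJ, Matrix.conjTranspose_submatrix, Matrix.conjTranspose_one]
    ext a b
    have hab : blockPos m h k a = blockPos m h k b ↔ a = b := by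
      rw [Fin.ext_iff, blockPos_val, blockPos_val, Fin.ext_iff]
      omega
    simp [Matrix.mul_apply, Matrix.one_apply, hab]
  have hJB : J.conjTranspose * diag m h B * J = B k := by
    rw [hJ, Matrix.conjTranspose_submatrix, Matrix.conjTranspose_one]
    ext a b
    rw [Matrix.mul_apply]
    simp [Matrix.mul_apply, Matrix.one_apply, diag_blockPos_self]
  have hJ1 : ‖J‖ ≤ 1 := by
    have h1 := Matrix.l2_opNorm_conjTranspose_mul_self J
    have h2 : ‖(1 : Mat (m k))‖ ≤ 1 := by
      rw [← Matrix.diagonal_one, Matrix.l2_opNorm_diagonal]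
      exact (pi_norm_le_iff_of_nonneg zero_le_one).2 fun _ => by simp
    rw [hJJ] at h1
    nlinarith [norm_nonneg J]
  calc ‖B k‖ = ‖J.conjTranspose * diag m h B * J‖ := by rw [hJB]
    _ ≤ ‖J.conjTranspose‖ * ‖diag m h B‖ * ‖J‖ :=
      (Matrix.l2_opNorm_mul _ _).trans (mul_le_mul_of_nonneg_right (Matrix.l2_opNorm_mul _ _)
        (norm_nonneg _))
    _ ≤ 1 * ‖diag m h B‖ * 1 := by
      rw [Matrix.l2_opNorm_conjTranspose]
      gcongr
    _ = ‖diag m h B‖ := by ring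

/-- A Schur estimate: rows and columns have at most `2 * K` non-zero entries, so Cauchy–Schwarz
bounds each row and the double sum is reordered by columns. The bound is independent of `n`, so
entrywise estimates suffice at all stages. -/
theorem Banded.norm_le {K : ℕ} {M : Mat n} (hM : Banded K M) {c : ℝ} (hc : 0 ≤ c)
    (h : ∀ a b, ‖M a b‖ ≤ c) : ‖M‖ ≤ (2 * K) * c := by
  set near : Fin n → Finset (Fin n) := fun a =>
    Finset.univ.filter fun b : Fin n => (a : ℕ) < b + K ∧ (b : ℕ) < a + K with hnear
  have hcard : ∀ a : Fin n, ((near a).card : ℝ) ≤ 2 * K := by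
    intro a
    have h1 : (near a).card ≤ (Finset.range (2 * K)).card := by
      refine Finset.card_le_card_of_injOn (fun b : Fin n => (b : ℕ) + K - a) (fun b hb => ?_)
        fun b hb b' hb' e => ?_
      · simp only [hnear, Finset.coe_filter, Finset.mem_univ, true_and, Set.mem_ofPred_eq] at hb
        simp only [Finset.coe_range, Set.mem_Iio]
        omega
      · simp only [hnear, Finset.coe_filter, Finset.mem_univ, true_and, Set.mem_ofPred_eq] at hb hb'
        simp only at e
        exact Fin.ext (by omega)
    rw [Finset.card_range] at h1
    exact_mod_cast h1
  rw [Matrix.cstar_norm_def]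
  refine ContinuousLinearMap.opNorm_le_bound _ (by positivity) fun v => ?_
  refine le_of_sq_le_sq ?_ (by positivity)
  rw [EuclideanSpace.norm_sq_eq, mul_pow, EuclideanSpace.norm_sq_eq]
  have hrow : ∀ a, ‖(Matrix.toEuclideanCLM (n := Fin n) (𝕜 := ℂ) M v) a‖ ^ 2 ≤
      (2 * K) * c ^ 2 * ∑ b : Fin n, if (a : ℕ) < b + K ∧ (b : ℕ) < a + K then ‖v b‖ ^ 2 else 0 := by
    intro a
    have h1 : (Matrix.toEuclideanCLM (n := Fin n) (𝕜 := ℂ) M v) a =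
        ∑ b ∈ near a, M a b * v b := by
      rw [Matrix.ofLp_toEuclideanCLM, Matrix.mulVec, dotProduct, hnear, Finset.sum_filter]
      refine Finset.sum_congr rfl fun b _ => ?_
      split_ifs with hab
      · rfl
      · rw [not_imp_comm.1 (hM a b) hab, zero_mul]
    have h2 : ‖(Matrix.toEuclideanCLM (n := Fin n) (𝕜 := ℂ) M v) a‖ ≤
        ∑ b ∈ near a, c * ‖v b‖ := by
      rw [h1]
      refine (norm_sum_le _ _).trans (Finset.sum_le_sum fun b _ => ?_)
      rw [norm_mul]
      exact mul_le_mul_of_nonneg_right (h a b) (norm_nonneg _)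
    calc _ ≤ (∑ b ∈ near a, c * ‖v b‖) ^ 2 := by gcongr
      _ ≤ (near a).card *
          ∑ b ∈ near a, (c * ‖v b‖) ^ 2 :=
        sq_sum_le_card_mul_sum_sq
      _ ≤ (2 * K) * ∑ b ∈ near a, (c * ‖v b‖) ^ 2 := by
        gcongr
        exact hcard a
      _ = _ := by
        simp only [mul_pow]
        rw [← Finset.mul_sum, hnear, Finset.sum_filter]
        ring
  calc _ ≤ ∑ a : Fin n, (2 * K) * c ^ 2 *
        ∑ b : Fin n, (if (a : ℕ) < b + K ∧ (b : ℕ) < a + K then ‖v b‖ ^ 2 else 0) :=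
      Finset.sum_le_sum fun a _ => hrow a
    _ = (2 * K) * c ^ 2 * ∑ b : Fin n, ∑ a : Fin n,
        (if (a : ℕ) < b + K ∧ (b : ℕ) < a + K then ‖v b‖ ^ 2 else 0) := by
      rw [← Finset.mul_sum, Finset.sum_comm]
    _ ≤ (2 * K) * c ^ 2 * ∑ b : Fin n, (2 * K) * ‖v b‖ ^ 2 := by
      refine mul_le_mul_of_nonneg_left (Finset.sum_le_sum fun b _ => ?_) (by positivity)
      rw [← Finset.sum_filter, Finset.sum_const, nsmul_eq_mul]
      refine mul_le_mul_of_nonneg_right ?_ (by positivity)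
      simpa only [hnear, and_comm] using hcard b
    _ = (2 * K * c) ^ 2 * ∑ b : Fin n, ‖v b‖ ^ 2 := by
      rw [← Finset.mul_sum]
      ring

theorem star_dotProduct_self {n : ℕ} (v : Fin n → ℂ) :
    star v ⬝ᵥ v = ((∑ s, ‖v s‖ ^ 2 : ℝ) : ℂ) := by
  rw [dotProduct, Complex.ofReal_sum]
  refine Finset.sum_congr rfl fun s _ => ?_
  rw [Pi.star_apply, RCLike.star_def, Complex.conj_mul', Complex.ofReal_pow]

/-- A matrix with a small singular value is close to a singular matrix. -/
theorem exists_singular_of_mem_spectrum {B : Mat n} {ε : ℝ} {l : ℝ} (hε : 0 < ε) (hl : l < ε ^ 2)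
    (h : (l : ℂ) ∈ spectrum ℂ (star B * B)) :
    ∃ B' : Mat n, B'.det = 0 ∧ ∀ s t, ‖B' s t - B s t‖ ≤ ε := by
  rw [spectrum.mem_iff, Matrix.isUnit_iff_isUnit_det, isUnit_iff_ne_zero, not_not,
    ← Matrix.exists_mulVec_eq_zero_iff] at h
  obtain ⟨ξ, hξ, h1⟩ := h
  rw [Matrix.sub_mulVec, sub_eq_zero, Algebra.algebraMap_eq_smul_one, Matrix.smul_mulVec,
    Matrix.one_mulVec] at h1
  set S : ℝ := ∑ s, ‖ξ s‖ ^ 2 with hS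
  have hS0 : 0 < S := by
    obtain ⟨s, hs⟩ := Function.ne_iff.1 hξ
    refine Finset.sum_pos' (fun _ _ => by positivity) ⟨s, Finset.mem_univ _, ?_⟩
    have : 0 < ‖ξ s‖ := norm_pos_iff.2 hs
    positivity
  have h2 : ∑ s, ‖(B.mulVec ξ) s‖ ^ 2 = l * S := by
    have h3 := star_dotProduct_self (B.mulVec ξ)
    rw [Matrix.star_mulVec, ← Matrix.dotProduct_mulVec, Matrix.mulVec_mulVec,
      ← Matrix.star_eq_conjTranspose, ← h1, dotProduct_smul, star_dotProduct_self, smul_eq_mul] at h3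
    exact_mod_cast h3.symm
  -- The rank one matrix that agrees with `B` on the eigenvector `ξ` is subtracted; it is small
  -- since `‖B ξ‖ ^ 2 = l * ‖ξ‖ ^ 2` and `l < ε ^ 2`.
  refine ⟨B - (S : ℂ)⁻¹ • Matrix.vecMulVec (B.mulVec ξ) (star ξ), ?_, fun s t => ?_⟩
  · rw [← Matrix.exists_mulVec_eq_zero_iff]
    refine ⟨ξ, hξ, ?_⟩
    have h4 : (S : ℂ) ≠ 0 := by exact_mod_cast hS0.ne'
    rw [Matrix.sub_mulVec, Matrix.smul_mulVec, Matrix.vecMulVec_mulVec, star_dotProduct_self,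
      ← hS]
    ext s
    simp [h4, mul_comm]
  · rw [Matrix.sub_apply, sub_sub_cancel_left, norm_neg, Matrix.smul_apply, Matrix.vecMulVec_apply,
      smul_eq_mul, norm_mul, norm_inv, Complex.norm_real, Real.norm_of_nonneg hS0.le, norm_mul,
      inv_mul_le_iff₀ hS0, Pi.star_apply, norm_star]
    have h5 : ‖(B.mulVec ξ) s‖ ^ 2 ≤ l * S := by
      rw [← h2]
      exact Finset.single_le_sum (f := fun s => ‖(B.mulVec ξ) s‖ ^ 2) (fun _ _ => by positivity)
        (Finset.mem_univ s)
    have h6 : ‖ξ t‖ ^ 2 ≤ S :=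
      Finset.single_le_sum (f := fun s => ‖ξ s‖ ^ 2) (fun _ _ => by positivity)
        (Finset.mem_univ t)
    refine le_of_sq_le_sq ?_ (by positivity)
    calc (‖(B.mulVec ξ) s‖ * ‖ξ t‖) ^ 2 = ‖(B.mulVec ξ) s‖ ^ 2 * ‖ξ t‖ ^ 2 := mul_pow _ _ _
      _ ≤ (ε ^ 2 * S) * S := by
        refine mul_le_mul (h5.trans ?_) h6 (by positivity) (by positivity)
        gcongr
      _ = (S * ε) ^ 2 := by ring

end Norm

section Instances

noncomputable abbrev CompositionSequence.instSemiringAlg (D : CompositionSequence.{u}) : Semiring D.Alg :=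
  inferInstance

noncomputable abbrev CompositionSequence.instAlgebraAlg (D : CompositionSequence.{u}) : Algebra ℂ D.Alg :=
  inferInstance

noncomputable abbrev CompositionSequence.instStarAlg (D : CompositionSequence.{u}) : Star D.Alg :=
  inferInstance

attribute [local instance] CompositionSequence.instSemiringAlg
  CompositionSequence.instAlgebraAlg CompositionSequence.instStarAlg

/-! ### Inductive systems -/

section InductiveSystem

variable {D : ℕ → CompositionSequence.{u}} (φ : ∀ j, (D j).Alg →⋆ₐ[ℂ] (D (j + 1)).Alg)

/-- The composite of the connecting maps from the algebra `j` to the algebra `k`, for `j ≤ k`. -/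
noncomputable def transition {j k : ℕ} (h : j ≤ k) : (D j).Alg →⋆ₐ[ℂ] (D k).Alg :=
  Nat.leRecOn (C := fun k => (D j).Alg →⋆ₐ[ℂ] (D k).Alg) h (fun {k} ψ => (φ k).comp ψ)
    (StarAlgHom.id ℂ (D j).Alg)

theorem transition_self (j : ℕ) : transition φ (le_refl j) = StarAlgHom.id ℂ (D j).Alg :=
  Nat.leRecOn_self _

theorem transition_succ {j k : ℕ} (h : j ≤ k) :
    transition φ (h.trans (Nat.le_succ k)) = (φ k).comp (transition φ h) :=
  Nat.leRecOn_succ h _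

theorem transition_transition {j k l : ℕ} (h : j ≤ k) (h' : k ≤ l) (b : (D j).Alg) :
    transition φ h' (transition φ h b) = transition φ (h.trans h') b := by
  induction l, h' using Nat.le_induction with
  | base => rw [transition_self]; rfl
  | succ l h' ih =>
    rw [transition_succ φ h', transition_succ φ (h.trans h'), StarAlgHom.comp_apply, ih]
    rfl

theorem connecting_eq_transition (j k : ℕ) (b : (D j).Alg) :
    connecting φ j k b = transition φ (Nat.le_add_right j k) b := by
  induction k with
  | zero => exact (DFunLike.congr_fun (transition_self φ j) b).symm
  | succ k ih =>
    exact (congrArg (φ (j + k)) ih).trans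
      (DFunLike.congr_fun (transition_succ φ (Nat.le_add_right j k)) b).symm

variable {φ} {A : Type v} [CStarAlgebra A] {ι : ∀ j, (D j).Alg →⋆ₐ[ℂ] A}

theorem IsInductiveLimit.transition_apply (hι : IsInductiveLimit φ ι) {j k : ℕ} (h : j ≤ k)
    (b : (D j).Alg) : ι k (transition φ h b) = ι j b := by
  induction k, h using Nat.le_induction with
  | base => rw [transition_self]; rfl
  | succ k h ih =>
    rw [transition_succ φ h, ← ih, ← hι.comp_eq k]
    rfl

theorem IsInductiveLimit.exists_norm_lt (hι : IsInductiveLimit φ ι) {j : ℕ} {b : (D j).Alg} {C : ℝ}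
    (h : ‖ι j b‖ < C) : ∃ k₀, ∀ k (hk : j ≤ k), k₀ ≤ k → ‖transition φ hk b‖ < C := by
  obtain ⟨m, hm⟩ := eventually_atTop.1 ((hι.norm_eq j b).eventually_lt_const h)
  refine ⟨j + m, fun k hk hmk => ?_⟩
  obtain ⟨p, rfl⟩ := Nat.exists_eq_add_of_le hk
  have := hm p (by omega)
  rwa [connecting_eq_transition] at this

end InductiveSystem

/-! ### Composition of diagonal maps -/

section Diagonal

/-- Concatenation of lists of points. -/
def PointList.join {l l' : ℕ} {X : Fin l → Type*} {n : Fin l → ℕ} {X' : Fin l' → Type*}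
    {n' : Fin l' → ℕ} {N : ℕ} (L : PointList X n N) (M : ∀ k, PointList X' n' (n (L.pt k).1)) :
    PointList X' n' N where
  t := ∑ k, (M k).t
  pt q := (M (finSigmaFinEquiv.symm q).1).pt (finSigmaFinEquiv.symm q).2
  sum_dim := sum_joinDim (m := fun k k' => n' ((M k).pt k').1) L.sum_dim fun k => (M k).sum_dim

theorem IsDiagonal.id (D : CompositionSequence.{u}) : IsDiagonal (StarAlgHom.id ℂ D.Alg) := by
  intro i x
  refine ⟨⟨1, fun _ => ⟨i, x⟩, by simp⟩, fun f => ?_⟩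
  rw [PointList.eval_eq]
  refine (eq_diag_iff _).2 ⟨fun k a b => ?_, fun k k' h => absurd (Subsingleton.elim k k') h⟩
  have h : ∀ c : Fin (D.n i), blockPos (fun _ : Fin 1 => D.n i) (by simp) k c = c := by
    intro c
    refine Fin.ext ?_
    rw [blockPos_val]
    simp [offset, Subsingleton.elim k 0]
  exact congrArg₂ (f.1 i x) (h a) (h b)

variable {D E G : CompositionSequence.{u}}

theorem PointList.eval_join {i : Fin G.length} {φ : D.Alg →⋆ₐ[ℂ] E.Alg}
    (L : PointList E.X E.n (G.n i)) (M : ∀ k, PointList D.X D.n (E.n (L.pt k).1))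
    (f : D.Alg) (hM : ∀ k, (φ f).1 (L.pt k).1 (L.pt k).2 = (M k).eval f.1) :
    L.eval (φ f).1 = (L.join M).eval f.1 := by
  rw [PointList.eval_eq, funext hM]
  exact diag_diag (m := fun k k' => D.n ((M k).pt k').1) L.sum_dim (fun k => (M k).sum_dim)
    fun k k' => f.1 ((M k).pt k').1 ((M k).pt k').2

theorem IsDiagonal.comp {ψ : E.Alg →⋆ₐ[ℂ] G.Alg} {φ : D.Alg →⋆ₐ[ℂ] E.Alg} (hψ : IsDiagonal ψ)
    (hφ : IsDiagonal φ) : IsDiagonal (ψ.comp φ) := by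
  intro i x
  obtain ⟨L, hL⟩ := hψ i x
  choose M hM using fun k => hφ (L.pt k).1 (L.pt k).2
  exact ⟨L.join M, fun f => (hL _).trans (L.eval_join M f fun k => hM k f)⟩

theorem isDiagonal_transition {D : ℕ → CompositionSequence.{u}}
    {φ : ∀ j, (D j).Alg →⋆ₐ[ℂ] (D (j + 1)).Alg} (hφ : ∀ j, IsDiagonal (φ j)) {j k : ℕ}
    (h : j ≤ k) : IsDiagonal (transition φ h) := by
  induction k, h using Nat.le_induction with
  | base =>
    rw [transition_self]
    exact IsDiagonal.id (D j)
  | succ k h ih =>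
    rw [transition_succ φ h]
    exact (hφ k).comp ih

theorem PosFun.ofAlg_off_add {φ : D.Alg →⋆ₐ[ℂ] E.Alg} {f : D.Alg} {i : Fin E.length} {x : E.X i}
    (L : PointList D.X D.n (E.n i)) (hL : (φ f).1 i x = L.eval f.1) (k : Fin L.t) {a : ℕ}
    (ha : a < D.n (L.pt k).1) :
    CompositionSequence.PosFun.ofAlg (φ f) i x (L.off k + a) =
      CompositionSequence.PosFun.ofAlg f (L.pt k).1 (L.pt k).2 a := by
  have e : L.off k + a = (blockPos (fun k => D.n (L.pt k).1) L.sum_dim k ⟨a, ha⟩ : ℕ) :=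
    (blockPos_val (m := fun k => D.n (L.pt k).1) L.sum_dim k ⟨a, ha⟩).symm
  rw [e, CompositionSequence.PosFun.ofAlg_apply, hL, PointList.eval_eq, diag_blockPos_self]
  exact (CompositionSequence.PosFun.ofAlg_apply f _ _ ⟨a, ha⟩).symm

namespace CompositionSequence

theorem Alg.norm_apply_le (f : D.Alg) (i) (x : D.X i) : ‖f.1 i x‖ ≤ ‖f‖ :=
  ((f.1 i).norm_coe_le_norm x).trans (norm_le_pi_norm f.1 i)

theorem Alg.norm_le {f : D.Alg} {C : ℝ} (hC : 0 ≤ C) (h : ∀ i x, ‖f.1 i x‖ ≤ C) : ‖f‖ ≤ C :=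
  (pi_norm_le_iff_of_nonneg hC).2 fun i => (ContinuousMap.norm_le _ hC).2 (h i)

theorem Alg.norm_map_apply_le (φ : D.Alg →⋆ₐ[ℂ] E.Alg) (f : D.Alg) (i) (x : E.X i) :
    ‖(φ f).1 i x‖ ≤ ‖f‖ :=
  (Alg.norm_apply_le _ i x).trans (NonUnitalStarAlgHom.norm_apply_le φ f)

end CompositionSequence

end Diagonal

/-! ### Consequences of simplicity -/

section Simple

variable {D : ℕ → CompositionSequence.{u}} {φ : ∀ j, (D j).Alg →⋆ₐ[ℂ] (D (j + 1)).Alg}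
  {A : Type v} [CStarAlgebra A] {ι : ∀ j, (D j).Alg →⋆ₐ[ℂ] A}

/-- The images of the elements which are pointwise dominated by a multiple of `a`. -/
def dominated (ι : ∀ j, (D j).Alg →⋆ₐ[ℂ] A) (φ : ∀ j, (D j).Alg →⋆ₐ[ℂ] (D (j + 1)).Alg) {j : ℕ}
    (a : (D j).Alg) : Set A :=
  {z | ∃ k, ∃ h : j ≤ k, ∃ y : (D k).Alg, ι k y = z ∧ ∃ C : ℝ, ∀ l (h' : k ≤ l) i x,
    ‖(transition φ h' y).1 i x‖ ≤ C * ‖(transition φ (h.trans h') a).1 i x‖}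

theorem IsInductiveLimit.dominated_of_le (hι : IsInductiveLimit φ ι) {j : ℕ} {a : (D j).Alg} {z : A}
    (hz : z ∈ dominated ι φ a) : ∃ k₀, ∀ k (hk : j ≤ k), k₀ ≤ k → ∃ y : (D k).Alg, ι k y = z ∧
    ∃ C : ℝ, ∀ l (h' : k ≤ l) i x,
      ‖(transition φ h' y).1 i x‖ ≤ C * ‖(transition φ (hk.trans h') a).1 i x‖ := by
  obtain ⟨k₀, h, y, hy, C, hC⟩ := hz
  refine ⟨k₀, fun k hk hkk => ⟨transition φ hkk y, ?_, C, fun l h' i x => ?_⟩⟩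
  · rw [hι.transition_apply, hy]
  · rw [transition_transition]
    exact hC l _ i x

-- The dominated elements form an ideal of the dense subalgebra. Its closure is a closed ideal
-- containing `ι j a ≠ 0`, so by simplicity some dominated `y` is within `1 / 2` of the unit, in the
-- limit and hence at all late stages. There `y` has norm above `1 / 2` at every point, which bounds
-- `a` from below.
set_option maxHeartbeats 1000000 in
theorem IsInductiveLimit.exists_forall_le_norm (hι : IsInductiveLimit φ ι) (hA : IsSimple A) {j : ℕ}
    {a : (D j).Alg} (ha : ι j a ≠ 0) : ∃ δ > 0, ∃ k₀, ∀ k (hk : j ≤ k), k₀ ≤ k → ∀ i x,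
      δ ≤ ‖(transition φ hk a).1 i x‖ := by
  obtain ⟨hnt, hA⟩ := hA
  set S := dominated ι φ a with hS
  have hmul : ∀ c ∈ ⋃ k, Set.range (ι k), ∀ z ∈ S, c * z ∈ S ∧ z * c ∈ S := by
    intro c hc z hz
    obtain ⟨m, c, rfl⟩ := Set.mem_iUnion.1 hc
    obtain ⟨k₀, hk₀⟩ := hι.dominated_of_le hz
    obtain ⟨y, rfl, C, hC⟩ := hk₀ (j + k₀ + m) (by omega) (by omega)
    set c' := transition φ (show m ≤ j + k₀ + m by omega) c
    have hc' : ι m c = ι _ c' := (hι.transition_apply _ _).symm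
    rw [hc', ← map_mul, ← map_mul]
    refine ⟨⟨j + k₀ + m, by omega, c' * y, rfl, ‖c'‖ * C, fun l h' i x => ?_⟩,
      ⟨j + k₀ + m, by omega, y * c', rfl, ‖c'‖ * C, fun l h' i x => ?_⟩⟩
    · rw [map_mul, CompositionSequence.Alg.mul_apply, mul_assoc]
      refine (norm_mul_le _ _).trans (mul_le_mul ?_ (hC l h' i x) (norm_nonneg _) (norm_nonneg _))
      exact CompositionSequence.Alg.norm_map_apply_le _ _ _ _
    · rw [map_mul, CompositionSequence.Alg.mul_apply, mul_assoc, mul_comm ‖c'‖]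
      refine (norm_mul_le _ _).trans (mul_le_mul (hC l h' i x) ?_ (norm_nonneg _)
        ((norm_nonneg _).trans (hC l h' i x)))
      exact CompositionSequence.Alg.norm_map_apply_le _ _ _ _
  have hadd : ∀ z ∈ S, ∀ w ∈ S, z + w ∈ S := by
    intro z hz w hw
    obtain ⟨k₀, hk₀⟩ := hι.dominated_of_le hz
    obtain ⟨k₁, hk₁⟩ := hι.dominated_of_le hw
    obtain ⟨y, rfl, C, hC⟩ := hk₀ (j + k₀ + k₁) (by omega) (by omega)
    obtain ⟨y', rfl, C', hC'⟩ := hk₁ (j + k₀ + k₁) (by omega) (by omega)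
    refine ⟨j + k₀ + k₁, by omega, y + y', map_add _ _ _, C + C', fun l h' i x => ?_⟩
    rw [map_add, CompositionSequence.Alg.add_apply, add_mul]
    exact (norm_add_le _ _).trans (add_le_add (hC l h' i x) (hC' l h' i x))
  have hneg : ∀ z ∈ S, -z ∈ S := by
    rintro _ ⟨k, h, y, rfl, C, hC⟩
    refine ⟨k, h, -y, map_neg _ _, C, fun l h' i x => ?_⟩
    rw [map_neg]
    exact (norm_neg _).trans_le (hC l h' i x)
  have hself : ι j a ∈ S := ⟨j, le_rfl, a, rfl, 1, fun l h' i x => (one_mul _).ge⟩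
  have hzero : (0 : A) ∈ S := ⟨j, le_rfl, 0, map_zero _, 1, fun l h' i x => by
    rw [map_zero, CompositionSequence.Alg.zero_apply, norm_zero]; positivity⟩
  have hdense : ∀ c : A, c ∈ closure (⋃ k, Set.range (ι k)) := fun c => hι.dense c
  set I : TwoSidedIdeal A := TwoSidedIdeal.mk' (closure S) (subset_closure hzero)
    (fun hx hy => map_mem_closure₂ continuous_add hx hy hadd)
    (fun hx => map_mem_closure continuous_neg hx hneg)
    (fun {x} _ hy => map_mem_closure₂ continuous_mul (hdense x) hy fun c hc z hz => (hmul c hc z hz).1)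
    (fun {_} y hx => map_mem_closure₂ continuous_mul hx (hdense y) fun z hz c hc => (hmul c hc z hz).2)
    with hI
  have hIcl : IsClosed (I : Set A) := by
    rw [hI, TwoSidedIdeal.coe_mk']
    exact isClosed_closure
  have haI : ι j a ∈ I := by
    rw [hI, TwoSidedIdeal.mem_mk']
    exact subset_closure hself
  have h1 : (1 : A) ∈ I := by
    rcases hA I hIcl with h | h
    · rw [h, TwoSidedIdeal.mem_bot] at haI
      exact absurd haI ha
    · rw [h]
      trivial
  rw [hI, TwoSidedIdeal.mem_mk', Metric.mem_closure_iff] at h1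
  obtain ⟨_, ⟨k, hjk, y, rfl, C, hC⟩, h2⟩ := h1 (1 / 2) (by norm_num)
  rw [dist_eq_norm, ← map_one (ι k), ← map_sub] at h2
  obtain ⟨k₀, hk₀⟩ := hι.exists_norm_lt h2
  refine ⟨1 / (2 * (|C| + 1)), by positivity, k + k₀, fun l hl hkl i x => ?_⟩
  have h3 := (CompositionSequence.Alg.norm_apply_le _ i x).trans_lt
    (hk₀ l (by omega) (by omega))
  rw [map_sub, map_one, CompositionSequence.Alg.sub_apply, CompositionSequence.Alg.one_apply] at h3
  have h4 := hC l (by omega) i x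
  have h5 : ‖(1 : Mat ((D l).n i))‖ = 1 := by
    have : Nonempty (Fin ((D l).n i)) := ⟨⟨0, (D l).n_pos i⟩⟩
    exact norm_one
  have h6 := norm_sub_norm_le (1 : Mat ((D l).n i)) ((transition φ (show k ≤ l by omega) y).1 i x)
  rw [h5] at h6
  rw [div_le_iff₀ (by positivity)]
  nlinarith [le_abs_self C, norm_nonneg ((transition φ hl a).1 i x)]

end Simple

/-! ### Elements with finite spectrum -/

/-- The spectrum consists of roots of `p`, so `a - c` is invertible for arbitrarily small `c`. -/
theorem mem_closure_units_of_aeval_eq_zero {A : Type*} [CStarAlgebra A] [Nontrivial A] {a : A}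
    {p : Polynomial ℂ} (hp : p ≠ 0) (h : Polynomial.aeval a p = 0) :
    a ∈ closure {a : A | IsUnit a} := by
  have hσ : spectrum ℂ a ⊆ p.roots.toFinset := by
    intro c hc
    have h1 := spectrum.subset_polynomial_aeval a p ⟨c, hc, rfl⟩
    rw [h, spectrum.zero_eq, Set.mem_singleton_iff] at h1
    simpa [hp] using h1
  have hd : Dense (spectrum ℂ a)ᶜ :=
    ((p.roots.toFinset.finite_toSet.subset hσ).countable).dense_compl ℝ
  have h1 := map_mem_closure (f := fun c : ℂ => a - algebraMap ℂ A c)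
    (t := {a : A | IsUnit a}) (by fun_prop) (hd 0) fun c hc => by
      have h2 := (spectrum.notMem_iff.1 hc).neg
      rwa [neg_sub] at h2
  simpa using h1

/-- By Cayley–Hamilton the normalised coefficients of the characteristic polynomial will do. Padding
to length `N` puts the vectors for all sizes below `N` on one compact sphere. -/
theorem exists_unit_vector_sum_pow_eq_zero {n N : ℕ} (hn : n < N) (M : Mat n) :
    ∃ c : Fin N → ℂ, ‖c‖ = 1 ∧ ∑ m, c m • M ^ (m : ℕ) = 0 := by
  set c : Fin N → ℂ := fun m => M.charpoly.coeff m with hc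
  have hdeg : M.charpoly.natDegree = n := by
    rw [Matrix.charpoly_natDegree_eq_dim, Fintype.card_fin]
  have hc0 : c ≠ 0 := by
    intro h
    have h1 := congrFun h ⟨n, hn⟩
    have h2 := M.charpoly_monic.coeff_natDegree
    rw [hdeg] at h2
    simp [hc, h2] at h1
  have hsum : ∑ m, c m • M ^ (m : ℕ) = 0 := by
    have h1 := Matrix.aeval_self_charpoly M
    rw [Polynomial.aeval_eq_sum_range' (by omega : M.charpoly.natDegree < N)] at h1
    rw [← h1, Finset.sum_range]
  refine ⟨(‖c‖⁻¹ : ℂ) • c, ?_, ?_⟩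
  · rw [norm_smul, norm_inv, Complex.norm_real, norm_norm]
    exact inv_mul_cancel₀ (norm_ne_zero_iff.2 hc0)
  · simp only [Pi.smul_apply, smul_assoc]
    rw [← Finset.smul_sum, hsum, smul_zero]

namespace CompositionSequence

/-- The evaluation at a point. -/
noncomputable def evalAt {D : CompositionSequence.{u}} (i : Fin D.length) (x : D.X i) :
    D.Alg →⋆ₐ[ℂ] Mat (D.n i) where
  toFun f := f.1 i x
  map_one' := rfl
  map_mul' _ _ := rfl
  map_zero' := rfl
  map_add' _ _ := rfl
  commutes' _ := rfl
  map_star' _ := rfl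

theorem evalAt_apply {D : CompositionSequence.{u}} (i : Fin D.length) (x : D.X i) (f : D.Alg) :
    evalAt i x f = f.1 i x := rfl

/-- Where the positive part of `ε ^ 2 - star f * f` does not vanish, the values of `f` are close to
singular matrices. -/
theorem exists_singular_of_cfc_ne_zero {D : CompositionSequence.{u}} (f : D.Alg) {ε : ℝ}
    (hε : 0 < ε) (i : Fin D.length) (x : D.X i)
    (h : (cfc (fun t : ℝ => max 0 (ε ^ 2 - t)) (star f * f)).1 i x ≠ 0) :
    ∃ B' : Mat (D.n i), B'.det = 0 ∧ ∀ s t, ‖B' s t - f.1 i x s t‖ ≤ ε := by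
  have h1 : evalAt i x (cfc (fun t : ℝ => max 0 (ε ^ 2 - t)) (star f * f)) =
      cfc (fun t : ℝ => max 0 (ε ^ 2 - t)) (evalAt i x (star f * f)) := by
    refine StarAlgHom.map_cfc (evalAt i x) _ _ (by fun_prop) ?_ (IsSelfAdjoint.star_mul_self f) ?_
    · exact (continuous_eval_const x).comp ((continuous_apply i).comp continuous_subtype_val)
    · exact IsSelfAdjoint.star_mul_self (f.1 i x)
  rw [evalAt_apply] at h1
  rw [h1] at h
  have h2 : evalAt i x (star f * f) = star (f.1 i x) * f.1 i x := rfl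
  rw [h2] at h
  by_contra hne
  refine h ?_
  rw [← cfc_zero ℝ (star (f.1 i x) * f.1 i x)]
  refine cfc_congr fun t ht => ?_
  refine max_eq_left (sub_nonpos.2 (le_of_not_gt fun hlt => hne ?_))
  refine exists_singular_of_mem_spectrum hε hlt ?_
  exact (spectrum.algebraMap_mem_iff (S := ℂ)).2 ht

end CompositionSequence

theorem continuous_of_starAlgHom {D : CompositionSequence.{u}} {A : Type v} [CStarAlgebra A]
    (φ : D.Alg →⋆ₐ[ℂ] A) : Continuous φ :=
  AddMonoidHomClass.continuous_of_bound φ 1 fun f => by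
    rw [one_mul]
    exact NonUnitalStarAlgHom.norm_apply_le φ f

theorem continuous_norm_sigma {D : CompositionSequence.{u}} (a : D.Alg) :
    Continuous fun q : Σ i, D.X i => ‖a.1 q.1 q.2‖ :=
  continuous_sigma fun i => (a.1 i).continuous.norm

/-! ### Annihilating polynomials, points visible in the limit, singular blocks -/

section Limit

variable {D : ℕ → CompositionSequence.{u}} {φ : ∀ j, (D j).Alg →⋆ₐ[ℂ] (D (j + 1)).Alg}
  {A : Type v} [CStarAlgebra A] {ι : ∀ j, (D j).Alg →⋆ₐ[ℂ] A}

theorem norm_sum_smul_pow_le {D E : CompositionSequence.{u}} (ψ : D.Alg →⋆ₐ[ℂ] E.Alg) (f : D.Alg)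
    {N : ℕ} (c d : Fin N → ℂ) (i : Fin E.length) (x : E.X i)
    (hd : ∑ m, d m • (ψ f).1 i x ^ (m : ℕ) = 0) :
    ‖(ψ (∑ m, c m • f ^ (m : ℕ))).1 i x‖ ≤ ‖c - d‖ * ∑ m : Fin N, (‖f‖ + 1) ^ (m : ℕ) := by
  have h1 : (ψ (∑ m, c m • f ^ (m : ℕ))).1 i x = ∑ m, (c - d) m • (ψ f).1 i x ^ (m : ℕ) := by
    have h2 : ((CompositionSequence.evalAt i x).comp ψ) (∑ m, c m • f ^ (m : ℕ)) =
        ∑ m, c m • (((CompositionSequence.evalAt i x).comp ψ) f) ^ (m : ℕ) := by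
      simp only [map_sum, map_smul, map_pow]
    simp only [Pi.sub_apply, sub_smul, Finset.sum_sub_distrib, hd, sub_zero]
    exact h2
  rw [h1, Finset.mul_sum]
  refine (norm_sum_le _ _).trans (Finset.sum_le_sum fun m _ => ?_)
  rw [norm_smul]
  refine mul_le_mul (norm_le_pi_norm (c - d) m) ?_ (norm_nonneg _) (norm_nonneg _)
  have : Nonempty (Fin (E.n i)) := ⟨⟨0, E.n_pos i⟩⟩
  refine (norm_pow_le _ _).trans (pow_le_pow_left₀ (norm_nonneg _) ?_ _)
  exact (CompositionSequence.Alg.norm_map_apply_le ψ f i x).trans (by linarith)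

/-- If the dimensions do not tend to infinity, then the elements of the algebras in the system have
finite spectrum in the limit. -/
theorem IsInductiveLimit.mem_closure_units_of_bounded (hι : IsInductiveLimit φ ι) (hA : IsSimple A)
    {N : ℕ} (hN : ∀ J, ∃ k, J ≤ k ∧ ∃ i, ∃ _ : (D k).X i, (D k).n i < N) (j : ℕ) (f : (D j).Alg) :
    ι j f ∈ closure {a : A | IsUnit a} := by
  have hnt := hA.1
  choose k hk i x hn using fun J => hN (j + J)
  have hjk : ∀ J, j ≤ k J := fun J => (Nat.le_add_right j J).trans (hk J)
  choose c hc1 hc using fun J =>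
    exists_unit_vector_sum_pow_eq_zero (hn J) ((transition φ (hjk J) f).1 (i J) (x J))
  obtain ⟨d, hd, ψ, hψ, hlim⟩ := (isCompact_sphere (0 : Fin N → ℂ) 1).tendsto_subseq
    (x := c) fun J => by simp [hc1]
  have hd1 : ‖d‖ = 1 := by simpa using hd
  set g := ∑ m, d m • f ^ (m : ℕ) with hg
  -- The images of `g` become arbitrarily small at the points `x J` of later and later stages, so
  -- `g` cannot survive in the limit.
  have hg0 : ι j g = 0 := by
    by_contra hne
    obtain ⟨δ, hδ, k₀, hk₀⟩ := hι.exists_forall_le_norm hA hne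
    have h1 : Tendsto (fun J => ‖d - c (ψ J)‖ * ∑ m : Fin N, (‖f‖ + 1) ^ (m : ℕ)) atTop (𝓝 0) := by
      have h2 := ((tendsto_const_nhds (x := d)).sub hlim).norm
      rw [sub_self, norm_zero] at h2
      simpa using h2.mul_const (∑ m : Fin N, (‖f‖ + 1) ^ (m : ℕ))
    obtain ⟨J₀, hJ₀⟩ := eventually_atTop.1 (h1.eventually_lt_const hδ)
    have h3 := hJ₀ (max J₀ k₀) (le_max_left _ _)
    set J := ψ (max J₀ k₀)
    have h4 : k₀ ≤ k J := ((le_max_right J₀ k₀).trans (hψ.id_le _)).trans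
      ((Nat.le_add_left _ j).trans (hk _))
    have h5 := hk₀ (k J) (hjk J) h4 (i J) (x J)
    have h6 := norm_sum_smul_pow_le (transition φ (hjk J)) f d (c J) (i J) (x J) (hc J)
    exact absurd (h5.trans h6) (not_le.2 h3)
  refine mem_closure_units_of_aeval_eq_zero
    (p := ∑ m : Fin N, Polynomial.C (d m) * Polynomial.X ^ (m : ℕ)) ?_ ?_
  · intro h
    have hd0 : d = 0 := by
      funext m
      have h1 := congrArg (fun p => Polynomial.coeff p m) h
      simp only [Polynomial.finsetSum_coeff, Polynomial.coeff_C_mul, Polynomial.coeff_X_pow,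
        Polynomial.coeff_zero] at h1
      rw [Finset.sum_eq_single m] at h1
      · simpa using h1
      · intro m' _ hm'
        rw [if_neg (fun h => hm' (Fin.ext h.symm)), mul_zero]
      · simp
    rw [hd0, norm_zero] at hd1
    exact zero_ne_one hd1
  · rw [← hg0, hg]
    simp only [map_sum, map_pow, map_mul, Polynomial.aeval_C, Polynomial.aeval_X,
      Algebra.smul_def]
    refine Finset.sum_congr rfl fun m _ => ?_
    rw [AlgHomClass.commutes]

theorem IsInductiveLimit.nonempty_points (hA : IsSimple A) (ι : ∀ j, (D j).Alg →⋆ₐ[ℂ] A) (k : ℕ) :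
    Nonempty (Σ i, (D k).X i) := by
  have hnt := hA.1
  by_contra hne
  have h1 : (1 : (D k).Alg) = 0 :=
    CompositionSequence.Alg.ext fun i x => absurd ⟨⟨i, x⟩⟩ hne
  have h2 := congrArg (ι k) h1
  rw [map_one, map_zero] at h2
  exact one_ne_zero h2

theorem PointList.t_pos {E : CompositionSequence.{u}} {N : ℕ} (hN : 0 < N)
    (L : PointList E.X E.n N) : 0 < L.t := by
  rcases Nat.eq_zero_or_pos L.t with h | h
  · exfalso
    have h1 := L.sum_dim
    have : IsEmpty (Fin L.t) := by rw [h]; infer_instance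
    rw [Fintype.sum_empty] at h1
    omega
  · exact h

theorem PointList.norm_apply_le {E : CompositionSequence.{u}} {N : ℕ} (L : PointList E.X E.n N)
    (f : E.Alg) (k : Fin L.t) : ‖f.1 (L.pt k).1 (L.pt k).2‖ ≤ ‖L.eval f.1‖ :=
  norm_diag_block_le L.sum_dim (fun k => f.1 (L.pt k).1 (L.pt k).2) k

/-- A substitute for injectivity of the connecting maps. Otherwise, by compactness, finitely many
elements of the kernel of `ι k` have no common zero. Their images are small at a late stage, and the
fibre over any point there contains a block over a point of stage `k`, at which all of them would be
small at once. -/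
theorem IsInductiveLimit.exists_point (hι : IsInductiveLimit φ ι) (hA : IsSimple A)
    (hφ : ∀ j, IsDiagonal (φ j)) (k : ℕ) :
    ∃ x : Σ i, (D k).X i, ∀ a : (D k).Alg, ι k a = 0 → a.1 x.1 x.2 = 0 := by
  by_contra! hne
  choose a ha0 hax using hne
  have hcont : ∀ a : (D k).Alg, Continuous fun q : Σ i, (D k).X i => ‖a.1 q.1 q.2‖ := fun a =>
    continuous_norm_sigma a
  obtain ⟨t, -, ht⟩ := isCompact_univ.elim_nhds_subcover
    (fun p : Σ i, (D k).X i => {q : Σ i, (D k).X i | ‖(a p).1 q.1 q.2‖ ≠ 0}) fun p _ =>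
      (isOpen_ne_fun (hcont (a p)) continuous_const).mem_nhds (norm_ne_zero_iff.2 (hax p))
  have hne := IsInductiveLimit.nonempty_points hA ι k
  obtain ⟨q₀, -, hq₀⟩ := isCompact_univ.exists_isMinOn
    (f := fun q : Σ i, (D k).X i => ∑ p ∈ t, ‖(a p).1 q.1 q.2‖) Set.univ_nonempty
    (continuous_finsetSum t fun p _ => hcont (a p)).continuousOn
  set c := ∑ p ∈ t, ‖(a p).1 q₀.1 q₀.2‖ with hc
  have hc0 : 0 < c := by
    obtain ⟨p, hp, hpq⟩ := Set.mem_iUnion₂.1 (ht (Set.mem_univ q₀))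
    exact Finset.sum_pos' (fun _ _ => norm_nonneg _)
      ⟨p, hp, lt_of_le_of_ne (norm_nonneg _) (Ne.symm hpq)⟩
  have hsmall : ∀ p, ∃ l₀, ∀ l (hl : k ≤ l), l₀ ≤ l →
      ‖transition φ hl (a p)‖ < c / (t.card + 1) := fun p =>
    hι.exists_norm_lt (by rw [ha0, norm_zero]; positivity)
  choose l₀ hl₀ using hsmall
  have hkl : k ≤ k + t.sup l₀ := Nat.le_add_right _ _
  obtain ⟨i, z⟩ := IsInductiveLimit.nonempty_points hA ι (k + t.sup l₀)
  obtain ⟨L, hL⟩ := isDiagonal_transition hφ hkl i z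
  set q : Fin L.t := ⟨0, L.t_pos ((D _).n_pos i)⟩
  have h1 : c ≤ ∑ p ∈ t, ‖(a p).1 (L.pt q).1 (L.pt q).2‖ := hq₀ (Set.mem_univ (L.pt q))
  have h2 : ∑ p ∈ t, ‖(a p).1 (L.pt q).1 (L.pt q).2‖ ≤ ∑ _p ∈ t, c / (t.card + 1) := by
    refine Finset.sum_le_sum fun p hp => ?_
    refine (L.norm_apply_le (a p) q).trans ?_
    rw [← hL]
    exact (CompositionSequence.Alg.norm_apply_le _ _ _).trans
      (hl₀ p _ hkl ((Finset.le_sup hp).trans (Nat.le_add_left _ _))).le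
  rw [Finset.sum_const, nsmul_eq_mul, mul_div_assoc'] at h2
  have h3 := h1.trans h2
  rw [le_div_iff₀ (by positivity)] at h3
  nlinarith

/-- There is a point at which all elements vanish which vanish in the limit; such a point of minimal
stage is outside of the closed subset along which this stage is attached. -/
theorem IsInductiveLimit.exists_point_notMem (hι : IsInductiveLimit φ ι) (hA : IsSimple A)
    (hφ : ∀ j, IsDiagonal (φ j)) (k : ℕ) :
    ∃ i, ∃ x : (D k).X i, x ∉ (D k).Y i ∧ ∀ a : (D k).Alg, ι k a = 0 → a.1 i x = 0 := by
  obtain ⟨⟨i, x⟩, hx⟩ := hι.exists_point hA hφ k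
  induction i using WellFoundedLT.induction with
  | ind i ih =>
    by_cases hY : x ∈ (D k).Y i
    · set L := (D k).list i ⟨x, hY⟩
      set q : Fin L.t := ⟨0, L.t_pos ((D _).n_pos i)⟩
      refine ih (L.pt q).1 ((D k).list_lt i ⟨x, hY⟩ q) (L.pt q).2 fun a ha => ?_
      have h1 := L.norm_apply_le a q
      have h2 : L.eval a.1 = 0 := (a.2 i ⟨x, hY⟩).symm.trans (hx a ha)
      rw [h2, norm_zero] at h1
      exact norm_le_zero_iff.1 h1
    · exact ⟨i, x, hY, hx⟩

/-- The positive part `a` of `ε ^ 2 - star f * f` survives, as zero is in the spectrum of the limit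
of `star f * f`. At late stages `a` vanishes nowhere, so every fibre has a block on which `a` is
non-zero, and there `f` is close to a singular matrix. `R` is a pointwise choice without any
continuity. -/
theorem IsInductiveLimit.exists_singular (hι : IsInductiveLimit φ ι) (hA : IsSimple A) {j : ℕ}
    {f : (D j).Alg} (hf : ¬ IsUnit (ι j (star f * f))) {ε : ℝ} (hε : 0 < ε) :
    ∃ R : ∀ i, (D j).X i → Mat ((D j).n i), (∀ i x s t, ‖R i x s t - f.1 i x s t‖ ≤ ε) ∧
      ∃ k₀, ∀ k (hk : j ≤ k), k₀ ≤ k → ∀ i (x : (D k).X i)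
        (L : PointList (D j).X (D j).n ((D k).n i)),
        (∀ a, (transition φ hk a).1 i x = L.eval a.1) →
        ∃ q, (R (L.pt q).1 (L.pt q).2).det = 0 := by
  classical
  have hnt := hA.1
  set a : (D j).Alg := cfc (fun t : ℝ => max 0 (ε ^ 2 - t)) (star f * f) with ha
  have hsa : IsSelfAdjoint (ι j (star f * f)) := by
    rw [map_mul, map_star]
    exact IsSelfAdjoint.star_mul_self _
  have ha0 : ι j a ≠ 0 := by
    have h1 : ι j a = cfc (fun t : ℝ => max 0 (ε ^ 2 - t)) (ι j (star f * f)) := by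
      exact StarAlgHom.map_cfc (ι j) _ _ (by fun_prop) (continuous_of_starAlgHom (ι j))
        (IsSelfAdjoint.star_mul_self f) hsa
    rw [h1]
    have h2 := norm_apply_le_norm_cfc (fun t : ℝ => max 0 (ε ^ 2 - t)) (ι j (star f * f))
      (x := 0) ((spectrum.zero_mem_iff ℝ).2 hf) (by fun_prop) hsa
    intro h3
    rw [h3, norm_zero, sub_zero, norm_le_zero_iff] at h2
    have : 0 < max 0 (ε ^ 2) := lt_max_of_lt_right (by positivity)
    exact this.ne' h2
  obtain ⟨δ, hδ, k₀, hk₀⟩ := hι.exists_forall_le_norm hA ha0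
  have hR : ∀ i (x : (D j).X i), ∃ B' : Mat ((D j).n i), (a.1 i x ≠ 0 → B'.det = 0) ∧
      ∀ s t, ‖B' s t - f.1 i x s t‖ ≤ ε := by
    intro i x
    by_cases h : a.1 i x = 0
    · exact ⟨f.1 i x, fun h' => absurd h h', fun s t => by rw [sub_self, norm_zero]; exact hε.le⟩
    · obtain ⟨B', h1, h2⟩ := CompositionSequence.exists_singular_of_cfc_ne_zero f hε i x h
      exact ⟨B', fun _ => h1, h2⟩
  choose R hR1 hR2 using hR
  refine ⟨R, hR2, k₀, fun k hk hkk i x L hL => ?_⟩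
  by_contra! hne
  have h1 := hk₀ k hk hkk i x
  have h2 : (transition φ hk a).1 i x = 0 := by
    have h3 : ∀ q, a.1 (L.pt q).1 (L.pt q).2 = 0 := fun q => by
      by_contra h4
      exact hne q (hR1 _ _ h4)
    rw [hL, PointList.eval_eq]
    refine ((eq_diag_iff L.sum_dim).2 ⟨fun q a b => ?_, fun _ _ _ _ _ => rfl⟩).symm
    rw [h3]
    rfl
  rw [h2, norm_zero] at h1
  exact absurd h1 (not_le.2 hδ)

end Limit

/-! ### Images of banded elements far out in the system -/

section Transfer

open CompositionSequence

variable {E G H : CompositionSequence.{u}}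

/-- The diagonal element with given diagonal entries. -/
noncomputable def CompositionSequence.PosFun.toAlg (δ : E.PosFun) : E.Alg :=
  δ.lower 0 fun _ _ _ h1 h2 => absurd (h1.trans_le h2) (lt_irrefl _)

theorem CompositionSequence.PosFun.toAlg_apply (δ : E.PosFun) (i) (x : E.X i) :
    δ.toAlg.1 i x = Matrix.diagonal fun p : Fin (E.n i) => (δ i x p : ℂ) := by
  ext a b
  simp only [PosFun.toAlg, PosFun.lower_apply, lowerMat, Matrix.of_apply, Matrix.diagonal_apply,
    add_zero, Fin.ext_iff]
  split_ifs with h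
  · rw [h]
  · rfl

theorem ofAlg_map_toAlg {ω : E.Alg →⋆ₐ[ℂ] H.Alg} {δ : E.PosFun} {i : Fin H.length} {x : H.X i}
    (L : PointList E.X E.n (H.n i)) (hL : ∀ f, (ω f).1 i x = L.eval f.1) (k : Fin L.t) {a : ℕ}
    (ha : a < E.n (L.pt k).1) :
    PosFun.ofAlg (ω δ.toAlg) i x (L.off k + a) = δ (L.pt k).1 (L.pt k).2 a := by
  rw [PosFun.ofAlg_off_add L (hL _) k ha]
  have := PosFun.ofAlg_apply δ.toAlg (L.pt k).1 (L.pt k).2 ⟨a, ha⟩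
  rw [PosFun.toAlg_apply, Matrix.diagonal_apply_eq, Complex.ofReal_re] at this
  exact this

/-- The image of a non-negative diagonal element is diagonal with non-negative entries, so its norm
is its largest entry. -/
theorem exists_le_ofAlg_map_toAlg {ψ : E.Alg →⋆ₐ[ℂ] G.Alg} (hψ : IsDiagonal ψ) {ζ : E.PosFun}
    (hζ0 : ∀ i x p, 0 ≤ ζ i x p) {δ : ℝ} (hδ : 0 < δ) {i : Fin G.length} {x : G.X i}
    (hx : δ ≤ ‖(ψ ζ.toAlg).1 i x‖) :
    ∃ p < G.n i, δ ≤ PosFun.ofAlg (ψ ζ.toAlg) i x p := by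
  obtain ⟨L, hL⟩ := hψ i x
  obtain ⟨d, hd, hd'⟩ := diag_diagonal L.sum_dim fun k a => (ζ (L.pt k).1 (L.pt k).2 a : ℂ)
  have h1 : (ψ ζ.toAlg).1 i x = Matrix.diagonal d := by
    rw [hL, PointList.eval_eq, ← hd]
    congr 1
    funext k
    exact PosFun.toAlg_apply _ _ _
  rw [h1, Matrix.l2_opNorm_diagonal] at hx
  by_contra! hlt
  refine absurd hx (not_le.2 ((pi_norm_lt_iff hδ).2 fun p => ?_))
  obtain ⟨k, a, rfl⟩ := exists_blockPos L.sum_dim p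
  have h2 := hlt _ (blockPos _ L.sum_dim k a).2
  rw [blockPos_val, ofAlg_map_toAlg L hL k a.2] at h2
  rw [hd', Complex.norm_real, Real.norm_of_nonneg (hζ0 _ _ _)]
  exact h2

/-- Band width and zero rows are inherited from the blocks over `E`. Every fibre of `G` contains a
position where `ζ` is at least `δ`, and fibres of `H` consist of such fibres, so gaps recur within
`2 * G.maxDim` positions. Dividing by `δ` and clamping raises their marks to one. -/
theorem map_mem_closure_units {ψ : E.Alg →⋆ₐ[ℂ] G.Alg} {χ : G.Alg →⋆ₐ[ℂ] H.Alg}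
    {ω : E.Alg →⋆ₐ[ℂ] H.Alg} (hω : ∀ f, ω f = χ (ψ f)) (hψ : IsDiagonal ψ) (hχ : IsDiagonal χ)
    (hωd : IsDiagonal ω) {K : ℕ} (hK : 0 < K) {f : E.Alg} (hf : ∀ i x, Banded K (f.1 i x))
    (h ζ : E.PosFun) (hfh : ∀ i x (a b : Fin (E.n i)), f.1 i x a b ≠ 0 → h i x a = 1)
    (hζ : ∀ i x, ∀ p < E.n i, ζ i x p ≠ 0 → p + 2 * K ≤ E.n i ∧
      ∀ q, p ≤ q → q < p + 2 * K → h i x q = 0)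
    (hζ0 : ∀ i x p, 0 ≤ ζ i x p) {δ : ℝ} (hδ : 0 < δ)
    (hζδ : ∀ i x, δ ≤ ‖(ψ ζ.toAlg).1 i x‖)
    (hN : ∀ i, ∀ _ : H.X i, 2 * G.maxDim + 4 * K + 1 ≤ H.n i) :
    ω f ∈ closure {a : H.Alg | IsUnit a} := by
  have hg : Continuous fun t : ℝ => clamp (t / δ) := continuous_clamp.comp (by fun_prop)
  refine mem_closure_units_of_banded hK (fun i x => ?_) (PosFun.ofAlg (ω h.toAlg))
    ((PosFun.ofAlg (ω ζ.toAlg)).comp (fun t => clamp (t / δ)) hg) (fun i x a b hab => ?_)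
    (fun i x p hp hne => ?_) (fun i x p hp => ?_) hN
  · obtain ⟨L, hL⟩ := hωd i x
    rw [hL, PointList.eval_eq]
    exact banded_diag _ fun k => hf _ _
  · obtain ⟨L, hL⟩ := hωd i x
    obtain ⟨k, a, rfl⟩ := exists_blockPos L.sum_dim a
    obtain ⟨k', b, rfl⟩ := exists_blockPos L.sum_dim b
    rw [hL, PointList.eval_eq] at hab
    by_cases hkk : k = k'
    · subst hkk
      rw [diag_blockPos_self] at hab
      rw [blockPos_val, ofAlg_map_toAlg L hL k a.2]
      exact hfh _ _ a b hab
    · exact absurd (diag_blockPos_of_ne L.sum_dim _ hkk a b) hab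
  · obtain ⟨L, hL⟩ := hωd i x
    obtain ⟨k, a, ha, rfl⟩ := exists_eq_offset_add L.sum_dim hp
    have h1 := offset_add_le L.sum_dim k
    rw [PosFun.comp_apply, ofAlg_map_toAlg L hL k ha] at hne
    have h2 : ζ (L.pt k).1 (L.pt k).2 a ≠ 0 := by
      intro h0
      rw [h0, zero_div] at hne
      exact hne (clamp_of_nonpos le_rfl)
    obtain ⟨h3, h4⟩ := hζ _ _ a ha h2
    refine ⟨by omega, fun q hq1 hq2 => ?_⟩
    obtain ⟨c, rfl⟩ := Nat.exists_eq_add_of_le hq1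
    rw [add_assoc, ofAlg_map_toAlg L hL k (a := a + c) (by omega)]
    exact h4 _ (by omega) (by omega)
  · obtain ⟨L, hL⟩ := hχ i x
    have hdim : ∀ k, G.n (L.pt k).1 ≤ G.maxDim := fun k => n_le_maxDim _
    have hpos : 0 < G.maxDim := by
      have h1 := L.t_pos (H.n_pos i)
      exact (G.n_pos _).trans_le (hdim ⟨0, h1⟩)
    -- The block from `G` around the middle of the window has size at most half the window, so it
    -- lies inside.
    obtain ⟨k, a, ha, e⟩ := exists_eq_offset_add L.sum_dim (p := p + G.maxDim) (by omega)
    have h1 := hdim k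
    obtain ⟨c, hc, h2⟩ := exists_le_ofAlg_map_toAlg hψ hζ0 hδ (hζδ (L.pt k).1 (L.pt k).2)
    refine ⟨L.off k + c, by simp only [PointList.off]; omega,
      by simp only [PointList.off]; omega, ?_⟩
    rw [PosFun.comp_apply, hω, PosFun.ofAlg_off_add L (hL _) k hc]
    exact clamp_of_one_le ((one_le_div hδ).2 h2)

end Transfer

/-! ### Joining singular blocks -/

theorem PointList.t_le_card_join {l l' : ℕ} {X : Fin l → Type*} {n : Fin l → ℕ}
    {X' : Fin l' → Type*} {n' : Fin l' → ℕ} {N : ℕ} (L : PointList X n N)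
    (M : ∀ k, PointList X' n' (n (L.pt k).1)) (P : (Σ i, X' i) → Prop) [DecidablePred P]
    (h : ∀ k, ∃ q, P ((M k).pt q)) :
    L.t ≤ (Finset.univ.filter fun q => P ((L.join M).pt q)).card := by
  choose c hc using h
  have h1 := Finset.card_le_card_of_injOn (s := (Finset.univ : Finset (Fin L.t)))
    (t := Finset.univ.filter fun q => P ((L.join M).pt q))
    (fun k => (finSigmaFinEquiv ⟨k, c k⟩ : Fin (∑ k, (M k).t))) (fun k _ => ?_) fun k _ k' _ e => ?_
  · rwa [Finset.card_univ, Fintype.card_fin] at h1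
  · have h2 : ∀ s : Σ k, Fin (M k).t, s = ⟨k, c k⟩ → P ((M s.1).pt s.2) := by
      rintro _ rfl
      exact hc k
    exact Finset.mem_coe.2 (Finset.mem_filter.2
      ⟨Finset.mem_univ _, h2 _ (finSigmaFinEquiv.symm_apply_apply _)⟩)
  · have := finSigmaFinEquiv.injective e
    exact congrArg Sigma.fst this

theorem PointList.le_t_mul_maxDim {E : CompositionSequence.{u}} {N : ℕ} (L : PointList E.X E.n N) :
    N ≤ L.t * E.maxDim := by
  have := Finset.sum_le_card_nsmul (Finset.univ : Finset (Fin L.t)) (fun k => E.n (L.pt k).1)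
    E.maxDim fun k _ => CompositionSequence.n_le_maxDim (L.pt k).1
  rwa [L.sum_dim, Finset.card_univ, Fintype.card_fin, smul_eq_mul] at this

theorem PointList.t_le {E : CompositionSequence.{u}} {N : ℕ} (L : PointList E.X E.n N) :
    L.t ≤ N := by
  have := Finset.card_nsmul_le_sum (Finset.univ : Finset (Fin L.t)) (fun k => E.n (L.pt k).1) 1
    fun k _ => E.n_pos _
  rwa [L.sum_dim, Finset.card_univ, Fintype.card_fin, smul_eq_mul, mul_one] at this

theorem norm_diag_sub_diag_le {t : ℕ} {m : Fin t → ℕ} {N : ℕ} (h : ∑ k, m k = N)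
    {B C : ∀ k, Mat (m k)} {ε : ℝ} (hε : 0 ≤ ε) (hBC : ∀ k a b, ‖B k a b - C k a b‖ ≤ ε)
    (p q : Fin N) : ‖diag m h B p q - diag m h C p q‖ ≤ ε := by
  obtain ⟨k, a, rfl⟩ := exists_blockPos h p
  obtain ⟨k', b, rfl⟩ := exists_blockPos h q
  by_cases hk : k = k'
  · subst hk
    rw [diag_blockPos_self, diag_blockPos_self]
    exact hBC k a b
  · rw [diag_blockPos_of_ne h B hk, diag_blockPos_of_ne h C hk, sub_self, norm_zero]
    exact hε

/-- If the value of a banded element at a point outside of `Y i₀` has many blocks which are almost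
singular, then a perturbation of the element is, up to invertible factors, a banded element with
zero rows. -/
theorem CompositionSequence.exists_perturbation {D E G : CompositionSequence.{u}}
    {ψ : D.Alg →⋆ₐ[ℂ] E.Alg} {χ : E.Alg →⋆ₐ[ℂ] G.Alg} {ω : D.Alg →⋆ₐ[ℂ] G.Alg}
    (hω : ∀ f, ω f = χ (ψ f)) (hψ : IsDiagonal ψ) (hχ : IsDiagonal χ) (hωd : IsDiagonal ω)
    {K : ℕ} (hK : D.maxDim < K) {f : D.Alg} {ε : ℝ} (hε : 0 < ε)
    {R : ∀ i, D.X i → Mat (D.n i)} (hR : ∀ i x s t, ‖R i x s t - f.1 i x s t‖ ≤ ε)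
    (hsing : ∀ i (x : E.X i) (L : PointList D.X D.n (E.n i)),
      (∀ a, (ψ a).1 i x = L.eval a.1) → ∃ q, (R (L.pt q).1 (L.pt q).2).det = 0)
    (hN : ∀ i, ∀ _ : G.X i, 2 * K * (E.maxDim + 1) ≤ G.n i) {i₀ : Fin G.length} {x₀ : G.X i₀}
    (hx₀ : x₀ ∉ G.Y i₀) :
    ∃ (U f' W : G.Alg) (h ζ : G.PosFun), IsUnit U ∧ IsUnit W ∧
      ‖U * f' * W - ω f‖ ≤ 2 * K * (2 * ε) ∧ (∀ i x, Banded K (f'.1 i x)) ∧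
      (∀ i x (a b : Fin (G.n i)), f'.1 i x a b ≠ 0 → h i x a = 1) ∧
      (∀ i x, ∀ p < G.n i, ζ i x p ≠ 0 → p + 2 * K ≤ G.n i ∧
        ∀ q, p ≤ q → q < p + 2 * K → h i x q = 0) ∧
      (∀ i x p, 0 ≤ ζ i x p) ∧ ζ i₀ x₀ 0 = 1 := by
  classical
  obtain ⟨L, hL⟩ := hχ i₀ x₀
  choose M hM using fun k => hψ (L.pt k).1 (L.pt k).2
  have hcard := L.t_le_card_join M (fun x => (R x.1 x.2).det = 0) fun k => hsing _ _ (M k) (hM k)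
  have hL1 := L.le_t_mul_maxDim
  have hL2 := hN i₀ x₀
  -- Blocks from `E` have size at most `E.maxDim`, so there are at least `2 * K` of them, each
  -- containing an almost singular block from `D`.
  have hr : 2 * K ≤ L.t := by
    by_contra! hlt
    have h1 : L.t * E.maxDim ≤ 2 * K * E.maxDim := Nat.mul_le_mul_right _ hlt.le
    rw [mul_add, mul_one] at hL2
    omega
  have hband : ∀ i x, Banded K ((ω f).1 i x) := by
    intro i x
    obtain ⟨L', hL'⟩ := hωd i x
    rw [hL', PointList.eval_eq]
    exact banded_diag _ fun k => banded_of_le ((n_le_maxDim _).trans hK.le) _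
  have hval : (ω f).1 i₀ x₀ = (L.join M).eval f.1 := by
    rw [hω, hL]
    exact L.eval_join M f fun k => hM k f
  have hD := (D.n_pos ⟨0, D.length_pos⟩).trans_le (n_le_maxDim _)
  -- Blocks of size at most `K - 1` can be deformed within band width `K`; `2 * K` zero rows are the
  -- gap length that the moving of rows requires.
  obtain ⟨F, hF, hF0⟩ := exists_bandedJoined (K := K - 1) (r := 2 * K) (L.join M).sum_dim
    (fun q => R ((L.join M).pt q).1 ((L.join M).pt q).2) (by omega)
    (fun q => (n_le_maxDim _).trans (by omega)) (hr.trans hcard)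
  rw [Nat.sub_add_cancel (by omega)] at hF
  obtain ⟨U, f', W, h, ζ, hU, hW, h1, h2, h3, h4, h5, h6, h7⟩ := exists_banded_exchange hx₀ hband hε
    (fun s t => by
      rw [hval, PointList.eval_eq]
      exact norm_diag_sub_diag_le _ hε.le (fun q => hR _ _) s t) hF hF0 (hr.trans L.t_le)
  refine ⟨U, f', W, h, ζ, hU, hW, ?_, h3, h4, h5, h6, h7⟩
  refine Alg.norm_le (by positivity) fun i x => ?_
  refine Banded.norm_le (fun a b hab => ?_) (by positivity) fun a b => ?_
  · by_cases h0 : (U * f' * W).1 i x a b = 0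
    · refine hband i x a b fun h0' => hab ?_
      rw [Alg.sub_apply, Matrix.sub_apply, h0, h0', sub_zero]
    · exact h2 i x a b h0
  · rw [Alg.sub_apply, Matrix.sub_apply]
    exact h1 i x a b

/-! ### Stable rank one -/

section Limit

variable {D : ℕ → CompositionSequence.{u}} {φ : ∀ j, (D j).Alg →⋆ₐ[ℂ] (D (j + 1)).Alg}
  {A : Type v} [CStarAlgebra A] {ι : ∀ j, (D j).Alg →⋆ₐ[ℂ] A}

theorem map_mem_closure_units_of_mem {E : CompositionSequence.{u}} (κ : E.Alg →⋆ₐ[ℂ] A) {f : E.Alg}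
    (hf : f ∈ closure {a : E.Alg | IsUnit a}) : κ f ∈ closure {a : A | IsUnit a} :=
  map_mem_closure (continuous_of_starAlgHom κ) hf fun _ hu => hu.map κ

theorem toAlg_map_ne_zero {E : CompositionSequence.{u}} (κ : E.Alg →⋆ₐ[ℂ] A) {ζ : E.PosFun}
    {i : Fin E.length} {x : E.X i} (hx : ∀ a : E.Alg, κ a = 0 → a.1 i x = 0) (hζ : ζ i x 0 = 1) :
    κ ζ.toAlg ≠ 0 := by
  intro h
  have h1 := congrFun (congrFun (hx _ h) ⟨0, E.n_pos i⟩) ⟨0, E.n_pos i⟩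
  rw [CompositionSequence.PosFun.toAlg_apply, Matrix.diagonal_apply_eq] at h1
  simp [hζ] at h1

theorem map_mul_mul_mem_closure_units {E : CompositionSequence.{u}} (κ : E.Alg →⋆ₐ[ℂ] A)
    {U f W : E.Alg} (hU : IsUnit U) (hW : IsUnit W) (hf : κ f ∈ closure {a : A | IsUnit a}) :
    κ (U * f * W) ∈ closure {a : A | IsUnit a} := by
  rw [map_mul, map_mul]
  exact mul_mem_closure_units (mul_mem_closure_units (subset_closure (hU.map κ)) hf)
    (subset_closure (hW.map κ))

theorem dist_map_le {E : CompositionSequence.{u}} (κ : E.Alg →⋆ₐ[ℂ] A) (f g : E.Alg) :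
    dist (κ f) (κ g) ≤ ‖g - f‖ := by
  rw [dist_comm, dist_eq_norm, ← map_sub]
  exact NonUnitalStarAlgHom.norm_apply_le κ _

theorem isUnit_of_isUnit_mul_of_isUnit_mul {M : Type*} [Monoid M] {a b : M} (h : IsUnit (b * a))
    (h' : IsUnit (a * b)) : IsUnit a := by
  obtain ⟨u, hu⟩ := h
  obtain ⟨w, hw⟩ := h'
  have h1 : ↑u⁻¹ * b * a = 1 := by rw [mul_assoc, ← hu, Units.inv_mul]
  have h2 : a * (b * ↑w⁻¹) = 1 := by rw [← mul_assoc, ← hw, Units.mul_inv]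
  exact isUnit_iff_exists_and_exists.2 ⟨⟨_, h2⟩, ⟨_, h1⟩⟩

/-- Four successive stages are used. At `l` every fibre has an almost singular block of `f`. At `m`
every fibre consists of so many fibres of `l` that `2 * K` zero rows can be created. At `p` the
function marking these gaps is bounded below everywhere. At `q` the fibres are large compared with
those of `p`, so the gaps recur. -/
theorem IsInductiveLimit.mem_closure_units_of_not_isUnit (hι : IsInductiveLimit φ ι)
    (hA : IsSimple A) (hφ : ∀ j, IsDiagonal (φ j))
    (hgrow : ∀ N, ∃ J, ∀ k, J ≤ k → ∀ i, ∀ _ : (D k).X i, N ≤ (D k).n i) {j : ℕ} {f : (D j).Alg}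
    (hf : ¬ IsUnit (ι j (star f * f))) : ι j f ∈ closure {a : A | IsUnit a} := by
  rw [← closure_closure, Metric.mem_closure_iff]
  intro ε hε
  set K := (D j).maxDim + 1 with hK
  -- The exchange doubles the entrywise error and the band estimate multiplies it by `2 * K`; the
  -- total is `ε / 2`.
  obtain ⟨R, hR, k₀, hsing⟩ := hι.exists_singular hA hf
    (show 0 < ε / (8 * K) by positivity)
  have h1 : j ≤ j + k₀ := Nat.le_add_right _ _
  have hsing' := hsing _ h1 (Nat.le_add_left _ _)
  generalize j + k₀ = l at h1 hsing'
  obtain ⟨m, h2, hm⟩ : ∃ m, ∃ _ : l ≤ m, ∀ i, ∀ _ : (D m).X i,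
      2 * K * ((D l).maxDim + 1) ≤ (D m).n i := by
    obtain ⟨J, hJ⟩ := hgrow (2 * K * ((D l).maxDim + 1))
    exact ⟨l + J, Nat.le_add_right _ _, hJ _ (Nat.le_add_left _ _)⟩
  -- As the kernel of `ι m` vanishes at `x₀`, an element that is non-zero there, such as the one
  -- given by `ζ`, survives in the limit.
  obtain ⟨i₀, x₀, hY, hx₀⟩ := hι.exists_point_notMem hA hφ m
  obtain ⟨U, f', W, h, ζ, hU, hW, hnorm, hband, hfh, hζ, hζ0, hζ1⟩ :=
    CompositionSequence.exists_perturbation (fun f => (transition_transition φ h1 h2 f).symm)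
      (isDiagonal_transition hφ h1) (isDiagonal_transition hφ h2)
      (isDiagonal_transition hφ (h1.trans h2)) (Nat.lt_succ_self _) (by positivity) hR hsing' hm hY
  obtain ⟨δ, hδ, p, h3, hp⟩ : ∃ δ > 0, ∃ p, ∃ h3 : m ≤ p,
      ∀ i x, δ ≤ ‖(transition φ h3 ζ.toAlg).1 i x‖ := by
    obtain ⟨δ, hδ, k₁, hk₁⟩ := hι.exists_forall_le_norm hA (toAlg_map_ne_zero (ι m) hx₀ hζ1)
    exact ⟨δ, hδ, m + k₁, Nat.le_add_right _ _, hk₁ _ _ (Nat.le_add_left _ _)⟩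
  obtain ⟨q, h4, hq⟩ : ∃ q, ∃ _ : p ≤ q, ∀ i, ∀ _ : (D q).X i,
      2 * (D p).maxDim + 4 * K + 1 ≤ (D q).n i := by
    obtain ⟨J, hJ⟩ := hgrow (2 * (D p).maxDim + 4 * K + 1)
    exact ⟨p + J, Nat.le_add_right _ _, hJ _ (Nat.le_add_left _ _)⟩
  have h5 := map_mem_closure_units (fun f => (transition_transition φ h3 h4 f).symm)
    (isDiagonal_transition hφ h3) (isDiagonal_transition hφ h4)
    (isDiagonal_transition hφ (h3.trans h4)) (Nat.succ_pos _) hband h ζ hfh hζ hζ0 hδ hp hq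
  have h6 := map_mem_closure_units_of_mem (ι q) h5
  rw [hι.transition_apply] at h6
  refine ⟨ι m (U * f' * W), map_mul_mul_mem_closure_units (ι m) hU hW h6, ?_⟩
  rw [← hι.transition_apply (h1.trans h2) f]
  refine (dist_map_le (ι m) _ _).trans_lt (hnorm.trans_lt ?_)
  have hK0 : (0 : ℝ) < K := by positivity
  have e : 2 * (K : ℝ) * (2 * (ε / (8 * K))) = ε / 2 := by
    field_simp
    norm_num
  rw [e]
  exact half_lt_self hε

theorem IsInductiveLimit.range_subset_closure_units (hι : IsInductiveLimit φ ι)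
    (hA : IsSimple A) (hφ : ∀ j, IsDiagonal (φ j)) (j : ℕ) (f : (D j).Alg) :
    ι j f ∈ closure {a : A | IsUnit a} := by
  -- Growth is demanded only at actual points: matrix sizes over empty spaces `X i` are irrelevant.
  by_cases hgrow : ∀ N, ∃ J, ∀ k, J ≤ k → ∀ i, ∀ _ : (D k).X i, N ≤ (D k).n i
  · by_cases h1 : IsUnit (ι j (star f * f))
    · by_cases h2 : IsUnit (ι j (star (star f) * star f))
      · rw [map_mul] at h1 h2
        rw [star_star] at h2
        exact subset_closure (isUnit_of_isUnit_mul_of_isUnit_mul h1 h2)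
      · have h3 := star_mem_closure_units (hι.mem_closure_units_of_not_isUnit hA hφ hgrow h2)
        rwa [map_star, star_star] at h3
    · exact hι.mem_closure_units_of_not_isUnit hA hφ hgrow h1
  · push Not at hgrow
    obtain ⟨N, hN⟩ := hgrow
    refine hι.mem_closure_units_of_bounded hA (N := N) (fun J => ?_) j f
    obtain ⟨k, hk, i, x, hx⟩ := hN J
    exact ⟨k, hk, i, x, hx⟩

end Limit

end Instances

end DSH

theorem theorem5p1 (D : ℕ → DSH.CompositionSequence.{u})
    (φ : ∀ j, (D j).Alg →⋆ₐ[ℂ] (D (j + 1)).Alg)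
    (hφ : ∀ j, DSH.IsDiagonal (φ j))
    (A : Type v) [CStarAlgebra A] (ι : ∀ j, (D j).Alg →⋆ₐ[ℂ] A)
    (hι : DSH.IsInductiveLimit φ ι) (hA : DSH.IsSimple A) :
    DSH.HasStableRankOne A := by
  refine dense_closure.1 (hι.dense.mono (Set.iUnion_subset fun j => ?_))
  rintro _ ⟨f, rfl⟩
  exact DSH.IsInductiveLimit.range_subset_closure_units hι hA hφ j f
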